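/- Let $k$ be a field of characteristic $0$. Let $K_0(\mathrm{Var}_k)$ be the Grothendieck ring of varieties over $k$, $L=[\mathbb A^1]$, and, for $d\ge 1$, let $\mathcal R_d$ be the subring of the localization of $K_0(\mathrm{Var}_k)[T]/(LT^d-1)$ (with $L^{-1/d}:=\bar T$) at the elements $L^{i/d}-1$, $i\in\mathbb Z\setminus\{0\}$, that is generated by $K_0(\mathrm{Var}_k)$, $L^{-1}$ and the fractions $(L-1)/(L^{i/d}-1)$, $i\in\mathbb Z\setminus\{0\}$. Let $V$ be a smooth variety of dimension $n$ over $k$ and $\omega\in(\Omega^n_{k(V)})^{\otimes d}$ a nonzero $d$-fold rational $n$-form, considered as a multi-valued form $\omega^{1/d}$ with divisor $\operatorname{div}\omega^{1/d}=\frac1d\operatorname{div}\omega=\sum_{i\in S}(\alpha_i-1)E_i$ (with $E_i$ the irreducible components of its support). If this divisor has (simple) normal crossings and $\omega^{1/d}$ has no logarithmic poles (all $\alpha_i\neq0$), put $$PV\!\int_V\omega^{1/d}=L^{-n}\sum_{I\subset S}[E_I^\circ]\prod_{i\in I}\frac{L-1}{L^{\alpha_i}-1}\in\mathcal R_d,\qquad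 E_I^\circ=\Big(\bigcap_{i\in I}E_i\Big)\setminus\Big(\bigcup_{l\notin I}E_l\Big).$$ The projective plane over $k$ is a smooth complete surface of Kodaira dimension $-\infty$, and the following holds. (a) On $\mathbb P^2=\mathbb P^2_{(X:Y:Z)}$ let $\omega^{1/2}=y^{-3/2}dx\,dy$, where $x=X/Z$, $y=Y/Z$, i.e. $\omega=y^{-3}(dx\wedge dy)^{\otimes 2}$. In the coordinates $Y/X$, $Z/X$, again denoted $y,z$, one has $\omega^{1/2}=y^{-3/2}z^{-3/2}dy\,dz$. With $C_1=\{Y=0\}$ and $C_2=\{Z=0\}$, $\operatorname{div}\omega^{1/2}=-\frac32C_1-\frac32C_2$; this is a normal crossings divisor, there are no logarithmic poles, and $$PV\!\int_{\mathbb P^2}\omega^{1/2}=L^{-2}\Big(L^2-L+2L\frac{L-1}{L^{-1/2}-1}+\frac{(L-1)^2}{(L^{-1/2}-1)^2}\Big)=0 .$$ (b) There is a birational map $\pi:\mathbb P^2_{(X':Y':Z')}\dashrightarrow\mathbb P^2_{(X:Y:Z)}$ over $k$ which is given in affine coordinates by $(x',y')\mapsto(x',y'-x'^2)$. On $\mathbb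 P^2_{(X':Y':Z')}$ the form $\pi^*\omega^{1/2}$ is $(y'-x'^2)^{-3/2}dx'\,dy'$, and $(y'z'-1)^{-3/2}dy'\,dz'$ in the coordinates $y'=Y'/X'$, $z'=Z'/X'$. Its divisor is $-\frac32\,\{Y'Z'-X'^2=0\}$, where the conic $\{Y'Z'-X'^2=0\}$ is a prime divisor; it is a normal crossings divisor, there are no logarithmic poles, and $$PV\!\int_{\mathbb P^2_{(X':Y':Z')}}\pi^*\omega^{1/2}=L^{-2}\Big(L^2+(L+1)\frac{L-1}{L^{-1/2}-1}\Big)=-L^{-3/2}\big(L+L^{1/2}+1\big)\neq0 .$$ (c) Consequently the principal value integral is not a birational invariant in the birational equivalence class of $\mathbb P^2$ (which has Kodaira dimension $-\infty$): it is not true that for every nonzero multi-valued form $\omega^{1/d}$ on this class, $PV\!\int_{V_1}\omega^{1/d}=PV\!\int_{V_2}\omega^{1/d}$ for any two smooth complete models $V_1,V_2$ on which the divisor of $\omega^{1/d}$ is a normal crossings divisor and $\omega^{1/d}$ has no logarithmic poles. -/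

import Mathlib

open CategoryTheory AlgebraicGeometry
open scoped TensorProduct KaehlerDifferential

universe u

noncomputable section

namespace MotivicPV

/-! ### Varieties and the Grothendieck ring -/

/-- A variety over `k`, in the broad sense of the Grothendieck ring: a reduced separated scheme of
finite type over `k`, possibly reducible or empty. Varieties in the narrow sense are those with
`IsIntegral V.X`. -/
structure Variety (k : Type u) [Field k] where
  /-- the underlying scheme -/
  X : Scheme.{u}
  /-- the structure morphism -/
  str : X ⟶ Spec (CommRingCat.of k)
  [isReduced : IsReduced X]
  [isSeparated : IsSeparated str]
  [locallyOfFiniteType : LocallyOfFiniteType str]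
  [quasiCompact : QuasiCompact str]

attribute [instance] Variety.isReduced Variety.isSeparated Variety.locallyOfFiniteType
  Variety.quasiCompact

instance Variety.isLocallyNoetherian {k : Type u} [Field k] (V : Variety k) :
    IsLocallyNoetherian V.X :=
  LocallyOfFiniteType.isLocallyNoetherian V.str

section Grothendieck

variable (k : Type u) [Field k]

/-- The defining relations of the Grothendieck ring of varieties: isomorphic varieties have the
same class, `[V] = [V \ W] + [W]` for `W` closed in `V`, `[V] [W] = [V × W]`, and the point is the
unit element. -/
inductive K0Rel : FreeCommRing (Variety k) → FreeCommRing (Variety k) → Prop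
  | iso (V W : Variety k) (e : V.X ≅ W.X) (he : e.hom ≫ W.str = V.str) :
      K0Rel (FreeCommRing.of V) (FreeCommRing.of W)
  | scissor (V W U : Variety k) (i : W.X ⟶ V.X) (j : U.X ⟶ V.X) (hi : IsClosedImmersion i)
      (hj : IsOpenImmersion j) (hik : i ≫ V.str = W.str) (hjk : j ≫ V.str = U.str)
      (h : Set.range j = (Set.range i)ᶜ) :
      K0Rel (FreeCommRing.of V) (FreeCommRing.of U + FreeCommRing.of W)
  | prod (V W P : Variety k) (p : P.X ⟶ V.X) (q : P.X ⟶ W.X)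
      (hp : p ≫ V.str = P.str) (h : IsPullback p q V.str W.str) :
      K0Rel (FreeCommRing.of V * FreeCommRing.of W) (FreeCommRing.of P)
  | point (V : Variety k) (h : IsIso V.str) : K0Rel (FreeCommRing.of V) 1

/-- The Grothendieck ring `K₀(Var_k)`. The commutative ring generated by the symbols `[V]` subject
to the relations above is the free abelian group on the symbols modulo the isomorphism and scissor
relations, with the product given by `[V] [W] = [V × W]`. -/
abbrev K0 : Type (u + 1) :=
  FreeCommRing (Variety k) ⧸ Ideal.span {z | ∃ a b, K0Rel k a b ∧ z = a - b}

variable {k} in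
/-- The class `[V]` of a variety. -/
def K0.cl (V : Variety k) : K0 k := Ideal.Quotient.mk _ (FreeCommRing.of V)

/-- The affine line. -/
def affineLine : Variety k where
  X := Spec (.of (Polynomial k))
  str := Spec.map (CommRingCat.ofHom Polynomial.C)
  locallyOfFiniteType := by
    rw [HasRingHomProperty.Spec_iff (P := @LocallyOfFiniteType)]
    exact RingHom.finiteType_algebraMap.2 (inferInstance : Algebra.FiniteType k (Polynomial k))

/-- `L = [𝔸¹]`. -/
def K0.L : K0 k := K0.cl (affineLine k)

variable (d : ℕ)

/-- `K₀(Var_k)[L^{-1/d}] = K₀(Var_k)[T] / (L T^d - 1)`. -/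
abbrev K0Root : Type (u + 1) :=
  AdjoinRoot (Polynomial.C (K0.L k) * Polynomial.X ^ d - 1 : Polynomial (K0 k))

lemma K0Root.L_mul_root_pow :
    algebraMap (K0 k) (K0Root k d) (K0.L k) * AdjoinRoot.root _ ^ d = 1 := by
  have h := AdjoinRoot.eval₂_root (Polynomial.C (K0.L k) * Polynomial.X ^ d - 1)
  simp only [Polynomial.eval₂_sub, Polynomial.eval₂_mul, Polynomial.eval₂_C,
    Polynomial.eval₂_X_pow, Polynomial.eval₂_one, sub_eq_zero] at h
  exact h

variable [NeZero d]

/-- The unit `L^{-1/d}`, the class of `T`. -/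
def K0Root.rootUnit : (K0Root k d)ˣ :=
  Units.mkOfMulEqOne (AdjoinRoot.root _)
    (algebraMap (K0 k) (K0Root k d) (K0.L k) * AdjoinRoot.root _ ^ (d - 1)) (by
      rw [← K0Root.L_mul_root_pow k d, mul_left_comm, ← pow_succ',
        Nat.sub_add_cancel NeZero.one_le])

/-- `L^{i/d}` in `K₀(Var_k)[L^{-1/d}]`. -/
def K0Root.Lpow (i : ℤ) : K0Root k d := ((K0Root.rootUnit k d) ^ (-i) : (K0Root k d)ˣ)

/-- The localization of `K₀(Var_k)[L^{-1/d}]` with respect to the elements `L^{i/d} - 1`,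
`i ∈ ℤ \ {0}`. -/
abbrev K0Loc : Type (u + 1) :=
  Localization (Submonoid.closure {z : K0Root k d | ∃ i : ℤ, i ≠ 0 ∧ z = K0Root.Lpow k d i - 1})

/-- `L^{i/d}` in the localized ring. -/
def K0Loc.Lpow (i : ℤ) : K0Loc k d := algebraMap (K0Root k d) _ (K0Root.Lpow k d i)

/-- The canonical map from `K₀(Var_k)` to the localized ring. -/
def K0Loc.ofK0 : K0 k →+* K0Loc k d :=
  (algebraMap (K0Root k d) (K0Loc k d)).comp (algebraMap (K0 k) (K0Root k d))

lemma K0Loc.Lpow_self : K0Loc.Lpow k d d = K0Loc.ofK0 k d (K0.L k) := by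
  have h : algebraMap (K0 k) (K0Root k d) (K0.L k) * ((K0Root.rootUnit k d ^ d : (K0Root k d)ˣ) :
      K0Root k d) = 1 := K0Root.L_mul_root_pow k d
  have h2 := Units.eq_inv_of_mul_eq_one_right h
  simp only [K0Loc.Lpow, K0Root.Lpow, K0Loc.ofK0, RingHom.comp_apply, zpow_neg, zpow_natCast, h2]

variable {d} in
/-- The fraction `(L - 1) / (L^{i/d} - 1)`, for `i ≠ 0`. -/
def K0Loc.frac (i : ℤ) (hi : i ≠ 0) : K0Loc k d :=
  IsLocalization.mk' (K0Loc k d) (algebraMap (K0 k) (K0Root k d) (K0.L k) - 1)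
    (⟨K0Root.Lpow k d i - 1, Submonoid.subset_closure ⟨i, hi, rfl⟩⟩ :
      Submonoid.closure {z : K0Root k d | ∃ i : ℤ, i ≠ 0 ∧ z = K0Root.Lpow k d i - 1})

/-- The ring `R_d`: the subring of the localized ring generated by `K₀(Var_k)`, `L⁻¹` and the
fractions `(L - 1) / (L^{i/d} - 1)`, `i ≠ 0`. -/
def ringR : Subring (K0Loc k d) :=
  Subring.closure (Set.range (K0Loc.ofK0 k d) ∪ {K0Loc.Lpow k d (-d)} ∪
    {z | ∃ (i : ℤ) (hi : i ≠ 0), z = K0Loc.frac k i hi})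

/-- An element of `K₀(Var_k)`, seen in `R_d`. -/
def ringR.ofK0 (x : K0 k) : ringR k d :=
  ⟨K0Loc.ofK0 k d x, Subring.subset_closure (Or.inl (Or.inl ⟨x, rfl⟩))⟩

/-- `L⁻¹` in `R_d`. -/
def ringR.Linv : ringR k d :=
  ⟨K0Loc.Lpow k d (-d), Subring.subset_closure (Or.inl (Or.inr rfl))⟩

open Classical in
/-- `(L - 1) / (L^{i/d} - 1)` in `R_d` for `i ≠ 0`; the value at `i = 0` is irrelevant. -/
def ringR.frac (i : ℤ) : ringR k d :=
  if hi : i ≠ 0 then ⟨K0Loc.frac k i hi, Subring.subset_closure (Or.inr ⟨i, hi, rfl⟩)⟩ else 0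

end Grothendieck

/-! ### Classes of locally closed subsets -/

section LocallyClosed

variable {k : Type u} [Field k] (V : Variety k)

open Classical in
/-- The class in `K₀(Var_k)` of a locally closed subset `W` of `V`, with its reduced structure: the
class of a (reduced) variety `Z` with an immersion `Z ⟶ V` over `k` whose image is `W`. Such a `Z`
exists for each locally closed `W`, and its class does not depend on choices, see
`Variety.exists_immersion` and `Variety.cl_eq`. -/
def Variety.cl (W : Set V.X) : K0 k :=
  if h : ∃ (Z : Variety k) (j : Z.X ⟶ V.X), IsImmersion j ∧ j ≫ V.str = Z.str ∧ Set.range j = W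
  then K0.cl h.choose else 0

open Limits in
lemma Variety.cl_unique {Z Z' : Variety k} (j : Z.X ⟶ V.X) (j' : Z'.X ⟶ V.X)
    [IsImmersion j] [IsImmersion j'] (h : j ≫ V.str = Z.str) (h' : j' ≫ V.str = Z'.str)
    (hr : Set.range j = Set.range j') : K0.cl Z = K0.cl Z' := by
  have key {A B C : Scheme.{u}} [IsReduced A] (f : A ⟶ C) (g : B ⟶ C) [IsImmersion f] [IsImmersion g] (hr : Set.range f ⊆ Set.range g) : IsIso (pullback.fst f g) := by
    have hs : Surjective (pullback.fst f g) := by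
      constructor
      rw [← Set.range_eq_univ, Scheme.Pullback.range_fst]
      rw [Set.eq_univ_iff_forall]
      exact fun x => hr ⟨x, rfl⟩
    have : IsClosedImmersion (pullback.fst f g) := .of_isPreimmersion _ (by rw [hs.surj.range_eq]; exact isClosed_univ)
    exact isIso_of_isClosedImmersion_of_surjective _
  have i1 := key j j' hr.le
  have i2 : IsIso (pullback.snd j j') := by
    have := key j' j hr.ge
    rw [← pullbackSymmetry_hom_comp_fst]; infer_instance
  refine sub_eq_zero.1 ?_
  rw [K0.cl, K0.cl, ← map_sub]
  refine Ideal.Quotient.eq_zero_iff_mem.2 (Ideal.subset_span ⟨_, _, .iso Z Z' ((asIso (pullback.fst j j')).symm ≪≫ asIso (pullback.snd j j')) ?_, rfl⟩)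
  simp [← h, ← h', pullback.condition_assoc]


lemma Variety.exists_immersion {W : Set V.X} (h : IsLocallyClosed W) :
    ∃ (Z : Variety k) (j : Z.X ⟶ V.X), IsImmersion j ∧ j ≫ V.str = Z.str ∧ Set.range j = W := by
  let U : V.X.Opens := ⟨coborder W, h.isOpen_coborder⟩
  let C : TopologicalSpace.Closeds U.toScheme := ⟨U.ι ⁻¹' W, isClosed_preimage_val_coborder⟩
  let I := Scheme.IdealSheafData.vanishingIdeal C
  have hr : IsReduced I.subscheme := by
    rw [IsReduced.iff_of_openCover _ I.subschemeCover.openCover]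
    intro A
    have : _root_.IsReduced (Γ(U.toScheme, A.1) ⧸ I.ideal A) := by
      rw [← Ideal.isRadical_iff_quotient_reduced]
      exact PrimeSpectrum.isRadical_vanishingIdeal _
    exact (inferInstance : IsReduced (Spec (.of (Γ(U.toScheme, A.1) ⧸ I.ideal A))))
  refine ⟨⟨I.subscheme, I.subschemeι ≫ U.ι ≫ V.str⟩, I.subschemeι ≫ U.ι, inferInstance, by simp, ?_⟩
  rw [Scheme.Hom.comp_base, TopCat.coe_comp, Set.range_comp, Scheme.IdealSheafData.range_subschemeι]
  simp only [I, Scheme.IdealSheafData.coe_support_vanishingIdeal]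
  exact (Set.image_preimage_eq_of_subset (by simpa using! subset_coborder))

lemma Variety.cl_eq (Z : Variety k) (j : Z.X ⟶ V.X) [hj : IsImmersion j]
    (h : j ≫ V.str = Z.str) : V.cl (Set.range j) = K0.cl Z := by
  have hex : ∃ (Z' : Variety k) (j' : Z'.X ⟶ V.X),
      IsImmersion j' ∧ j' ≫ V.str = Z'.str ∧ Set.range j' = Set.range j := ⟨Z, j, hj, h, rfl⟩
  rw [Variety.cl, dif_pos hex]
  obtain ⟨j', hj', h', hr⟩ := hex.choose_spec
  exact Variety.cl_unique V j' j h' h hr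

end LocallyClosed

/-! ### Multi-valued differential forms -/

/-- `(Ωⁿ_K)^{⊗ d}` for a field `K` over `k`: the `d`-th tensor power over `K` of the `n`-th exterior
power of the module of Kähler differentials of `K` over `k`. For `K` the function field of a
variety, an element `ω` is (the `d`-th power of) a multi-valued rational differential form
`ω^{1/d}`. -/
abbrev MultiForm (k K : Type u) [Field k] [Field K] [Algebra k K] (n d : ℕ) : Type u :=
  PiTensorProduct K fun _ : Fin d => ⋀[K]^n Ω[K⁄k]

/-- `(da₁₁ ∧ ⋯ ∧ da₁ₙ) ⊗ ⋯ ⊗ (da_{d1} ∧ ⋯ ∧ da_{dn})`. -/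
def wedgePow (k : Type u) {K : Type u} [Field k] [Field K] [Algebra k K] {n d : ℕ}
    (a : Fin d → Fin n → K) : MultiForm k K n d :=
  PiTensorProduct.tprod K fun j =>
    exteriorPower.ιMulti K n fun i => KaehlerDifferential.D k K (a j i)

section Pullback

variable {K K' : Type u} [Field K] [Field K'] (φ : K →+* K')
  {V V' E : Type u} [AddCommGroup V] [Module K V] [AddCommGroup V'] [Module K' V']
  [AddCommGroup E] [Module K' E] {F : Type u} [AddCommMonoid F] [Module K' F]

/-- The semilinear map on exterior powers given by a semilinear map and an alternating map. -/
def extLift {n : ℕ} (f : V →ₛₗ[φ] V') (w : V' [⋀^Fin n]→ₗ[K'] E) : ⋀[K]^n V →ₛₗ[φ] E :=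
  letI : Module K E := Module.compHom E φ
  let w' : V [⋀^Fin n]→ₗ[K] E :=
    { toFun v := w fun i => f (v i)
      map_update_add' v i x y := by
        simp only [← Function.comp_def (⇑f), Function.comp_update, map_add, AlternatingMap.map_update_add]
      map_update_smul' v i c x := by
        simp only [← Function.comp_def (⇑f), Function.comp_update, map_smulₛₗ, AlternatingMap.map_update_smul]
        rfl
      map_eq_zero_of_eq' v i j h hij := w.map_eq_zero_of_eq _ (congrArg f h) hij }
  let l := exteriorPower.alternatingMapLinearEquiv w'
  { toFun := l, map_add' := l.map_add, map_smul' := l.map_smul }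

lemma extLift_ιMulti {n : ℕ} (f : V →ₛₗ[φ] V') (w : V' [⋀^Fin n]→ₗ[K'] E) (v : Fin n → V) :
    extLift φ f w (exteriorPower.ιMulti K n v) = w fun i => f (v i) := by
  let _ : Module K E := Module.compHom E φ
  exact exteriorPower.alternatingMapLinearEquiv_apply_ιMulti _ v

/-- The semilinear map on tensor powers given by a semilinear map and a multilinear map. -/
def tensLift {d : ℕ} (f : V →ₛₗ[φ] V') (w : MultilinearMap K' (fun _ : Fin d => V') F) :
    PiTensorProduct K (fun _ : Fin d => V) →ₛₗ[φ] F :=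
  letI : Module K F := Module.compHom F φ
  let w' : MultilinearMap K (fun _ : Fin d => V) F :=
    { toFun v := w fun i => f (v i)
      map_update_add' v i x y := by
        simp only [← Function.comp_def (⇑f), Function.comp_update, map_add, MultilinearMap.map_update_add]
      map_update_smul' v i c x := by
        simp only [← Function.comp_def (⇑f), Function.comp_update, map_smulₛₗ, MultilinearMap.map_update_smul]
        rfl }
  let l := PiTensorProduct.lift w'
  { toFun := l, map_add' := l.map_add, map_smul' := l.map_smul }

lemma tensLift_tprod {d : ℕ} (f : V →ₛₗ[φ] V') (w : MultilinearMap K' (fun _ : Fin d => V') F) (v : Fin d → V) :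
    tensLift φ f w (PiTensorProduct.tprod K v) = w fun i => f (v i) := by
  let _ : Module K F := Module.compHom F φ
  exact PiTensorProduct.lift.tprod v
end Pullback

section Pullback

variable {k K K' : Type u} [Field k] [Field K] [Field K'] [Algebra k K] [Algebra k K']

/-- The map `a db ↦ φ(a) dφ(b)` on Kähler differentials. -/
def kaehlerPullback (φ : K →ₐ[k] K') : Ω[K⁄k] →ₛₗ[φ.toRingHom] Ω[K'⁄k] :=
  letI : Algebra K K' := φ.toAlgebra
  haveI : IsScalarTower k K K' := .of_algebraMap_eq fun x => (φ.commutes x).symm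
  { toFun := KaehlerDifferential.map k k K K'
    map_add' := map_add _
    map_smul' c x := by
      rw [map_smul, ← algebraMap_smul K' c]; rfl }

lemma kaehlerPullback_D (φ : K →ₐ[k] K') (a : K) : kaehlerPullback φ (KaehlerDifferential.D k K a) = KaehlerDifferential.D k K' (φ a) := by
  let _ : Algebra K K' := φ.toAlgebra
  have : IsScalarTower k K K' := .of_algebraMap_eq fun x => (φ.commutes x).symm
  exact KaehlerDifferential.map_D k k K K' a

/-- The pull-back of multi-valued forms along a homomorphism `φ` of function fields:
`f · ⊗ⱼ (daⱼ₁ ∧ ⋯ ∧ daⱼₙ) ↦ φ(f) · ⊗ⱼ (dφ(aⱼ₁) ∧ ⋯ ∧ dφ(aⱼₙ))`. -/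
def MultiForm.pullback (φ : K →ₐ[k] K') {n d : ℕ} :
    MultiForm k K n d →ₛₗ[φ.toRingHom] MultiForm k K' n d :=
  tensLift φ.toRingHom (extLift φ.toRingHom (kaehlerPullback φ) (exteriorPower.ιMulti K' n))
    (PiTensorProduct.tprod K')

lemma MultiForm.pullback_wedgePow (φ : K →ₐ[k] K') {n d : ℕ} (a : Fin d → Fin n → K) :
    MultiForm.pullback φ (wedgePow k a) = wedgePow k fun j i => φ (a j i) := by
  simp only [MultiForm.pullback, wedgePow, tensLift_tprod, extLift_ιMulti, kaehlerPullback_D]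
end Pullback

/-! ### Divisors of forms and the principal value integral -/

section Divisors

variable {k : Type u} [Field k] (V : Variety k) [IsIntegral V.X]

/-- The function field of an integral variety. -/
def Variety.FF : Type u := V.X.functionField

instance : Field V.FF := inferInstanceAs (Field V.X.functionField)

instance : Algebra k V.FF :=
  ((V.X.presheaf.germ ⊤ (genericPoint V.X) trivial).hom.comp
    (V.str.appTop.hom.comp (Scheme.ΓSpecIso (CommRingCat.of k)).inv.hom)).toAlgebra

/-- The local ring of `V` at `ξ`, as a subring of the function field. -/
def Variety.localRing (ξ : V.X) : Subring V.FF :=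
  (algebraMap (V.X.presheaf.stalk ξ) V.X.functionField).range

/-- The image of `(Ωⁿ_{V,ξ})^{⊗ d}` in `(Ωⁿ_{k(V)})^{⊗ d}`: the forms that are regular at `ξ`. -/
def Variety.regularForms (n d : ℕ) (ξ : V.X) :
    Submodule (V.localRing ξ) (MultiForm k V.FF n d) :=
  Submodule.span (V.localRing ξ)
    {η | ∃ a : Fin d → Fin n → V.FF, (∀ j i, a j i ∈ V.localRing ξ) ∧ η = wedgePow k a}

variable {V}
variable {n d : ℕ}

open Classical in
/-- The order of a nonzero form `ω` along the prime divisor with generic point `ξ`: writing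
`ω = g • η` with `g` a rational function and `η` a generator of the (free of rank one) module of
forms that are regular at `ξ`, it is the order of `g` along this divisor. It is `0` at points `ξ`
that are not of codimension one. -/
def ordForm (ω : MultiForm k V.FF n d) (ξ : V.X) : ℤ :=
  if h : ∃ g : V.FF, g ≠ 0 ∧ V.regularForms n d ξ = Submodule.span _ {g⁻¹ • ω}
  then Scheme.ord (X := V.X) h.choose ξ else 0

/-- The `ℚ`-divisor `div ω^{1/d} = (1/d) div ω`, as the function which assigns to the generic point
of each prime divisor its multiplicity. -/
def divForm (ω : MultiForm k V.FF n d) (ξ : V.X) : ℚ := (ordForm ω ξ : ℚ) / d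

/-- The form `ω^{1/d}` has no logarithmic poles: no multiplicity `α - 1` of `div ω^{1/d}` is `-1`. -/
def NoLogPoles (ω : MultiForm k V.FF n d) : Prop := ∀ ξ : V.X, divForm ω ξ ≠ -1

/-- A `ℚ`-divisor `D` on a smooth variety of dimension `n` is a normal crossings divisor: around
each closed point `p` of its support there are local coordinates `t₁, …, tₙ` (generators of the
maximal ideal of the local ring at `p`) such that the irreducible components of `D` through `p` are
given by pairwise different ones of the equations `tᵢ = 0`. -/
def IsNormalCrossings (n : ℕ) (D : V.X → ℚ) : Prop :=
  ∀ p : V.X, IsClosed {p} → (∃ ξ, D ξ ≠ 0 ∧ ξ ⤳ p) →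
    ∃ t : Fin n → V.X.presheaf.stalk p,
      Ideal.span (Set.range t) = IsLocalRing.maximalIdeal (V.X.presheaf.stalk p) ∧
      ∃ i : {ξ : V.X // D ξ ≠ 0 ∧ ξ ⤳ p} → Fin n, Function.Injective i ∧
        ∀ ξ, Ideal.comap (V.X.presheaf.stalkSpecializes ξ.2.2).hom
          (IsLocalRing.maximalIdeal (V.X.presheaf.stalk ξ.1)) = Ideal.span {t (i ξ)}

/-- A subset of `V` is (the support of) a prime divisor. -/
def IsPrimeDivisor (C : Set V.X) : Prop := ∃ ξ : V.X, Order.coheight ξ = 1 ∧ closure {ξ} = C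

open Classical in
/-- A prime divisor `C`, as a `ℚ`-divisor. -/
def primeDiv (C : Set V.X) (ξ : V.X) : ℚ := if closure {ξ} = C then 1 else 0

/-- The index set `S` of the irreducible components `E_ξ = closure {ξ}` of `div ω^{1/d}`. -/
def components (ω : MultiForm k V.FF n d) : Set V.X := {ξ | divForm ω ξ ≠ 0}

/-- The stratum `E_I° = (⋂_{i ∈ I} E_i) \ (⋃_{l ∉ I} E_l)`. -/
def stratum (ω : MultiForm k V.FF n d) (I : Finset V.X) : Set V.X :=
  (⋂ ξ ∈ I, closure {ξ}) \ ⋃ ξ ∈ components ω \ ↑I, closure {ξ}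

variable [NeZero d]

open Classical in
/-- The motivic principal value integral
`PV ∫_V ω^{1/d} = L^{-n} ∑_{I ⊆ S} [E_I°] ∏_{i ∈ I} (L - 1) / (L^{α_i} - 1)` in `R_d`, where
`n = dim V`, the form `ω^{1/d}` has no logarithmic poles and
`div ω^{1/d} = ∑_{i ∈ S} (α_i - 1) E_i` is a normal crossings divisor, so
`d α_i = ord_{E_i} ω + d`. The set `S` is always finite. -/
def PV (ω : MultiForm k V.FF n d) : ringR k d :=
  ringR.Linv k d ^ n *
    if h : (components ω).Finite then
      ∑ I ∈ h.toFinset.powerset,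
        ringR.ofK0 k d (V.cl (stratum ω I)) * ∏ ξ ∈ I, ringR.frac k d (ordForm ω ξ + d)
    else 0

end Divisors

/-! ### Birational geometry -/

section Birational

variable {k : Type u} [Field k]

/-- `π` is a birational map over `k`. -/
def IsBirationalMap (V W : Variety k) (π : V.X ⤏ W.X) : Prop :=
  ∃ f : Scheme.PartialIso V.X W.X, f.IsOver V.str W.str ∧ f.toRationalMap = π

/-- `φ : k(W) → k(V)` is the comorphism `π^*` of the (dominant) rational map `π`. -/
def IsComorphism (V W : Variety k) [IsIntegral V.X] [IsIntegral W.X] (π : V.X ⤏ W.X)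
    (φ : W.FF →ₐ[k] V.FF) : Prop :=
  π.fromFunctionField = Spec.map (CommRingCat.ofHom (R := W.X.functionField)
    (S := V.X.functionField) φ.toRingHom) ≫ W.X.fromSpecStalk (genericPoint W.X)

/-- The Kodaira dimension of the smooth complete variety `V` of dimension `n` is `-∞`: for each
`m > 0` the zero form is the only regular section of the `m`-th power of the canonical bundle. -/
def KodairaDimNegInfty (V : Variety k) [IsIntegral V.X] (n : ℕ) : Prop :=
  ∀ m : ℕ, 0 < m → ∀ η : MultiForm k V.FF n m, η ≠ 0 → ∃ ξ : V.X, ordForm η ξ < 0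

/-- In the birational equivalence class of the variety `V` of dimension `n`, the principal value
integral is a birational invariant: for each nonzero multi-valued form `ω^{1/d}` on (the function
field of) `V`, it takes the same value on any two smooth complete models on which
`div ω^{1/d}` is a normal crossings divisor and `ω^{1/d}` has no logarithmic poles. A model is
given with an identification of its function field with that of `V`. -/
def PVIsBirationalInvariant (V : Variety k) [IsIntegral V.X] (n : ℕ) : Prop :=
  ∀ (d : ℕ) [NeZero d] (ω : MultiForm k V.FF n d), ω ≠ 0 →
  ∀ (V₁ V₂ : Variety k) [IsIntegral V₁.X] [IsIntegral V₂.X] [IsProper V₁.str] [IsProper V₂.str]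
    [SmoothOfRelativeDimension n V₁.str] [SmoothOfRelativeDimension n V₂.str]
    (φ₁ : V.FF ≃ₐ[k] V₁.FF) (φ₂ : V.FF ≃ₐ[k] V₂.FF),
    IsNormalCrossings n (divForm (MultiForm.pullback φ₁.toAlgHom ω)) → NoLogPoles (MultiForm.pullback φ₁.toAlgHom ω) →
    IsNormalCrossings n (divForm (MultiForm.pullback φ₂.toAlgHom ω)) → NoLogPoles (MultiForm.pullback φ₂.toAlgHom ω) →
    PV (MultiForm.pullback φ₁.toAlgHom ω) = PV (MultiForm.pullback φ₂.toAlgHom ω)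

end Birational

/-! ### The projective plane -/

section Plane

open MvPolynomial HomogeneousLocalization

variable (k : Type u) [Field k]

/-- The grading of `k[X, Y, Z]` by degree. -/
abbrev Gr : ℕ → Submodule k (MvPolynomial (Fin 3) k) :=
  homogeneousSubmodule (Fin 3) k

instance : GradedAlgebra (Gr k) := MvPolynomial.gradedAlgebra

lemma bijective_algebraMap_Gr_zero : Function.Bijective (algebraMap k (Gr k 0)) := by
  constructor
  · intro a b h
    exact MvPolynomial.C_injective _ _ (congrArg Subtype.val h)
  rintro ⟨p, hp⟩
  obtain ⟨c, rfl⟩ : ∃ c, C c = p := by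
    rw [mem_homogeneousSubmodule] at hp
    rw [← totalDegree_zero_iff_isHomogeneous, totalDegree_eq_zero_iff_eq_C] at hp
    exact ⟨_, hp.symm⟩
  exact ⟨c, rfl⟩

instance : Algebra.FiniteType (Gr k 0) (MvPolynomial (Fin 3) k) :=
  have : IsScalarTower k (Gr k 0) (MvPolynomial (Fin 3) k) := 
    IsScalarTower.of_algebraMap_eq (R := k) (S := Gr k 0) (A := MvPolynomial (Fin 3) k) fun _ => rfl
  Algebra.FiniteType.of_restrictScalars_finiteType k _ _

/-- The scheme `Proj k[X, Y, Z]`. -/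
abbrev P2Scheme : Scheme.{u} := Proj (Gr k)

/-- The structure morphism of the projective plane. -/
def P2Hom : P2Scheme k ⟶ Spec (.of k) := Proj.toSpecZero (Gr k) ≫ Spec.map (CommRingCat.ofHom (algebraMap k (Gr k 0)))

instance : IsIso (Spec.map (CommRingCat.ofHom (algebraMap k (Gr k 0)))) := by
  have : IsIso (CommRingCat.ofHom (algebraMap k (Gr k 0))) := 
    (RingEquiv.ofBijective _ (bijective_algebraMap_Gr_zero k)).toCommRingCatIso.isIso_hom
  infer_instance
instance : IsProper (P2Hom k) := by unfold P2Hom; infer_instance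

/-- The zero ideal, as a point of the projective plane. -/
def P2GenericPoint : Proj (Gr k) where
  asHomogeneousIdeal := ⊥
  isPrime := Ideal.isPrime_bot
  not_irrelevant_le h := by
    have := h (HomogeneousIdeal.mem_irrelevant_of_mem (Gr k) zero_lt_one (isHomogeneous_X k (0 : Fin 3)))
    exact MvPolynomial.X_ne_zero (R := k) (0 : Fin 3) this

lemma P2GenericPoint_specializes (x : Proj (Gr k)) : P2GenericPoint k ⤳ x := 
  specializes_iff_mem_closure.2 <|
    (ProjectiveSpectrum.le_iff_mem_closure (Gr k) (P2GenericPoint k) x).1 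
      ((ProjectiveSpectrum.as_ideal_le_as_ideal ..).1 bot_le)

instance : IsIntegral (P2Scheme k) := by
  have : IsReduced (P2Scheme k) := by
    have (x : P2Scheme k) : _root_.IsReduced ((P2Scheme k).presheaf.stalk x) := by
      have hx := ProjectiveSpectrum.isPrime (x : ProjectiveSpectrum (Gr k))
      have : _root_.IsReduced (AtPrime (Gr k) (ProjectiveSpectrum.asHomogeneousIdeal (x : ProjectiveSpectrum (Gr k))).toIdeal) := 
        isReduced_of_injective (algebraMap _ (Localization.AtPrime (ProjectiveSpectrum.asHomogeneousIdeal (x : ProjectiveSpectrum (Gr k))).toIdeal)) 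
         (val_injective _)
      exact isReduced_of_injective (Proj.stalkIso (Gr k) x).commRingCatIsoToRingEquiv (RingEquiv.injective _)
    exact isReduced_of_isReduced_stalk _
  have : IrreducibleSpace (P2Scheme k) := by
    have := (isIrreducible_singleton (x := P2GenericPoint k)).closure
    rw [Set.eq_univ_of_forall (fun x => (P2GenericPoint_specializes k x).mem_closure)] at this
    have h2 : PreirreducibleSpace (P2Scheme k) := ⟨this.2⟩
    exact ⟨⟨P2GenericPoint k⟩⟩
  exact isIntegral_of_irreducibleSpace_of_isReduced _

lemma genericPoint_mem_basicOpen (i : Fin 3) : genericPoint (P2Scheme k) ∈ Proj.basicOpen (Gr k) (X i) :=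
  (genericPoint_specializes (P2GenericPoint k : P2Scheme k)).mem_open (Proj.basicOpen (Gr k) (X i)).isOpen
   (show X i ∉ (⊥ : Ideal (MvPolynomial (Fin 3) k)) from MvPolynomial.X_ne_zero (R := k) i)

/-- The projective plane `ℙ²` with homogeneous coordinates `X = X 0`, `Y = X 1`, `Z = X 2`. -/
def P2 : Variety k where
  X := P2Scheme k
  str := P2Hom k

instance : IsIntegral (P2 k).X := inferInstanceAs (IsIntegral (P2Scheme k))

/-- The rational function `X_i / X_j` on `ℙ²`. -/
def P2.ratio (i j : Fin 3) : (P2 k).FF :=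
  (P2Scheme k).presheaf.germ (Proj.basicOpen (Gr k) (X j)) (genericPoint (P2Scheme k))
    (genericPoint_mem_basicOpen k j)
    (Proj.awayToSection (Gr k) (X j)
      (Away.mk (Gr k) (f := X j) (d := 1) (isHomogeneous_X k j) 1 (X i) (isHomogeneous_X k i)))

/-- The affine coordinate `x = X / Z`. -/
def P2.x : (P2 k).FF := P2.ratio k 0 2

/-- The affine coordinate `y = Y / Z`. -/
def P2.y : (P2 k).FF := P2.ratio k 1 2

variable {k} in
/-- The zero set in `ℙ²` of a homogeneous polynomial. -/
def P2.curve (F : MvPolynomial (Fin 3) k) : Set (P2 k).X :=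
  ((Proj.basicOpen (Gr k) F : (P2Scheme k).Opens) : Set (P2Scheme k))ᶜ

variable {k} in
/-- The bivalued form `f^{1/2} da db`, i.e. `ω = f (da ∧ db)^{⊗ 2}`. -/
def P2.biform (f a b : (P2 k).FF) : MultiForm k (P2 k).FF 2 2 :=
  f • wedgePow k fun _ => ![a, b]

/-- The form `ω^{1/2} = y^{-3/2} dx dy` on `ℙ²`, i.e. `ω = y⁻³ (dx ∧ dy)^{⊗ 2}`. -/
def P2.omega : MultiForm k (P2 k).FF 2 2 := P2.biform (P2.y k ^ (-3 : ℤ)) (P2.x k) (P2.y k)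

end Plane

end MotivicPV

end

open MotivicPV MvPolynomial

/-! Both models are the projective plane, and both forms are `F⁻³ (dx ∧ dy)^{⊗ 2}` for a quadratic
form `F` (`quadForm`): `F = YZ` for `ω`, and `F = YZ - X²` for its pull-back. The canonical bundle
of the plane is `O(-3)`, so a change of chart multiplies `(dx ∧ dy)^{⊗ 2}` by a sixth power of a
ratio of coordinates. This cancels the factor coming from `F⁻³`. Hence the form has the same shape
in every chart (`quadForm_eq`), and its order along a prime divisor is `-3` times the order of `F`
(`ordForm_quadForm`). For `YZ` the divisor consists of two crossing lines, for `YZ - X²` of one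
smooth conic.

The shear `(x, y) ↦ (x, y - x²)` is an automorphism of the affine plane with Jacobian determinant
`1`, so it defines a birational map of the projective plane (`exists_isBirationalMap`) and carries
one form to the other (`pullback_shear_omega`). It does not respect the boundary: the line at
infinity is a component of the first divisor but not of the second, and this changes the integral.

Each component has `α = -1/2`. With `l = L^{1/2}` the factor `(L - 1)/(L^{-1/2} - 1)` is `-l(l +
1)`. The lines have strata of classes `L² - L`, `L`, `L` and `1`, and the sum vanishes. The conic
has class `L + 1` and complement of class `L²`, and the integral is `-l⁻³(l² + l + 1)`. The classes
follow by cutting along coordinate lines, since the lines and the conic are graphs in suitable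
charts. Graphs have coordinate ring `k[t]`; this also yields the local coordinates for normal
crossings.

That the last value is nonzero cannot be read off from generators and relations; a homomorphism out
of the localized ring is needed. It counts points. The field `k` embeds into an ultraproduct `K` of
finite fields (`exists_finiteModel`). The `K`-points of a variety over `k` are described by finite
sets of points over these finite fields, and the germ of their cardinalities does not depend on
choices (`Coding.card_eq_sum`, `Decomp.card_eq`) and respects the defining relations. Germs of real
functions along an ultrafilter form a field in which the image `q` of `L` exceeds `1`. So roots of
`q` exist, the elements `q^{i/d} - 1` are invertible, and the measure extends to the localization
(`measureLoc`). There `l⁻³(l² + l + 1)` becomes positive (`K0Loc.Lpow_mul_ne_zero`). -/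

open CategoryTheory AlgebraicGeometry
noncomputable section
namespace MotivicPV

/-! ### Pseudo-finite extensions of a field and counting of points -/

/-- An ultrafilter and a family of finite fields, together with maps from `k` that are almost
everywhere compatible with the ring operations: `k` embeds into the ultraproduct. -/
structure FiniteModel (k : Type u) [Field k] where
  ι : Type u
  U : Ultrafilter ι
  F : ι → Type u
  [field : ∀ s, Field (F s)]
  [finite : ∀ s, Finite (F s)]
  red : ∀ s, k → F s
  red_add (a b : k) : ∀ᶠ s in U, red s (a + b) = red s a + red s b
  red_mul (a b : k) : ∀ᶠ s in U, red s (a * b) = red s a * red s b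
  red_one : ∀ᶠ s in U, red s 1 = 1

attribute [instance] FiniteModel.field FiniteModel.finite

/-- Nonzero primes are maximal, and a nonzero integer is not divisible by a prime number larger than
its absolute value. -/
instance : IsJacobsonRing ℤ := by
  rw [isJacobsonRing_iff_prime_eq]
  intro P hP
  refine le_antisymm (fun x hx => ?_) Ideal.le_jacobson
  by_cases hP0 : P = ⊥
  · subst hP0
    by_contra hx0
    obtain ⟨p, hp, hpp⟩ := Nat.exists_infinite_primes (x.natAbs + 1)
    have hpr : Prime (p : ℤ) := Nat.prime_iff_prime_int.1 hpp
    have hmax : (Ideal.span {(p : ℤ)}).IsMaximal :=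
      PrincipalIdealRing.isMaximal_of_irreducible hpr.irreducible
    have := (Ideal.mem_sInf.1 hx) ⟨bot_le, hmax⟩
    rw [Ideal.mem_span_singleton] at this
    have h1 := Nat.le_of_dvd (Int.natAbs_pos.2 hx0) (Int.natCast_dvd.1 this)
    omega
  · have := IsPrime.to_maximal_ideal hP0
    exact (Ideal.mem_sInf.1 hx) ⟨le_rfl, this⟩

/-- A ring of finite type over `ℤ` that is not trivial has a finite residue field. -/
lemma finite_quotient_of_finiteType_int (A : Type*) [CommRing A] [Algebra.FiniteType ℤ A]
    (m : Ideal A) [m.IsMaximal] : Finite (A ⧸ m) := by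
  let _ : Field (A ⧸ m) := Ideal.Quotient.field m
  have ft : Algebra.FiniteType ℤ (A ⧸ m) := inferInstance
  -- The Nullstellensatz over the Jacobson ring `ℤ`: a field of finite type is integral over it.
  have hint : (algebraMap ℤ (A ⧸ m)).IsIntegral := by
    obtain ⟨n, f, hf⟩ := Algebra.FiniteType.iff_quotient_mvPolynomial''.1 ft
    have := MvPolynomial.comp_C_integral_of_surjective_of_isJacobsonRing f.toRingHom hf
    rwa [Subsingleton.elim (algebraMap ℤ (A ⧸ m)) (f.toRingHom.comp MvPolynomial.C)]
  have : Algebra.IsIntegral ℤ (A ⧸ m) := ⟨hint⟩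
  have : Module.Finite ℤ (A ⧸ m) := Algebra.IsIntegral.finite
  refine Module.finite_of_fg_torsion (A ⧸ m) fun {x} => ?_
  -- If `ℤ` embedded into this integral extension, which is a field, then `ℤ` would be a field. So
  -- the quotient is finitely generated and torsion.
  obtain ⟨n, hn, h0⟩ : ∃ n : ℤ, algebraMap ℤ (A ⧸ m) n = 0 ∧ n ≠ 0 := by
    by_contra! h
    have hinj : Function.Injective (algebraMap ℤ (A ⧸ m)) := (injective_iff_map_eq_zero _).2 h
    exact Int.not_isField (isField_of_isIntegral_of_isField hinj (Field.toIsField (A ⧸ m)))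
  exact ⟨⟨n, mem_nonZeroDivisors_of_ne_zero h0⟩, by
    change n • x = 0
    rw [Algebra.smul_def, hn, zero_mul]⟩

/-- As `k` need not be finitely generated, no single finite residue field suffices. The fields are
residue fields of the `ℤ`-algebras generated by the finite subsets of `k`. A given element lies in
almost all of these algebras, since the ultrafilter refines `atTop`. -/
lemma exists_finiteModel (k : Type u) [Field k] : Nonempty (FiniteModel k) := by
  classical
  let A (s : Finset k) : Subalgebra ℤ k := Algebra.adjoin ℤ (s : Set k)
  have hft (s) : Algebra.FiniteType ℤ (A s) :=
    (Subalgebra.fg_iff_finiteType _).1 (Subalgebra.fg_adjoin_finset s)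
  choose m hm using fun s => Ideal.exists_maximal (A s)
  let red (s : Finset k) (a : k) : A s ⧸ m s :=
    if h : a ∈ A s then Ideal.Quotient.mk _ ⟨a, h⟩ else 0
  have ev (a : k) : ∀ᶠ s in (Ultrafilter.of Filter.atTop : Ultrafilter (Finset k)), a ∈ A s :=
    Ultrafilter.of_le _ ((Filter.eventually_ge_atTop {a}).mono fun s hs =>
      Algebra.subset_adjoin (hs (Finset.mem_singleton_self a)))
  exact ⟨{
    ι := Finset k
    U := Ultrafilter.of Filter.atTop
    F := fun s => A s ⧸ m s
    field := fun s => Ideal.Quotient.field _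
    finite := fun s => finite_quotient_of_finiteType_int _ _
    red := red
    red_add := fun a b => by
      filter_upwards [ev a, ev b] with s ha hb
      simp only [red, dif_pos ha, dif_pos hb, dif_pos (add_mem ha hb)]
      exact map_add _ (⟨a, ha⟩ : A s) ⟨b, hb⟩
    red_mul := fun a b => by
      filter_upwards [ev a, ev b] with s ha hb
      simp only [red, dif_pos ha, dif_pos hb, dif_pos (mul_mem ha hb)]
      exact map_mul _ (⟨a, ha⟩ : A s) ⟨b, hb⟩
    red_one := .of_forall fun s => by
      simp only [red, dif_pos (one_mem (A s))]
      exact map_one _ }⟩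

namespace FiniteModel

variable {k : Type u} [Field k] (M : FiniteModel k)

/-- The families that vanish almost everywhere. -/
def null : Ideal (∀ s, M.F s) where
  carrier := {x | ∀ᶠ s in M.U, x s = 0}
  zero_mem' := .of_forall fun _ => rfl
  add_mem' ha hb := by
    filter_upwards [ha, hb] with s h h'
    simp [h, h']
  smul_mem' c x hx := by
    filter_upwards [hx] with s h
    simp [h]

lemma mem_null {x : ∀ s, M.F s} : x ∈ M.null ↔ ∀ᶠ s in M.U, x s = 0 := Iff.rfl

/-- A family outside `null` is nonzero almost everywhere, by the ultrafilter property, so its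
coordinatewise inverse (with `0⁻¹ = 0`) inverts it modulo `null`. -/
instance : M.null.IsMaximal := by
  rw [Ideal.isMaximal_iff]
  refine ⟨fun h => ?_, fun J x hJ hx hxJ => ?_⟩
  · obtain ⟨s, hs⟩ := (M.mem_null.1 h).exists
    exact one_ne_zero hs
  · have h1 : (1 - x⁻¹ * x) ∈ M.null := by
      rw [mem_null] at hx ⊢
      rw [← Ultrafilter.eventually_not] at hx
      filter_upwards [hx] with s hs
      simp [inv_mul_cancel₀ hs]
    simpa using J.add_mem (hJ h1) (J.mul_mem_left x⁻¹ hxJ)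

/-- The ultraproduct of the finite fields. -/
def K : Type u := (∀ s, M.F s) ⧸ M.null

instance : Field M.K := Ideal.Quotient.field M.null

/-- The class of a family. -/
def proj : (∀ s, M.F s) →+* M.K := Ideal.Quotient.mk M.null

lemma proj_surjective : Function.Surjective M.proj := Ideal.Quotient.mk_surjective

lemma proj_eq_proj {x y : ∀ s, M.F s} : M.proj x = M.proj y ↔ ∀ᶠ s in M.U, x s = y s := by
  refine Ideal.Quotient.eq.trans (M.mem_null.trans ?_)
  simp [sub_eq_zero]

instance : Algebra k M.K := RingHom.toAlgebra
  { toFun a := M.proj fun s => M.red s a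
    map_one' := by
      rw [← map_one M.proj, proj_eq_proj]
      exact M.red_one
    map_mul' a b := by
      rw [← map_mul M.proj, proj_eq_proj]
      exact M.red_mul a b
    map_zero' := by
      rw [← map_zero M.proj, proj_eq_proj]
      filter_upwards [M.red_add 0 0] with s hs
      simpa using hs
    map_add' a b := by
      rw [← map_add M.proj, proj_eq_proj]
      exact M.red_add a b }

lemma algebraMap_eq (a : k) : algebraMap k M.K a = M.proj fun s => M.red s a := rfl

variable {σ τ : Type} 

/-- The value of a polynomial over `k` at a point with coordinates in one of the finite fields. -/
def ev (s : M.ι) (x : σ → M.F s) (f : MvPolynomial σ k) : M.F s :=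
  ∑ d ∈ f.support, M.red s (f.coeff d) * ∏ i ∈ d.support, x i ^ d i

/-- For a single `s` the map `red s` need not be a homomorphism, so `ev s` need not be
multiplicative or additive in `f`. Expanding `f` into monomials uses only that `proj` is a ring
homomorphism. -/
lemma aeval_proj (x : ∀ s, σ → M.F s) (f : MvPolynomial σ k) :
    MvPolynomial.aeval (fun i => M.proj fun s => x s i) f = M.proj fun s => M.ev s (x s) f := by
  rw [MvPolynomial.aeval_def, MvPolynomial.eval₂_eq]
  simp only [algebraMap_eq, ← map_pow, ← map_prod, ← map_mul, ← map_sum]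
  congr 1
  ext s
  simp [ev]

/-- A description of the set of `K`-valued points of `B` by points over the finite fields. -/
structure Coding (B : Type u) [CommRing B] [Algebra k B] where
  σ : Type
  [fin : Finite σ]
  b : σ → B
  adjoin_eq : Algebra.adjoin k (Set.range b) = ⊤
  D : ∀ s, Set (σ → M.F s)
  mem_D (x : ∀ s, σ → M.F s) :
    (∀ᶠ s in M.U, x s ∈ D s) ↔ ∃ g : B →ₐ[k] M.K, ∀ i, g (b i) = M.proj fun s => x s i

attribute [instance] Coding.fin

variable {M} in
/-- The number of points. -/
def Coding.card {B : Type u} [CommRing B] [Algebra k B] (C : M.Coding B) : (M.U : Filter M.ι).Germ ℝ :=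
  ((fun s => (Nat.card (C.D s) : ℝ) : M.ι → ℝ) : (M.U : Filter M.ι).Germ ℝ)

/-- Present `B` by finitely many generators and, by noetherianity, finitely many equations. The sets
`D s` are the solutions of the reduced equations. -/
lemma nonempty_coding (B : Type u) [CommRing B] [Algebra k B] [Algebra.FiniteType k B] :
    Nonempty (M.Coding B) := by
  obtain ⟨n, f, hf⟩ := Algebra.FiniteType.iff_quotient_mvPolynomial''.1 ‹Algebra.FiniteType k B›
  obtain ⟨S, hS⟩ := (IsNoetherian.noetherian (RingHom.ker f) : (RingHom.ker f).FG)
  have key (x : Fin n → M.K) : (∀ p ∈ S, MvPolynomial.aeval x p = 0) ↔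
      ∃ g : B →ₐ[k] M.K, ∀ i, g (f (.X i)) = x i := by
    constructor
    · intro h
      have h2 : ∀ p, f p = 0 → MvPolynomial.aeval x p = 0 := by
        have : RingHom.ker f ≤ RingHom.ker (MvPolynomial.aeval (R := k) x) := by
          rw [← hS, Ideal.span_le]; exact fun p hp => h p hp
        exact fun p hp => this hp
      refine ⟨AlgHom.liftOfSurjective f hf (MvPolynomial.aeval x) h2, fun i => ?_⟩
      exact (AlgHom.liftOfSurjective_apply f hf _ h2 _).trans (MvPolynomial.aeval_X _ _)
    · rintro ⟨g, hg⟩ p hp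
      have : f p = 0 := by
        change p ∈ RingHom.ker f
        rw [← hS]; exact Ideal.subset_span hp
      have e : MvPolynomial.aeval x = g.comp f := by
        ext i; simp [hg]
      rw [e, AlgHom.comp_apply, this, map_zero]
  refine ⟨⟨Fin n, fun i => f (.X i), ?_, fun s => {x | ∀ p ∈ S, M.ev s x p = 0}, fun x => ?_⟩⟩
  · have := congrArg (Subalgebra.map f) (MvPolynomial.adjoin_range_X (R := k) (σ := Fin n))
    rw [AlgHom.map_adjoin, ← Set.range_comp] at this
    rw [Function.comp_def] at this
    rw [this, Algebra.map_top, AlgHom.range_eq_top]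
    exact hf
  · rw [← key]
    simp only [aeval_proj]
    simp only [Set.mem_ofPred_eq]
    -- Finiteness of the set of equations is what lets "almost everywhere" commute with their
    -- conjunction.
    rw [Filter.eventually_all_finset]
    refine forall₂_congr fun p _ => ?_
    rw [← map_zero M.proj, proj_eq_proj]; rfl

variable {M}

lemma Coding.exists_algHom {B : Type u} [CommRing B] [Algebra k B] (C : M.Coding B) (g : B →ₐ[k] M.K) :
    ∃ x : ∀ s, C.σ → M.F s, (∀ᶠ s in M.U, x s ∈ C.D s) ∧ ∀ i, g (C.b i) = M.proj fun s => x s i := by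
  choose y hy using fun i => M.proj_surjective (g (C.b i))
  refine ⟨fun s i => y i s, (C.mem_D _).2 ⟨g, fun i => (hy i).symm⟩, fun i => (hy i).symm⟩

lemma Coding.algHom_ext {B : Type u} [CommRing B] [Algebra k B] (C : M.Coding B) {g g' : B →ₐ[k] M.K}
    (h : ∀ i, g (C.b i) = g' (C.b i)) : g = g' :=
  AlgHom.ext_of_adjoin_eq_top C.adjoin_eq (by rintro _ ⟨i, rfl⟩; exact h i)

lemma proj_eq_proj_pi [Finite σ] {x y : ∀ s, σ → M.F s} :
    (∀ i, M.proj (fun s => x s i) = M.proj (fun s => y s i)) ↔ ∀ᶠ s in M.U, x s = y s := by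
  simp only [proj_eq_proj, ← Filter.eventually_all, funext_iff]

/-- A family of homomorphisms `B → B_j` that induces a bijection on `K`-valued points. -/
theorem Coding.card_eq_sum {B : Type u} [CommRing B] [Algebra k B] (C : M.Coding B)
    {J : Type} [Fintype J] {B' : J → Type u} [∀ j, CommRing (B' j)] [∀ j, Algebra k (B' j)]
    (C' : ∀ j, M.Coding (B' j)) (φ : ∀ j, B →ₐ[k] B' j)
    (h : Function.Bijective fun g : Σ j, B' j →ₐ[k] M.K => g.2.comp (φ g.1)) :
    C.card = ∑ j, (C' j).card := by
  classical
  -- In terms of generators, `φ j` is given by polynomials; reducing these gives maps between the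
  -- sets of points over the finite fields.
  have hP (j : J) (i : C.σ) : ∃ P : MvPolynomial (C' j).σ k,
      MvPolynomial.aeval (C' j).b P = φ j (C.b i) := by
    have := (C' j).adjoin_eq
    rw [Algebra.adjoin_range_eq_range_aeval, AlgHom.range_eq_top] at this
    exact this _
  choose P hP using hP
  let p (s : M.ι) (j : J) (x : (C' j).σ → M.F s) : C.σ → M.F s := fun i => M.ev s x (P j i)
  have hp (j : J) (x : ∀ s, (C' j).σ → M.F s) (g : B' j →ₐ[k] M.K)
      (hg : ∀ i, g ((C' j).b i) = M.proj fun s => x s i) (i : C.σ) :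
      g.comp (φ j) (C.b i) = M.proj fun s => p s j (x s) i := by
    rw [AlgHom.comp_apply, ← hP, ← M.aeval_proj, MvPolynomial.comp_aeval_apply]
    simp only [hg]
  -- the maps are almost everywhere well defined
  have h1 (j : J) : ∀ᶠ s in M.U, ∀ x ∈ (C' j).D s, p s j x ∈ C.D s := by
    by_contra hn
    rw [← Ultrafilter.eventually_not] at hn
    -- Counterexamples at almost all `s` assemble to a `K`-valued point, whose image under `φ j` is
    -- again a `K`-valued point: a contradiction. Where there is no counterexample, `0` is a dummy
    -- value. Injectivity and surjectivity below follow the same pattern.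
    have : ∀ s, ∃ x, ¬ (∀ x ∈ (C' j).D s, p s j x ∈ C.D s) → x ∈ (C' j).D s ∧ p s j x ∉ C.D s := by
      intro s
      by_cases hs : ∀ x ∈ (C' j).D s, p s j x ∈ C.D s
      · exact ⟨0, fun h => (h hs).elim⟩
      · push Not at hs
        obtain ⟨x, hx, hx'⟩ := hs
        exact ⟨x, fun _ => ⟨hx, hx'⟩⟩
    choose x hx using this
    obtain ⟨g, hg⟩ := ((C' j).mem_D x).1 (hn.mono fun s hs => (hx s hs).1)
    have := (C.mem_D _).2 ⟨_, hp j x g hg⟩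
    obtain ⟨s, hs, hs'⟩ := (this.and hn).exists
    exact (hx s hs').2 hs
  -- A family of collisions would give two different `K`-valued points with the same image.
  have h2 (j j' : J) : ∀ᶠ s in M.U, ∀ x ∈ (C' j).D s, ∀ x' ∈ (C' j').D s,
      p s j x = p s j' x' → (⟨j, x⟩ : Σ j, (C' j).σ → M.F s) = ⟨j', x'⟩ := by
    by_contra hn
    rw [← Ultrafilter.eventually_not] at hn
    have : ∀ s, ∃ x x', ¬ (∀ x ∈ (C' j).D s, ∀ x' ∈ (C' j').D s,
        p s j x = p s j' x' → (⟨j, x⟩ : Σ j, (C' j).σ → M.F s) = ⟨j', x'⟩) →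
        x ∈ (C' j).D s ∧ x' ∈ (C' j').D s ∧ p s j x = p s j' x' ∧
          (⟨j, x⟩ : Σ j, (C' j).σ → M.F s) ≠ ⟨j', x'⟩ := by
      intro s
      by_cases hs : ∀ x ∈ (C' j).D s, ∀ x' ∈ (C' j').D s,
        p s j x = p s j' x' → (⟨j, x⟩ : Σ j, (C' j).σ → M.F s) = ⟨j', x'⟩
      · exact ⟨0, 0, fun h => (h hs).elim⟩
      · push Not at hs
        obtain ⟨x, hx, x', hx', e, hne⟩ := hs
        exact ⟨x, x', fun _ => ⟨hx, hx', e, hne⟩⟩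
    choose x x' hx using this
    obtain ⟨g, hg⟩ := ((C' j).mem_D x).1 (hn.mono fun s hs => (hx s hs).1)
    obtain ⟨g', hg'⟩ := ((C' j').mem_D x').1 (hn.mono fun s hs => (hx s hs).2.1)
    have e : g.comp (φ j) = g'.comp (φ j') := C.algHom_ext fun i => by
      rw [hp j x g hg, hp j' x' g' hg', proj_eq_proj]
      exact hn.mono fun s hs => congrFun (hx s hs).2.2.1 i
    have := @h.1 ⟨j, g⟩ ⟨j', g'⟩ e
    obtain rfl : j = j' := congrArg Sigma.fst this
    obtain rfl : g = g' := eq_of_heq (Sigma.mk.inj this).2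
    have := proj_eq_proj_pi.1 fun i => (hg i).symm.trans (hg' i)
    obtain ⟨s, hs, hs'⟩ := (this.and hn).exists
    exact (hx s hs').2.2.2 (by rw [hs])
  -- A family of missed points would be a `K`-valued point of `B`; this has a preimage, whose
  -- coordinates hit the family almost everywhere.
  have h3 : ∀ᶠ s in M.U, ∀ y ∈ C.D s, ∃ j, ∃ x ∈ (C' j).D s, p s j x = y := by
    by_contra hn
    rw [← Ultrafilter.eventually_not] at hn
    have : ∀ s, ∃ y, ¬ (∀ y ∈ C.D s, ∃ j, ∃ x ∈ (C' j).D s, p s j x = y) →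
        y ∈ C.D s ∧ ¬ ∃ j, ∃ x ∈ (C' j).D s, p s j x = y := by
      intro s
      by_cases hs : ∀ y ∈ C.D s, ∃ j, ∃ x ∈ (C' j).D s, p s j x = y
      · exact ⟨0, fun h => (h hs).elim⟩
      · rw [not_forall] at hs
        obtain ⟨y, hy⟩ := hs
        rw [Classical.not_imp] at hy
        exact ⟨y, fun _ => hy⟩
    choose y hy using this
    obtain ⟨g, hg⟩ := (C.mem_D y).1 (hn.mono fun s hs => (hy s hs).1)
    obtain ⟨⟨j, g'⟩, rfl⟩ := h.2 g
    obtain ⟨x, hx, hx'⟩ := (C' j).exists_algHom g'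
    have := proj_eq_proj_pi.1 fun i => (hp j x g' hx' i).symm.trans (hg i)
    obtain ⟨s, ⟨hs, hs'⟩, hs''⟩ := ((this.and hn).and hx).exists
    exact (hy s hs').2 ⟨j, _, hs'', hs⟩
  have h4 : ∀ᶠ s in M.U, Nat.card (C.D s) = ∑ j, Nat.card ((C' j).D s) := by
    filter_upwards [Filter.eventually_all.2 h1,
      Filter.eventually_all.2 fun j => Filter.eventually_all.2 (h2 j), h3] with s h1 h2 h3
    rw [← Nat.card_sigma]
    symm
    refine Nat.card_eq_of_bijective
      (fun x : Σ j, (C' j).D s => (⟨p s x.1 x.2.1, h1 _ _ x.2.2⟩ : C.D s)) ⟨?_, ?_⟩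
    · rintro ⟨j, x, hx⟩ ⟨j', x', hx'⟩ e
      have := h2 j j' x hx x' hx' (congrArg Subtype.val e)
      obtain rfl : j = j' := congrArg Sigma.fst this
      obtain rfl : x = x' := eq_of_heq (Sigma.mk.inj this).2
      rfl
    · rintro ⟨y, hy⟩
      obtain ⟨j, x, hx, e⟩ := h3 y hy
      exact ⟨⟨j, x, hx⟩, Subtype.ext e⟩
  have h5 : ∑ j, (C' j).card = ((fun s => ∑ j, (Nat.card ((C' j).D s) : ℝ) : M.ι → ℝ) :
      (M.U : Filter M.ι).Germ ℝ) := by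
    have := map_sum (Filter.Germ.coeRingHom (R := ℝ) (M.U : Filter M.ι))
      (fun j s => (Nat.card ((C' j).D s) : ℝ)) Finset.univ
    simp only [Filter.Germ.coe_coeRingHom] at this
    refine this.symm.trans (congrArg _ ?_)
    ext s
    simp
  rw [h5, card, Filter.Germ.coe_eq]
  filter_upwards [h4] with s hs
  rw [hs]; push_cast; rfl

open TensorProduct in
-- A `K`-valued point of `B ⊗ C` is a pair of points, so the product sets form a coding.
lemma Coding.exists_card_tensor {B C : Type u} [CommRing B] [Algebra k B] [CommRing C] [Algebra k C]
    (cB : M.Coding B) (cC : M.Coding C) : ∃ c : M.Coding (B ⊗[k] C), c.card = cB.card * cC.card := by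
  refine ⟨⟨cB.σ ⊕ cC.σ, Sum.elim (fun i => cB.b i ⊗ₜ 1) (fun i => 1 ⊗ₜ cC.b i), ?_,
    fun s => {x | x ∘ Sum.inl ∈ cB.D s ∧ x ∘ Sum.inr ∈ cC.D s}, fun x => ?_⟩, ?_⟩
  · have h1 := congrArg (Subalgebra.map (Algebra.TensorProduct.includeLeft : B →ₐ[k] B ⊗[k] C))
      cB.adjoin_eq
    have h2 := congrArg (Subalgebra.map (Algebra.TensorProduct.includeRight : C →ₐ[k] B ⊗[k] C))
      cC.adjoin_eq
    rw [AlgHom.map_adjoin, ← Set.range_comp, Algebra.map_top] at h1 h2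
    rw [Set.Sum.elim_range, Algebra.adjoin_union]
    refine (congrArg₂ _ h1 h2).trans ?_
    have := Algebra.TensorProduct.map_range (AlgHom.id k B) (AlgHom.id k C)
    rw [AlgHom.comp_id, AlgHom.comp_id] at this
    rw [← this, Algebra.TensorProduct.map_id, AlgHom.range_eq_top]
    exact Function.surjective_id
  · simp only [Set.mem_ofPred_eq, Filter.eventually_and]
    have e1 := cB.mem_D (fun s => x s ∘ Sum.inl)
    have e2 := cC.mem_D (fun s => x s ∘ Sum.inr)
    rw [e1, e2]
    constructor
    · rintro ⟨⟨g, hg⟩, ⟨g', hg'⟩⟩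
      refine ⟨Algebra.TensorProduct.lift g g' fun _ _ => Commute.all _ _, ?_⟩
      rintro (i | i)
      · simp [hg]
      · simp [hg']
    · rintro ⟨g, hg⟩
      exact ⟨⟨g.comp Algebra.TensorProduct.includeLeft, fun i => hg (.inl i)⟩,
        ⟨g.comp Algebra.TensorProduct.includeRight, fun i => hg (.inr i)⟩⟩
  · simp only [card]
    rw [← Filter.Germ.coe_mul]
    congr 1
    ext s
    simp only [Pi.mul_apply]
    rw [← Nat.cast_mul, ← Nat.card_prod]
    congr 1
    refine Nat.card_congr ((Equiv.subtypeEquiv (Equiv.sumArrowEquivProdArrow _ _ _) 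
      (q := fun a => a.1 ∈ cB.D s ∧ a.2 ∈ cC.D s) (fun x => Iff.rfl)).trans Equiv.subtypeProdEquivProd)

lemma Coding.exists_card_self : ∃ c : M.Coding k, c.card = 1 := by
  refine ⟨⟨Empty, Empty.elim, ?_, fun s => Set.univ, fun x => ?_⟩, ?_⟩
  · exact Subsingleton.elim _ _
  · exact ⟨fun _ => ⟨Algebra.ofId k M.K, fun i => i.elim⟩, fun _ => .of_forall fun _ => trivial⟩
  · simp [card]; rfl

/-- The numbers of elements of the finite fields. -/
def q (M : FiniteModel k) (s : M.ι) : ℝ := Nat.card (M.F s)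

lemma one_lt_q (s : M.ι) : 1 < M.q s := by
  have : 1 < Nat.card (M.F s) := Finite.one_lt_card
  exact Nat.one_lt_cast.2 this

lemma Coding.exists_card_polynomial : ∃ c : M.Coding (Polynomial k), c.card = (M.q : M.ι → ℝ) := by
  refine ⟨⟨Unit, fun _ => Polynomial.X, ?_, fun s => Set.univ, fun x => ?_⟩, ?_⟩
  · simp [Polynomial.adjoin_X]
  · simpa using ⟨Polynomial.aeval (M.proj fun s => x s ()), by simp⟩
  · simp only [card]
    congr 1
    ext s
    rw [Nat.card_univ, Nat.card_fun]
    simp [q]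

end FiniteModel
end MotivicPV
end

/-! ### Counting points of schemes of finite type over `k` -/

open CategoryTheory AlgebraicGeometry Limits
noncomputable section
namespace MotivicPV
namespace FiniteModel

variable {k : Type u} [Field k] (M : FiniteModel k)

/-- The number of points of an algebra of finite type. -/
def card (B : Type u) [CommRing B] [Algebra k B] [Algebra.FiniteType k B] :
    (M.U : Filter M.ι).Germ ℝ := (M.nonempty_coding B).some.card

variable {M} in
-- Two codings of the same algebra are compared through the identity map.
lemma Coding.card_eq {B : Type u} [CommRing B] [Algebra k B] [Algebra.FiniteType k B]
    (C : M.Coding B) : C.card = M.card B := by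
  rw [C.card_eq_sum (J := Unit) (fun _ => (M.nonempty_coding B).some) fun _ => AlgHom.id k B]
  · simp [FiniteModel.card]
  · refine ⟨fun ⟨_, g⟩ ⟨_, g'⟩ h => ?_, fun g => ⟨⟨(), g⟩, by simp⟩⟩
    obtain rfl : g = g' := by simpa using h
    rfl

lemma card_eq_sum {B : Type u} [CommRing B] [Algebra k B] [Algebra.FiniteType k B]
    {J : Type} [Fintype J] {B' : J → Type u} [∀ j, CommRing (B' j)] [∀ j, Algebra k (B' j)]
    [∀ j, Algebra.FiniteType k (B' j)] (φ : ∀ j, B →ₐ[k] B' j)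
    (h : Function.Bijective fun g : Σ j, B' j →ₐ[k] M.K => g.2.comp (φ g.1)) :
    M.card B = ∑ j, M.card (B' j) :=
  Coding.card_eq_sum _ (fun _ => (M.nonempty_coding _).some) φ h

/-- The structure morphism of an affine scheme over `k`. -/
abbrev _root_.MotivicPV.specStr (B : Type u) [CommRing B] [Algebra k B] :
    Spec (.of B) ⟶ Spec (.of k) :=
  Spec.map (CommRingCat.ofHom (algebraMap k B))

/-- The `K`-valued points of a scheme over `k`. -/
def Pt {X : Scheme.{u}} (s : X ⟶ Spec (.of k)) : Type u :=
  {p : Spec (.of M.K) ⟶ X // p ≫ s = specStr M.K}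

variable {M} in
/-- The map on `K`-valued points induced by a morphism. -/
def Pt.map {X Y : Scheme.{u}} {s : X ⟶ Spec (.of k)} {t : Y ⟶ Spec (.of k)} (f : X ⟶ Y)
    (h : f ≫ t = s) (p : M.Pt s) : M.Pt t :=
  ⟨p.1 ≫ f, by rw [Category.assoc, h, p.2]⟩

/-- `K`-valued points of an affine scheme are homomorphisms. -/
def ptEquiv (B : Type u) [CommRing B] [Algebra k B] : (B →ₐ[k] M.K) ≃ M.Pt (specStr (k := k) B) where
  toFun g := ⟨Spec.map (CommRingCat.ofHom g.toRingHom), by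
    rw [← Spec.map_comp, ← CommRingCat.ofHom_comp, AlgHom.toRingHom_eq_coe, g.comp_algebraMap]⟩
  invFun p :=
    { toRingHom := (Spec.preimage p.1).hom
      commutes' r := by
        have h := p.2
        rw [← Spec.map_preimage p.1, ← Spec.map_comp] at h
        have := congrArg CommRingCat.Hom.hom (Spec.map_injective h)
        exact congrArg (fun f => f r) this }
  left_inv g := by
    refine AlgHom.ext fun x => ?_
    exact congrArg (fun f : CommRingCat.of B ⟶ CommRingCat.of M.K => f.hom x)
      (Spec.preimage_map (CommRingCat.ofHom g.toRingHom))
  right_inv p := Subtype.ext (by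
    change Spec.map (Spec.preimage p.1) = p.1
    rw [Spec.map_preimage])

lemma ptEquiv_comp {B C : Type u} [CommRing B] [Algebra k B] [CommRing C] [Algebra k C]
    (φ : B →ₐ[k] C) (h : Spec.map (CommRingCat.ofHom φ.toRingHom) ≫ specStr B = specStr (k := k) C)
    (g : C →ₐ[k] M.K) :
    M.ptEquiv B (g.comp φ) = Pt.map (Spec.map (CommRingCat.ofHom φ.toRingHom)) h (M.ptEquiv C g) := by
  refine Subtype.ext ?_
  change _ = Spec.map (CommRingCat.ofHom g.toRingHom) ≫ Spec.map (CommRingCat.ofHom φ.toRingHom)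
  rw [← Spec.map_comp, ← CommRingCat.ofHom_comp]
  rfl

/-- A decomposition of the `K`-valued points of a scheme over `k` into the sets of points of finitely
many affine schemes of finite type. -/
structure Decomp {X : Scheme.{u}} (s : X ⟶ Spec (.of k)) where
  J : Type
  [fintype : Fintype J]
  B : J → Type u
  [ring : ∀ j, CommRing (B j)]
  [alg : ∀ j, Algebra k (B j)]
  [ft : ∀ j, Algebra.FiniteType k (B j)]
  f (j : J) : Spec (.of (B j)) ⟶ X
  hf (j : J) : f j ≫ s = specStr (B j)
  bij : Function.Bijective fun g : Σ j, M.Pt (specStr (k := k) (B j)) => Pt.map (f g.1) (hf g.1) g.2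

attribute [instance] Decomp.fintype Decomp.ring Decomp.alg Decomp.ft

variable {M}

/-- The number of points that is computed by a decomposition. -/
def Decomp.card {X : Scheme.{u}} {s : X ⟶ Spec (.of k)} (D : M.Decomp s) :
    (M.U : Filter M.ι).Germ ℝ := ∑ j, M.card (D.B j)

/-- An affine scheme of finite type over `k` is the spectrum of an algebra of finite type. -/
lemma _root_.MotivicPV.exists_isoSpec {X : Scheme.{u}} [IsAffine X] (s : X ⟶ Spec (.of k))
    [LocallyOfFiniteType s] :
    ∃ (R : Type u) (_ : CommRing R) (_ : Algebra k R) (_ : Algebra.FiniteType k R)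
      (e : X ≅ Spec (.of R)), e.hom ≫ specStr R = s := by
  let R : Type u := Γ(X, ⊤)
  let φ := Spec.preimage (X.isoSpec.inv ≫ s)
  let _ : Algebra k R := φ.hom.toAlgebra
  have h : specStr (k := k) R = X.isoSpec.inv ≫ s := Spec.map_preimage _
  refine ⟨R, inferInstance, inferInstance, ?_, X.isoSpec, by rw [h]; simp⟩
  have : LocallyOfFiniteType (specStr (k := k) R) := by rw [h]; infer_instance
  rw [HasRingHomProperty.Spec_iff (P := @LocallyOfFiniteType)] at this
  exact RingHom.finiteType_algebraMap.1 this

/-- Separatedness enters here: it makes a morphism from an affine scheme to `X` affine, so that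
fibre products of affine pieces over `X` are again affine. -/
lemma _root_.MotivicPV.exists_isPullback_spec {X : Scheme.{u}} (s : X ⟶ Spec (.of k)) [IsSeparated s]
    {B C : Type u} [CommRing B] [Algebra k B] [Algebra.FiniteType k B]
    [CommRing C] [Algebra k C] [Algebra.FiniteType k C]
    (f : Spec (.of B) ⟶ X) (g : Spec (.of C) ⟶ X) (hf : f ≫ s = specStr B) (hg : g ≫ s = specStr C) :
    ∃ (R : Type u) (_ : CommRing R) (_ : Algebra k R) (_ : Algebra.FiniteType k R)
      (a : B →ₐ[k] R) (b : C →ₐ[k] R), IsPullback (Spec.map (CommRingCat.ofHom a.toRingHom))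
        (Spec.map (CommRingCat.ofHom b.toRingHom)) f g := by
  have i1 : IsAffineHom (f ≫ s) := by rw [hf]; infer_instance
  have i1 : IsAffineHom f := .of_comp f s
  have i2 : LocallyOfFiniteType (specStr (k := k) B) := by
    rw [HasRingHomProperty.Spec_iff (P := @LocallyOfFiniteType)]
    exact RingHom.finiteType_algebraMap.2 inferInstance
  have i2' : LocallyOfFiniteType (specStr (k := k) C) := by
    rw [HasRingHomProperty.Spec_iff (P := @LocallyOfFiniteType)]
    exact RingHom.finiteType_algebraMap.2 inferInstance
  have i2 : LocallyOfFiniteType (f ≫ s) := by rw [hf]; infer_instance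
  have i3 : LocallyOfFiniteType f := locallyOfFiniteType_of_comp f s
  have i4 : IsAffine (pullback f g) := isAffine_of_isAffineHom (pullback.snd f g)
  obtain ⟨R, _, _, _, e, he⟩ := exists_isoSpec (k := k) (pullback.snd f g ≫ specStr C)
  have he' : pullback.fst f g ≫ specStr B = pullback.snd f g ≫ specStr (k := k) C := by
    rw [← hf, ← hg, pullback.condition_assoc]
  let a := Spec.preimage (e.inv ≫ pullback.fst f g)
  let b := Spec.preimage (e.inv ≫ pullback.snd f g)
  have ha : Spec.map a ≫ specStr (k := k) B = specStr R := by
    rw [Spec.map_preimage, Category.assoc, he', ← he, Iso.inv_hom_id_assoc]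
  have hb : Spec.map b ≫ specStr (k := k) C = specStr R := by
    rw [Spec.map_preimage, Category.assoc, ← he, Iso.inv_hom_id_assoc]
  rw [← Spec.map_comp] at ha hb
  refine ⟨R, _, _, ‹_›, ⟨a.hom, fun r => ?_⟩, ⟨b.hom, fun r => ?_⟩, ?_⟩
  · exact congrArg (fun f => f.hom r) (Spec.map_injective ha)
  · exact congrArg (fun f => f.hom r) (Spec.map_injective hb)
  · refine IsPullback.of_iso (IsPullback.of_hasPullback f g) e (Iso.refl _) (Iso.refl _) (Iso.refl _)
      ?_ ?_ (by simp) (by simp)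
    · change _ = e.hom ≫ Spec.map a
      simp [a]
    · change _ = e.hom ≫ Spec.map b
      simp [b]

lemma specMap_specStr {B C : Type u} [CommRing B] [Algebra k B] [CommRing C] [Algebra k C]
    (φ : B →ₐ[k] C) :
    Spec.map (CommRingCat.ofHom φ.toRingHom) ≫ specStr B = specStr (k := k) C := by
  rw [← Spec.map_comp, ← CommRingCat.ofHom_comp, AlgHom.toRingHom_eq_coe, AlgHom.comp_algebraMap]

/-- The points of `B` are sorted by the piece of `D` through which their image in `X` factors; those
belonging to piece `j` are the points of the fibre product `R j`. -/
lemma Decomp.card_eq_sum_of_isPullback {X : Scheme.{u}} {s : X ⟶ Spec (.of k)}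
    (D : M.Decomp s) {B : Type u} [CommRing B] [Algebra k B] [Algebra.FiniteType k B]
    (f : Spec (.of B) ⟶ X) (hf : f ≫ s = specStr B) {R : D.J → Type u} [∀ j, CommRing (R j)]
    [∀ j, Algebra k (R j)] [∀ j, Algebra.FiniteType k (R j)] (a : ∀ j, B →ₐ[k] R j)
    (b : ∀ j, D.B j →ₐ[k] R j)
    (h : ∀ j, IsPullback (Spec.map (CommRingCat.ofHom (a j).toRingHom))
        (Spec.map (CommRingCat.ofHom (b j).toRingHom)) f (D.f j)) :
    M.card B = ∑ j, M.card (R j) := by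
  refine M.card_eq_sum a ⟨?_, ?_⟩
  · rintro ⟨j₁, g₁⟩ ⟨j₂, g₂⟩ e
    dsimp only at e
    have e1 := congrArg (M.ptEquiv _) e
    rw [M.ptEquiv_comp _ (specMap_specStr _), M.ptEquiv_comp _ (specMap_specStr _)] at e1
    have e2 := congrArg Subtype.val e1
    simp only [Pt.map] at e2
    have e3 : Pt.map (D.f j₁) (D.hf j₁) (Pt.map _ (specMap_specStr (b j₁)) (M.ptEquiv _ g₁)) =
        Pt.map (D.f j₂) (D.hf j₂) (Pt.map _ (specMap_specStr (b j₂)) (M.ptEquiv _ g₂)) := by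
      refine Subtype.ext ?_
      simp only [Pt.map, Category.assoc, ← (h _).w]
      rw [reassoc_of% e2]
    have e4 := @D.bij.1 ⟨j₁, _⟩ ⟨j₂, _⟩ e3
    obtain rfl : j₁ = j₂ := congrArg Sigma.fst e4
    have e5 := congrArg Subtype.val (eq_of_heq (Sigma.mk.inj e4).2)
    have : M.ptEquiv _ g₁ = M.ptEquiv _ g₂ := Subtype.ext ((h j₁).hom_ext e2 e5)
    rw [(M.ptEquiv _).injective this]
  · intro g
    obtain ⟨⟨j, p⟩, hp⟩ := D.bij.2 (Pt.map f hf (M.ptEquiv _ g))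
    obtain ⟨l, hl, -⟩ := (h j).exists_lift (M.ptEquiv _ g).1 p.1 (congrArg Subtype.val hp).symm
    have hl' : l ≫ specStr (k := k) (R j) = specStr M.K := by
      rw [← specMap_specStr (a j), ← Category.assoc, hl, (M.ptEquiv _ g).2]
    refine ⟨⟨j, (M.ptEquiv _).symm ⟨l, hl'⟩⟩, (M.ptEquiv _).injective ?_⟩
    refine (M.ptEquiv_comp _ (specMap_specStr _) _).trans ?_
    refine (congrArg (Pt.map _ _) (Equiv.apply_symm_apply _ _)).trans ?_
    exact Subtype.ext hl

/-- The pairwise fibre products form a common refinement; its points are summed in both orders. -/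
lemma Decomp.card_eq {X : Scheme.{u}} {s : X ⟶ Spec (.of k)} [IsSeparated s] (D D' : M.Decomp s) :
    D.card = D'.card := by
  choose R r1 r2 r3 a b h using fun (j : D.J) (j' : D'.J) =>
    exists_isPullback_spec s (D.f j) (D'.f j') (D.hf j) (D'.hf j')
  rw [card, card,
    Finset.sum_congr rfl fun j _ => D'.card_eq_sum_of_isPullback (D.f j) (D.hf j) (a j) (b j) (h j),
    Finset.sum_congr rfl fun j' _ => D.card_eq_sum_of_isPullback (D'.f j') (D'.hf j')
      (fun j => b j j') (fun j => a j j') (fun j => (h j j').flip), Finset.sum_comm]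

/-- A decomposition is obtained from decompositions of the members of a family of schemes whose
`K`-valued points decompose those of the given one. -/
lemma Decomp.exists_card_sum {X : Scheme.{u}} (s : X ⟶ Spec (.of k)) {I : Type} [Fintype I]
    {Y : I → Scheme.{u}} {t : ∀ i, Y i ⟶ Spec (.of k)} (D : ∀ i, M.Decomp (t i))
    (f : ∀ i, Y i ⟶ X) (hf : ∀ i, f i ≫ s = t i)
    (bij : Function.Bijective fun p : Σ i, M.Pt (t i) => Pt.map (f p.1) (hf p.1) p.2) :
    ∃ D' : M.Decomp s, D'.card = ∑ i, (D i).card := by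
  refine ⟨⟨Σ i, (D i).J, fun j => (D j.1).B j.2, fun j => (D j.1).f j.2 ≫ f j.1, fun j => ?_, ?_⟩, ?_⟩
  · rw [Category.assoc, hf, (D _).hf]
  · constructor
    · rintro ⟨⟨i, j⟩, p⟩ ⟨⟨i', j'⟩, p'⟩ e
      have e1 : Pt.map (f i) (hf i) (Pt.map ((D i).f j) ((D i).hf j) p) =
          Pt.map (f i') (hf i') (Pt.map ((D i').f j') ((D i').hf j') p') := by
        refine Subtype.ext ?_
        simpa [Pt.map] using congrArg Subtype.val e
      have e2 := @bij.1 ⟨i, _⟩ ⟨i', _⟩ e1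
      obtain rfl : i = i' := congrArg Sigma.fst e2
      have e3 := @(D i).bij.1 ⟨j, _⟩ ⟨j', _⟩ (eq_of_heq (Sigma.mk.inj e2).2)
      obtain rfl : j = j' := congrArg Sigma.fst e3
      obtain rfl : p = p' := eq_of_heq (Sigma.mk.inj e3).2
      rfl
    · intro q
      obtain ⟨⟨i, p⟩, rfl⟩ := bij.2 q
      obtain ⟨⟨j, p⟩, rfl⟩ := (D i).bij.2 p
      refine ⟨⟨⟨i, j⟩, p⟩, Subtype.ext ?_⟩
      simp [Pt.map]
  · simp only [card]
    rw [Fintype.sum_sigma]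

lemma Decomp.exists_card_spec (B : Type u) [CommRing B] [Algebra k B] [Algebra.FiniteType k B] :
    ∃ D : M.Decomp (specStr (k := k) B), D.card = M.card B := by
  refine ⟨⟨Unit, fun _ => B, fun _ => 𝟙 _, fun _ => by simp, ?_, ?_⟩, ?_⟩
  · rintro ⟨_, p⟩ ⟨_, p'⟩ e
    obtain rfl : p = p' := Subtype.ext (by simpa [Pt.map] using congrArg Subtype.val e)
    rfl
  · exact fun p => ⟨⟨(), p⟩, Subtype.ext (by simp [Pt.map])⟩
  · simp [card]

/-- A morphism from a reduced scheme factors through an immersion that contains its image. -/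
lemma _root_.MotivicPV.exists_lift_of_range_subset {A B C : Scheme.{u}} [IsReduced A] (f : A ⟶ C)
    (g : B ⟶ C) [IsImmersion g] (hr : Set.range f ⊆ Set.range g) : ∃ l, l ≫ g = f := by
  have hs : Surjective (pullback.fst f g) := by
    constructor
    rw [← Set.range_eq_univ, Scheme.Pullback.range_fst, Set.eq_univ_iff_forall]
    exact fun x => hr ⟨x, rfl⟩
  -- The base change of `g` to `A` is a surjective immersion, hence a surjective closed immersion,
  -- and this is an isomorphism because `A` is reduced.
  have : IsClosedImmersion (pullback.fst f g) :=
    .of_isPreimmersion _ (by rw [hs.surj.range_eq]; exact isClosed_univ)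
  have := isIso_of_isClosedImmersion_of_surjective (pullback.fst f g)
  exact ⟨inv (pullback.fst f g) ≫ pullback.snd f g, by simp [← pullback.condition]⟩

/-- Immersions onto the members of a partition induce a bijection on `K`-valued points. -/
lemma bijective_map_of_immersion {X : Scheme.{u}} {s : X ⟶ Spec (.of k)} {I : Type*}
    {Y : I → Scheme.{u}} {t : ∀ i, Y i ⟶ Spec (.of k)} (f : ∀ i, Y i ⟶ X) (hf : ∀ i, f i ≫ s = t i)
    [∀ i, IsImmersion (f i)] (h : ∀ x, ∃! i, x ∈ Set.range (f i)) :
    Function.Bijective fun p : Σ i, M.Pt (t i) => Pt.map (f p.1) (hf p.1) p.2 := by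
  -- The spectrum of `K` is one point, so the image of `o` decides which member of the partition a
  -- `K`-valued point belongs to.
  let o : Spec (.of M.K) := IsLocalRing.closedPoint M.K
  constructor
  · rintro ⟨i, p⟩ ⟨i', p'⟩ e
    have e1 : p.1 ≫ f i = p'.1 ≫ f i' := congrArg Subtype.val e
    have h1 : (p.1 ≫ f i) o ∈ Set.range (f i) := ⟨p.1 o, by simp⟩
    have h2 : (p.1 ≫ f i) o ∈ Set.range (f i') := by rw [e1]; exact ⟨p'.1 o, by simp⟩
    obtain rfl : i = i' := (h _).unique h1 h2
    rw [cancel_mono] at e1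
    rw [Subtype.ext e1]
  · intro p
    obtain ⟨i, hi, -⟩ := h (p.1 o)
    have : Subsingleton (Spec (.of M.K)) := inferInstanceAs (Subsingleton (PrimeSpectrum M.K))
    obtain ⟨l, hl⟩ := exists_lift_of_range_subset p.1 (f i) (by
      rintro _ ⟨x, rfl⟩
      rwa [Subsingleton.elim x o])
    exact ⟨⟨i, l, by rw [← hf, ← Category.assoc, hl, p.2]⟩, Subtype.ext hl⟩

/-- A scheme of finite type over `k` has a finite cover by spectra of algebras of finite type. -/
lemma _root_.MotivicPV.exists_finite_spec_cover {X : Scheme.{u}} (s : X ⟶ Spec (.of k))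
    [LocallyOfFiniteType s] [QuasiCompact s] :
    ∃ (n : ℕ) (R : Fin n → Type u) (_ : ∀ i, CommRing (R i)) (_ : ∀ i, Algebra k (R i))
      (_ : ∀ i, Algebra.FiniteType k (R i)) (f : ∀ i, Spec (.of (R i)) ⟶ X),
      (∀ i, IsOpenImmersion (f i)) ∧ (∀ i, f i ≫ s = specStr (R i)) ∧
      ∀ x, ∃ i, x ∈ Set.range (f i) := by
  have : CompactSpace X := QuasiCompact.compactSpace_of_compactSpace s
  let 𝒰 := X.affineCover.finiteSubcover
  let e : Fin (Fintype.card 𝒰.I₀) ≃ 𝒰.I₀ := (Fintype.equivFin _).symm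
  have (i : Fin (Fintype.card 𝒰.I₀)) : IsAffine (𝒰.X (e i)) := by
    change IsAffine (X.affineCover.X _); infer_instance
  choose R r1 r2 r3 σ hσ using fun i => exists_isoSpec (k := k) (𝒰.f (e i) ≫ s)
  refine ⟨_, R, r1, r2, r3, fun i => (σ i).inv ≫ 𝒰.f (e i), fun i => inferInstance, fun i => ?_,
    fun x => ?_⟩
  · rw [Category.assoc, ← hσ, Iso.inv_hom_id_assoc]
  · have hx : x ∈ Set.range (𝒰.f (𝒰.idx x)) := 𝒰.covers x
    obtain ⟨i, hi⟩ := e.surjective (𝒰.idx x)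
    rw [← hi] at hx
    obtain ⟨y, hy⟩ := hx
    exact ⟨i, (σ i).hom y, by rw [← hy]; simp⟩

lemma _root_.MotivicPV.exists_closed_spec (R : Type u) [CommRing R] [Algebra k R]
    [Algebra.FiniteType k R] {Z : Set (Spec (.of R))} (hZ : IsClosed Z) :
    ∃ (B : Type u) (_ : CommRing B) (_ : Algebra k B) (_ : Algebra.FiniteType k B) (c : Spec (.of B) ⟶ Spec (.of R)),
      IsClosedImmersion c ∧ c ≫ specStr R = specStr (k := k) B ∧ Set.range c = Z := by
  let I : Ideal R := PrimeSpectrum.vanishingIdeal (R := R) Z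
  refine ⟨R ⧸ I, inferInstance, inferInstance, inferInstance,
    Spec.map (CommRingCat.ofHom (Ideal.Quotient.mkₐ k I).toRingHom),
    IsClosedImmersion.spec_of_surjective _ Ideal.Quotient.mk_surjective, specMap_specStr _, ?_⟩
  refine (range_comap_of_surjective _ (Ideal.Quotient.mk I) Ideal.Quotient.mk_surjective).trans ?_
  rw [Ideal.mk_ker]
  exact (PrimeSpectrum.zeroLocus_vanishingIdeal_eq_closure (R := R) Z).trans hZ.closure_eq

/-- A scheme of finite type over `k` has a decomposition. -/
lemma nonempty_decomp {X : Scheme.{u}} (s : X ⟶ Spec (.of k)) [LocallyOfFiniteType s]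
    [QuasiCompact s] : Nonempty (M.Decomp s) := by
  classical
  obtain ⟨n, R, _, _, _, f, hfo, hf, hcov⟩ := exists_finite_spec_cover s
  -- Only the part of the `i`-th chart not covered by earlier charts is kept. It is closed in the
  -- chart, hence again affine, and the parts partition `X`.
  have hZ (i) : IsClosed {x : Spec (.of (R i)) | ∀ l < i, f i x ∉ Set.range (f l)} := by
    have : {x : Spec (.of (R i)) | ∀ l < i, f i x ∉ Set.range (f l)} =
      ⋂ l, ⋂ (_ : l < i), (f i) ⁻¹' (Set.range (f l))ᶜ := by ext; simp
    rw [this]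
    exact isClosed_iInter fun l => isClosed_iInter fun _ =>
      (IsOpenImmersion.isOpen_range (f l)).isClosed_compl.preimage (f i).continuous
  choose B _ _ _ c hc hcs hr using fun i => exists_closed_spec (k := k) (R i) (hZ i)
  have hcf (i : Fin n) : (c i ≫ f i) ≫ s = specStr (B i) := by rw [Category.assoc, hf, hcs]
  have (i : Fin n) : IsImmersion (c i ≫ f i) := inferInstance
  refine ⟨⟨Fin n, B, fun i => c i ≫ f i, hcf,
    bijective_map_of_immersion (fun i => c i ≫ f i) hcf fun x => ?_⟩⟩
  have hx : ∃ i, x ∈ Set.range (f i) := hcov x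
  have hr' (i) : x ∈ Set.range (c i ≫ f i) ↔ x ∈ Set.range (f i) ∧ ∀ l < i, x ∉ Set.range (f l) := by
    rw [Scheme.Hom.comp_base, TopCat.coe_comp, Set.range_comp, hr]
    constructor
    · rintro ⟨y, hy, rfl⟩
      exact ⟨⟨y, rfl⟩, hy⟩
    · rintro ⟨⟨y, rfl⟩, hy⟩
      exact ⟨y, hy, rfl⟩
  simp only [hr']
  refine ⟨Fin.find _ hx, ⟨Fin.find_spec hx, fun l hl => Fin.find_min hx hl⟩, fun j hj => ?_⟩
  exact le_antisymm (not_lt.1 fun h => hj.2 _ h (Fin.find_spec hx))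
    (not_lt.1 fun h => Fin.find_min hx h hj.1)

variable (M) in
/-- The number of points of a scheme of finite type over `k`. -/
def count {X : Scheme.{u}} (s : X ⟶ Spec (.of k)) [LocallyOfFiniteType s] [QuasiCompact s] :
    (M.U : Filter M.ι).Germ ℝ := (nonempty_decomp (M := M) s).some.card

section
variable {X : Scheme.{u}} {s : X ⟶ Spec (.of k)} [LocallyOfFiniteType s] [QuasiCompact s]
  [IsSeparated s]

lemma Decomp.card_eq_count (D : M.Decomp s) : D.card = M.count s := Decomp.card_eq _ _

/-- Decompositions of the members combine to one of `X`. The case of one member gives invariance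
under isomorphism, the case of two the scissor relation. -/
lemma count_eq_sum {I : Type} [Fintype I] {Y : I → Scheme.{u}} {t : ∀ i, Y i ⟶ Spec (.of k)}
    [∀ i, LocallyOfFiniteType (t i)] [∀ i, QuasiCompact (t i)]
    (f : ∀ i, Y i ⟶ X) (hf : ∀ i, f i ≫ s = t i) [∀ i, IsImmersion (f i)]
    (h : ∀ x, ∃! i, x ∈ Set.range (f i)) : M.count s = ∑ i, M.count (t i) := by
  obtain ⟨D, hD⟩ := Decomp.exists_card_sum s (fun i => (nonempty_decomp (M := M) (t i)).some) f hf
    (bijective_map_of_immersion f hf h)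
  rw [← D.card_eq_count, hD]; rfl

variable (M) in
lemma count_spec (B : Type u) [CommRing B] [Algebra k B] [Algebra.FiniteType k B]
    [LocallyOfFiniteType (specStr (k := k) B)] : M.count (specStr (k := k) B) = M.card B := by
  obtain ⟨D, hD⟩ := Decomp.exists_card_spec (M := M) (k := k) B
  rw [← D.card_eq_count, hD]

instance _root_.MotivicPV.finiteType_tensorProduct (B C : Type u) [CommRing B] [Algebra k B]
    [Algebra.FiniteType k B] [CommRing C] [Algebra k C] [Algebra.FiniteType k C] :
    Algebra.FiniteType k (TensorProduct k B C) :=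
  Algebra.FiniteType.trans (S := B) inferInstance inferInstance

open TensorProduct in
lemma card_tensor (B C : Type u) [CommRing B] [Algebra k B] [Algebra.FiniteType k B]
    [CommRing C] [Algebra k C] [Algebra.FiniteType k C] :
    M.card (B ⊗[k] C) = M.card B * M.card C := by
  obtain ⟨c, hc⟩ := Coding.exists_card_tensor (M.nonempty_coding B).some (M.nonempty_coding C).some
  rw [← c.card_eq, hc]; rfl

variable (M) in
lemma exists_isPullback_card_mul (B C : Type u) [CommRing B] [Algebra k B] [Algebra.FiniteType k B]
    [CommRing C] [Algebra k C] [Algebra.FiniteType k C] :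
    ∃ (R : Type u) (_ : CommRing R) (_ : Algebra k R) (_ : Algebra.FiniteType k R)
      (a : B →ₐ[k] R) (b : C →ₐ[k] R), IsPullback (Spec.map (CommRingCat.ofHom a.toRingHom))
        (Spec.map (CommRingCat.ofHom b.toRingHom)) (specStr (k := k) B) (specStr C) ∧
      M.card R = M.card B * M.card C :=
  ⟨TensorProduct k B C, inferInstance, inferInstance, inferInstance,
    Algebra.TensorProduct.includeLeft, Algebra.TensorProduct.includeRight,
    isPullback_SpecMap_of_isPushout _ _ _ _ (CommRingCat.isPushout_tensorProduct k _ _),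
    card_tensor B C⟩

/-- The products of a piece of `X` with a piece of `Y` decompose the points of the product; on each
of them the count is multiplicative by `card_tensor`. -/
lemma Decomp.exists_card_mul {X Y P : Scheme.{u}} {s : X ⟶ Spec (.of k)}
    {t : Y ⟶ Spec (.of k)} {r : P ⟶ Spec (.of k)} (p : P ⟶ X) (q : P ⟶ Y) (hp : p ≫ s = r) (h : IsPullback p q s t) (D : M.Decomp s)
    (D' : M.Decomp t) : ∃ E : M.Decomp r, E.card = D.card * D'.card := by
  have hq : q ≫ t = r := by rw [← h.w, hp]
  choose R _ _ _ il ir hpb hcard using fun (j : D.J) (j' : D'.J) =>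
    M.exists_isPullback_card_mul (D.B j) (D'.B j')
  have hlr (j j') : Spec.map (CommRingCat.ofHom (il j j').toRingHom) ≫ D.f j ≫ s =
    Spec.map (CommRingCat.ofHom (ir j j').toRingHom) ≫ D'.f j' ≫ t := by
      rw [D.hf, D'.hf, specMap_specStr, specMap_specStr]
  have hf (j : D.J × D'.J) : h.lift (Spec.map (CommRingCat.ofHom (il j.1 j.2).toRingHom) ≫ D.f j.1)
        (Spec.map (CommRingCat.ofHom (ir j.1 j.2).toRingHom) ≫ D'.f j.2)
        (by simpa using hlr j.1 j.2) ≫ r =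
      specStr (k := k) (R j.1 j.2) := by
    rw [← hp, h.lift_fst_assoc, Category.assoc, D.hf, specMap_specStr]
  refine ⟨⟨D.J × D'.J, fun j => R j.1 j.2, fun j => _, hf, ?_⟩, ?_⟩
  · constructor
    · rintro ⟨⟨j, j'⟩, x⟩ ⟨⟨l, l'⟩, y⟩ e
      have e0 := congrArg Subtype.val e
      have e1 : Pt.map (D.f j) (D.hf j) (Pt.map _ (specMap_specStr (il j j')) x) =
          Pt.map (D.f l) (D.hf l) (Pt.map _ (specMap_specStr (il l l')) y) := by
        refine Subtype.ext ?_
        simpa [Pt.map] using congrArg (· ≫ p) e0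
      have e2 : Pt.map (D'.f j') (D'.hf j') (Pt.map _ (specMap_specStr (ir j j')) x) =
          Pt.map (D'.f l') (D'.hf l') (Pt.map _ (specMap_specStr (ir l l')) y) := by
        refine Subtype.ext ?_
        simpa [Pt.map] using congrArg (· ≫ q) e0
      have e3 := @D.bij.1 ⟨j, _⟩ ⟨l, _⟩ e1
      have e4 := @D'.bij.1 ⟨j', _⟩ ⟨l', _⟩ e2
      obtain rfl : j = l := congrArg Sigma.fst e3
      obtain rfl : j' = l' := congrArg Sigma.fst e4
      have e5 := congrArg Subtype.val (eq_of_heq (Sigma.mk.inj e3).2)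
      have e6 := congrArg Subtype.val (eq_of_heq (Sigma.mk.inj e4).2)
      obtain rfl : x = y := Subtype.ext ((hpb j j').hom_ext e5 e6)
      rfl
    · intro x
      obtain ⟨⟨j, y⟩, hy⟩ := D.bij.2 (Pt.map p hp x)
      obtain ⟨⟨j', y'⟩, hy'⟩ := D'.bij.2 (Pt.map q hq x)
      obtain ⟨l, hl, hl'⟩ := (hpb j j').exists_lift y.1 y'.1 (y.2.trans y'.2.symm)
      have hl2 : l ≫ specStr (k := k) (R j j') = specStr M.K := by
        rw [← specMap_specStr (il j j'), ← Category.assoc, hl, y.2]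
      have h1 : y.1 ≫ D.f j = x.1 ≫ p := congrArg Subtype.val hy
      have h2 : y'.1 ≫ D'.f j' = x.1 ≫ q := congrArg Subtype.val hy'
      rw [← hl, Category.assoc] at h1
      rw [← hl', Category.assoc] at h2
      refine ⟨⟨⟨j, j'⟩, l, hl2⟩, Subtype.ext (h.hom_ext ?_ ?_)⟩
      · rw [← h1]
        change (l ≫ _) ≫ p = _
        rw [Category.assoc, h.lift_fst]
      · rw [← h2]
        change (l ≫ _) ≫ q = _
        rw [Category.assoc, h.lift_snd]
  · change ∑ j : D.J × D'.J, M.card (R j.1 j.2) = _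
    simp only [hcard]
    rw [Decomp.card, Decomp.card, Fintype.sum_prod_type, Finset.sum_mul_sum]

lemma count_prod {X Y P : Scheme.{u}} {s : X ⟶ Spec (.of k)} {t : Y ⟶ Spec (.of k)}
    {r : P ⟶ Spec (.of k)} [LocallyOfFiniteType s] [QuasiCompact s] [LocallyOfFiniteType t] [QuasiCompact t]
    [LocallyOfFiniteType r] [QuasiCompact r] [IsSeparated r] (p : P ⟶ X) (q : P ⟶ Y)
    (hp : p ≫ s = r) (h : IsPullback p q s t) : M.count r = M.count s * M.count t := by
  obtain ⟨E, hE⟩ := Decomp.exists_card_mul p q hp h (nonempty_decomp (M := M) s).some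
    (nonempty_decomp (M := M) t).some
  rw [← E.card_eq_count, hE]; rfl

end

end FiniteModel
end MotivicPV
end

/-! ### The point-counting measure on the Grothendieck ring and its localization -/

open CategoryTheory AlgebraicGeometry Limits
noncomputable section
namespace MotivicPV
namespace FiniteModel

variable {k : Type u} [Field k] (M : FiniteModel k)

/-- The motivic measure that counts points. -/
def measure : K0 k →+* (M.U : Filter M.ι).Germ ℝ :=
  Ideal.Quotient.lift _ (FreeCommRing.lift fun V : Variety k => M.count V.str) (by
    have h : ∀ a b, K0Rel k a b →
        FreeCommRing.lift (fun V : Variety k => M.count V.str) a =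
        FreeCommRing.lift (fun V : Variety k => M.count V.str) b := by
      intro a b hab
      induction hab with
      | iso V W e he =>
        simp only [FreeCommRing.lift_of]
        rw [count_eq_sum (I := Unit) (Y := fun _ => V.X) (t := fun _ => V.str) (fun _ => e.hom)
          (fun _ => he) fun x => ⟨(), ⟨e.inv x, by simp⟩, fun _ _ => rfl⟩]
        simp
      | scissor V W U i j hi hj hik hjk h =>
        simp only [FreeCommRing.lift_of, map_add]
        have hb (b : Bool) : IsImmersion (Bool.rec (motive := fun b => (Bool.rec U W b : Variety k).X ⟶ V.X) j i b) := by
          cases b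
          · exact (inferInstance : IsImmersion j)
          · exact (inferInstance : IsImmersion i)
        rw [count_eq_sum (I := Bool) (Y := fun b => (Bool.rec U W b : Variety k).X)
          (t := fun b => (Bool.rec U W b : Variety k).str)
          (fun b => Bool.rec (motive := fun b => (Bool.rec U W b : Variety k).X ⟶ V.X) j i b)
          (fun b => by cases b; exacts [hjk, hik]) fun x => ?_]
        · rw [Fintype.sum_bool, add_comm]
        · by_cases hx : x ∈ Set.range i
          · refine ⟨true, hx, fun b hb => ?_⟩
            cases b
            · have : x ∈ (Set.range i)ᶜ := h ▸ hb
              exact (this hx).elim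
            · rfl
          · have hx' : x ∈ Set.range j := by rw [h]; exact hx
            refine ⟨false, hx', fun b hb => ?_⟩
            cases b
            · rfl
            · exact (hx hb).elim
      | prod V W P p q hp h =>
        simp only [FreeCommRing.lift_of, map_mul]
        exact (count_prod p q hp h).symm
      | point V h =>
        simp only [FreeCommRing.lift_of, map_one]
        have hk : specStr (k := k) k = 𝟙 _ := by
          rw [specStr, Algebra.algebraMap_self]; exact Spec.map_id _
        have : LocallyOfFiniteType (specStr (k := k) k) := by rw [hk]; infer_instance
        have : QuasiCompact (specStr (k := k) k) := by rw [hk]; infer_instance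
        rw [count_eq_sum (I := Unit) (Y := fun _ => Spec (.of k)) (t := fun _ => specStr k)
          (fun _ => inv V.str) (fun _ => by rw [hk]; simp) fun x => ⟨(), ⟨V.str x, by
            rw [← Scheme.Hom.comp_apply]; simp⟩, fun _ _ => rfl⟩]
        obtain ⟨c, hc⟩ := Coding.exists_card_self (M := M)
        simp only [Finset.univ_unique, Finset.sum_const, Finset.card_singleton, one_smul]
        rw [count_spec, ← c.card_eq, hc]
    intro a ha
    have : Ideal.span {z | ∃ a b, K0Rel k a b ∧ z = a - b} ≤
        RingHom.ker (FreeCommRing.lift fun V : Variety k => M.count V.str) := by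
      rw [Ideal.span_le]
      rintro _ ⟨a, b, hab, rfl⟩
      exact (RingHom.sub_mem_ker_iff _).2 (h a b hab)
    exact this ha)

lemma measure_L : M.measure (K0.L k) = (M.q : M.ι → ℝ) := by
  have : LocallyOfFiniteType (specStr (k := k) (Polynomial k)) := (affineLine k).locallyOfFiniteType
  obtain ⟨c, hc⟩ := Coding.exists_card_polynomial (M := M)
  rw [← hc, c.card_eq, ← count_spec]
  exact FreeCommRing.lift_of _ _

/-- The measure, with a root of the class of the affine line. -/
def measureRoot (d : ℕ) [NeZero d] : K0Root k d →+* (M.U : Filter M.ι).Germ ℝ :=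
  AdjoinRoot.lift M.measure
    -- Counts are taken in germs of real functions so that the positive number `q` has a `d`-th
    -- root.
    ((fun s => M.q s ^ (-(1 : ℝ) / d) : M.ι → ℝ) : (M.U : Filter M.ι).Germ ℝ) (by
      simp only [Polynomial.eval₂_sub, Polynomial.eval₂_mul, Polynomial.eval₂_C,
        Polynomial.eval₂_X_pow, Polynomial.eval₂_one, sub_eq_zero, measure_L]
      rw [← Filter.Germ.coe_pow, ← Filter.Germ.coe_mul, ← Filter.Germ.coe_one]
      congr 1
      ext s
      have hq : 0 < M.q s := zero_lt_one.trans (M.one_lt_q s)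
      have hd : (d : ℝ) ≠ 0 := NeZero.ne _
      simp only [Pi.mul_apply, Pi.pow_apply, Pi.one_apply]
      rw [← Real.rpow_natCast, ← Real.rpow_mul hq.le, div_mul_cancel₀ _ hd, Real.rpow_neg_one,
        mul_inv_cancel₀ hq.ne'])

lemma measureRoot_Lpow (d : ℕ) [NeZero d] (i : ℤ) : M.measureRoot d (K0Root.Lpow k d i) =
    ((fun s => M.q s ^ ((i : ℝ) / d) : M.ι → ℝ) : (M.U : Filter M.ι).Germ ℝ) := by
  have h : M.measureRoot d (K0Root.rootUnit k d) =
      ((fun s => M.q s ^ (-(1 : ℝ) / d) : M.ι → ℝ) : (M.U : Filter M.ι).Germ ℝ) :=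
    AdjoinRoot.lift_root _
  have h2 : M.measureRoot d (K0Root.Lpow k d i) =
      ((Units.map (M.measureRoot d).toMonoidHom (K0Root.rootUnit k d ^ (-i)) :
        ((M.U : Filter M.ι).Germ ℝ)ˣ) : (M.U : Filter M.ι).Germ ℝ) := rfl
  rw [h2, map_zpow, Units.val_zpow_eq_zpow_val]
  refine (congrArg (· ^ (-i)) h).trans ?_
  change (((fun s => M.q s ^ (-(1 : ℝ) / d)) ^ (-i) : M.ι → ℝ) : (M.U : Filter M.ι).Germ ℝ) = _
  congr 1
  ext s
  have hq : 0 < M.q s := zero_lt_one.trans (M.one_lt_q s)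
  simp only [Pi.pow_apply]
  rw [← Real.rpow_intCast, ← Real.rpow_mul hq.le]
  congr 1
  push_cast
  ring

/-- A nontrivial real power of `q > 1` is never `1`, as its logarithm is nonzero. -/
lemma measureRoot_ne_zero (d : ℕ) [NeZero d] (i : ℤ) (hi : i ≠ 0) :
    M.measureRoot d (K0Root.Lpow k d i - 1) ≠ 0 := by
  rw [map_sub, map_one, measureRoot_Lpow, sub_ne_zero, ← Filter.Germ.coe_one, Ne, Filter.Germ.coe_eq]
  intro h
  obtain ⟨s, hs⟩ := Filter.Eventually.exists h
  have hq := M.one_lt_q s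
  have hd : (d : ℝ) ≠ 0 := NeZero.ne _
  have hs' : Real.log (M.q s ^ ((i : ℝ) / d)) = 0 := by
    rw [show M.q s ^ ((i : ℝ) / d) = 1 from hs, Real.log_one]
  rw [Real.log_rpow (zero_lt_one.trans hq), mul_eq_zero, div_eq_zero_iff] at hs'
  exact hs'.elim (fun h => h.elim (fun h => hi (by exact_mod_cast h)) hd) (Real.log_pos hq).ne'

/-- The measure on the localized ring. -/
def measureLoc (d : ℕ) [NeZero d] : K0Loc k d →+* (M.U : Filter M.ι).Germ ℝ :=
  IsLocalization.lift (M := Submonoid.closure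
    {z : K0Root k d | ∃ i : ℤ, i ≠ 0 ∧ z = K0Root.Lpow k d i - 1}) (g := M.measureRoot d) (by
      rintro ⟨y, hy⟩
      -- Germs along an ultrafilter form a field, so it is enough that the generators of the
      -- submonoid do not map to zero.
      rw [isUnit_iff_ne_zero]
      induction hy using Submonoid.closure_induction with
      | mem x hx => obtain ⟨i, hi, rfl⟩ := hx; exact M.measureRoot_ne_zero d i hi
      | one => simp
      | mul x y _ _ hx hy => simpa using ⟨hx, hy⟩)

lemma measureLoc_Lpow (d : ℕ) [NeZero d] (i : ℤ) : M.measureLoc d (K0Loc.Lpow k d i) =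
    ((fun s => M.q s ^ ((i : ℝ) / d) : M.ι → ℝ) : (M.U : Filter M.ι).Germ ℝ) := by
  rw [measureLoc, K0Loc.Lpow, IsLocalization.lift_eq, measureRoot_Lpow]

end FiniteModel

/-- The measure sends this element to the germ of a function with positive values. -/
theorem K0Loc.Lpow_mul_ne_zero (k : Type u) [Field k] :
    K0Loc.Lpow k 2 (-3) * (K0Loc.Lpow k 2 2 + K0Loc.Lpow k 2 1 + 1) ≠ 0 := by
  obtain ⟨M⟩ := exists_finiteModel k
  intro h
  have := congrArg (M.measureLoc 2) h
  simp only [map_mul, map_add, map_one, map_zero, M.measureLoc_Lpow] at this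
  rw [← Filter.Germ.coe_one, ← Filter.Germ.coe_add, ← Filter.Germ.coe_add, ← Filter.Germ.coe_mul,
    ← Filter.Germ.coe_zero, Filter.Germ.coe_eq] at this
  obtain ⟨s, hs⟩ := Filter.Eventually.exists this
  have hq : 0 < M.q s := zero_lt_one.trans (M.one_lt_q s)
  refine absurd hs (ne_of_gt ?_)
  simp only [Pi.mul_apply, Pi.add_apply, Pi.one_apply, Pi.zero_apply]
  positivity

end MotivicPV
end

open CategoryTheory AlgebraicGeometry
noncomputable section
namespace MotivicPV

/-! ### The standard charts of the projective plane -/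

lemma eval₂_mul_of_isHomogeneous {R S σ : Type*} [CommSemiring R] [CommSemiring S] {n : ℕ}
    {F : MvPolynomial σ R} (hF : F.IsHomogeneous n) (f : R →+* S) (c : S) (g : σ → S) :
    F.eval₂ f (fun i => c * g i) = c ^ n * F.eval₂ f g := by
  rw [MvPolynomial.eval₂_eq, MvPolynomial.eval₂_eq, Finset.mul_sum]
  refine Finset.sum_congr rfl fun d hd => ?_
  have h := hF (MvPolynomial.mem_support_iff.1 hd)
  rw [Finsupp.weight_apply, Finsupp.sum] at h
  simp only [Pi.one_apply, smul_eq_mul, mul_one] at h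
  simp only [mul_pow, Finset.prod_mul_distrib, Finset.prod_pow_eq_pow_sum, h]
  ring

open MvPolynomial HomogeneousLocalization

namespace P2

variable {k : Type u} [Field k]

/-- Dehomogenization with respect to the coordinate `X_j`. -/
def dehom (j : Fin 3) : MvPolynomial (Fin 3) k →ₐ[k] MvPolynomial (Fin 2) k :=
  aeval (j.insertNth (α := fun _ => MvPolynomial (Fin 2) k) 1 X)

@[simp] lemma dehom_X_self (j : Fin 3) : dehom (k := k) j (X j) = 1 := by simp [dehom]

@[simp] lemma dehom_X_succAbove (j : Fin 3) (i : Fin 2) :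
    dehom (k := k) j (X (j.succAbove i)) = X i := by simp [dehom]

@[simp] lemma dehom_C (j : Fin 3) (c : k) : dehom j (C c) = C c := by
  simp [dehom, MvPolynomial.algebraMap_eq]

variable (k) in
/-- The coordinate ring of the standard chart. -/
abbrev Aw (j : Fin 3) : Type u := HomogeneousLocalization.Away (Gr k) (X j)

/-- The fraction `F / X_j ^ n`. -/
def awMk (j : Fin 3) (n : ℕ) (F : MvPolynomial (Fin 3) k) (hF : F.IsHomogeneous n) : Aw k j :=
  Away.mk (Gr k) (f := X j) (d := 1) (isHomogeneous_X k j) n F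
    (by simpa [mem_homogeneousSubmodule] using hF)

lemma exists_awMk (j : Fin 3) (a : Aw k j) : ∃ n F hF, a = awMk j n F hF := by
  obtain ⟨n, F, hF, rfl⟩ := Away.mk_surjective (Gr k) (isHomogeneous_X k j) a
  exact ⟨n, F, by simpa [mem_homogeneousSubmodule] using hF, rfl⟩

/-- Dehomogenization of fractions. -/
def awHom (j : Fin 3) : Aw k j →+* MvPolynomial (Fin 2) k :=
  (IsLocalization.Away.lift (S := Localization.Away (X j : MvPolynomial (Fin 3) k)) (X j)
    (g := (dehom (k := k) j).toRingHom) (by simp)).comp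
  (algebraMap (Aw k j) (Localization.Away (X j : MvPolynomial (Fin 3) k)))

lemma val_awMk (j : Fin 3) (n : ℕ) (F : MvPolynomial (Fin 3) k) (hF : F.IsHomogeneous n) :
    (awMk j n F hF).val =
      Localization.mk F (⟨X j ^ n, n, rfl⟩ : Submonoid.powers (X j : MvPolynomial (Fin 3) k)) := rfl

lemma awHom_awMk (j : Fin 3) (n : ℕ) (F : MvPolynomial (Fin 3) k) (hF : F.IsHomogeneous n) :
    awHom j (awMk j n F hF) = dehom j F := by
  have h : algebraMap (Aw k j) (Localization.Away (X j : MvPolynomial (Fin 3) k)) (awMk j n F hF) =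
      Localization.mk F (⟨X j ^ n, n, rfl⟩ : Submonoid.powers (X j : MvPolynomial (Fin 3) k)) := val_awMk j n F hF
  rw [awHom, RingHom.comp_apply, h, Localization.mk_eq_mk', IsLocalization.Away.lift,
    IsLocalization.lift_mk'_spec]
  simp

/-- The constants of the chart. -/
def awC (j : Fin 3) : k →+* Aw k j := (fromZeroRingHom (Gr k) _).comp (algebraMap k (Gr k 0))

/-- The inverse of `awHom`. -/
def awInv (j : Fin 3) : MvPolynomial (Fin 2) k →+* Aw k j :=
  eval₂Hom (awC j) fun i => awMk j 1 (X (j.succAbove i)) (isHomogeneous_X k _)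

lemma val_awC (j : Fin 3) (c : k) : (awC j c).val =
    algebraMap (MvPolynomial (Fin 3) k) (Localization.Away (X j : MvPolynomial (Fin 3) k)) (C c) := by
  change Localization.mk _ 1 = _
  rw [Localization.mk_one_eq_algebraMap]; rfl

/-- In the localization at `X j` both sides can be compared: substituting `X i / X j` into a
homogeneous `F` of degree `n` gives `F / X j ^ n`. -/
lemma awInv_dehom (j : Fin 3) (n : ℕ) (F : MvPolynomial (Fin 3) k) (hF : F.IsHomogeneous n) :
    awInv j (dehom j F) = awMk j n F hF := by
  refine val_injective _ ?_
  let L := Localization.Away (X j : MvPolynomial (Fin 3) k)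
  let s : L := Localization.mk (1 : MvPolynomial (Fin 3) k) (⟨X j, 1, pow_one _⟩ : Submonoid.powers (X j : MvPolynomial (Fin 3) k))
  have hs : algebraMap (MvPolynomial (Fin 3) k) L (X j) * s = 1 := by
    rw [← Localization.mk_one_eq_algebraMap, Localization.mk_mul, ← Localization.mk_one]
    exact Localization.mk_eq_mk_iff.2 (Localization.r_of_eq (by simp))
  have hX (i : Fin 3) : (awInv j (dehom j (X i))).val = s * algebraMap (MvPolynomial (Fin 3) k) L (X i) := by
    induction i using j.succAboveCases with
    | x => rw [dehom_X_self, map_one, mul_comm, hs]; exact HomogeneousLocalization.val_one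
    | p i =>
      rw [dehom_X_succAbove, awInv, coe_eval₂Hom, eval₂_X]
      refine (val_awMk ..).trans ?_
      rw [← Localization.mk_one_eq_algebraMap, Localization.mk_mul]
      simp
  have h1 : ((algebraMap (Aw k j) L).comp ((awInv j).comp (dehom j).toRingHom)) F =
      F.eval₂ ((algebraMap (MvPolynomial (Fin 3) k) L).comp C) (fun i => s * algebraMap (MvPolynomial (Fin 3) k) L (X i)) := by
    rw [← coe_eval₂Hom]
    congr 1
    refine ringHom_ext (fun c => ?_) fun i => ?_
    · rw [coe_eval₂Hom, eval₂_C, RingHom.comp_apply, RingHom.comp_apply]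
      change algebraMap (Aw k j) L (awInv j (dehom j (C c))) = _
      rw [dehom_C, awInv, coe_eval₂Hom, eval₂_C]
      exact val_awC j c
    · rw [coe_eval₂Hom, eval₂_X]
      exact hX i
  rw [eval₂_mul_of_isHomogeneous hF] at h1
  have h2 : F.eval₂ ((algebraMap (MvPolynomial (Fin 3) k) L).comp C) (fun i => algebraMap (MvPolynomial (Fin 3) k) L (X i)) = algebraMap (MvPolynomial (Fin 3) k) L F := by
    have : eval₂Hom ((algebraMap (MvPolynomial (Fin 3) k) L).comp C) (fun i => algebraMap (MvPolynomial (Fin 3) k) L (X i)) =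
        algebraMap (MvPolynomial (Fin 3) k) L :=
      ringHom_ext (fun c => by simp) fun i => by simp
    exact congrArg (fun f => f F) this
  rw [h2] at h1
  refine h1.trans ?_
  refine Eq.trans ?_ (val_awMk ..).symm
  rw [← Localization.mk_one_eq_algebraMap, Localization.mk_pow, Localization.mk_mul]
  simp only [one_pow, one_mul, mul_one]
  rfl

/-- The coordinate ring of the standard chart is a polynomial ring. -/
def awEquiv (j : Fin 3) : Aw k j ≃+* MvPolynomial (Fin 2) k :=
  RingEquiv.ofRingHom (awHom j) (awInv j)
    (ringHom_ext (fun c => by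
      have h : awC j c = awMk j 0 (C c) (isHomogeneous_C _ c) := by
        rw [← awInv_dehom, dehom_C, awInv, coe_eval₂Hom, eval₂_C]
      rw [RingHom.comp_apply, awInv, coe_eval₂Hom, eval₂_C, h, awHom_awMk, dehom_C]; rfl)
      fun i => by
        rw [RingHom.comp_apply, awInv, coe_eval₂Hom, eval₂_X, awHom_awMk, dehom_X_succAbove]; rfl)
    (by
      ext a : 1
      obtain ⟨n, F, hF, rfl⟩ := exists_awMk j a
      rw [RingHom.comp_apply, awHom_awMk, awInv_dehom j n F hF]; rfl)

lemma awEquiv_awMk (j : Fin 3) (n : ℕ) (F : MvPolynomial (Fin 3) k) (hF : F.IsHomogeneous n) :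
    awEquiv j (awMk j n F hF) = dehom j F := awHom_awMk ..

lemma awEquiv_symm_dehom (j : Fin 3) (n : ℕ) (F : MvPolynomial (Fin 3) k) (hF : F.IsHomogeneous n) :
    (awEquiv j).symm (dehom j F) = awMk j n F hF := awInv_dehom ..

lemma exists_dehom (j : Fin 3) (f : MvPolynomial (Fin 2) k) :
    ∃ (n : ℕ) (F : MvPolynomial (Fin 3) k), F.IsHomogeneous n ∧ dehom j F = f := by
  obtain ⟨n, F, hF, h⟩ := exists_awMk j ((awEquiv j).symm f)
  exact ⟨n, F, hF, by rw [← awEquiv_awMk j n F hF, ← h, RingEquiv.apply_symm_apply]⟩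

end P2
end MotivicPV
end

/-! ### Charts as affine planes, smoothness, and germs of sections -/

open CategoryTheory AlgebraicGeometry
noncomputable section
namespace MotivicPV
open MvPolynomial HomogeneousLocalization

/-- The canonical presentation of a polynomial ring, without relations. -/
def mvPolynomialPresentation (R ι : Type*) [CommRing R] :
    Algebra.SubmersivePresentation R (MvPolynomial ι R) ι PEmpty.{1} where
  __ := Algebra.Generators.mvPolynomial R ι
  relation := PEmpty.elim
  span_range_relation_eq_ker := by
    rw [Algebra.Generators.ker_eq_ker_aeval_val, Set.range_eq_empty, Ideal.span_empty, eq_comm,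
      ← RingHom.injective_iff_ker_eq_bot]
    exact fun a b h => by simpa [Algebra.Generators.mvPolynomial_val] using h
  map := PEmpty.elim
  map_inj a := a.elim
  jacobian_isUnit := by
    rw [Algebra.PreSubmersivePresentation.jacobian_eq_jacobiMatrix_det, Matrix.det_isEmpty,
      map_one]
    exact isUnit_one

instance (R : Type*) [CommRing R] (n : ℕ) :
    Algebra.IsStandardSmoothOfRelativeDimension n R (MvPolynomial (Fin n) R) :=
  (mvPolynomialPresentation R (Fin n)).isStandardSmoothOfRelativeDimension
    (by simp [Algebra.Presentation.dimension])

namespace P2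

variable {k : Type u} [Field k]

lemma X_mem (j : Fin 3) : (X j : MvPolynomial (Fin 3) k) ∈ Gr k 1 := isHomogeneous_X k j

variable (k) in
/-- The standard open subset `X_j ≠ 0` of the projective plane. -/
abbrev U (j : Fin 3) : (P2Scheme k).Opens := Proj.basicOpen (Gr k) (X j)

/-- The sections over a standard chart. -/
def sec (j : Fin 3) : MvPolynomial (Fin 2) k ≃+* Γ(P2Scheme k, U k j) :=
  (awEquiv j).symm.trans
    (Proj.basicOpenIsoAway (Gr k) (X j) (X_mem j) zero_lt_one).commRingCatIsoToRingEquiv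

lemma sec_dehom (j : Fin 3) (n : ℕ) (F : MvPolynomial (Fin 3) k) (hF : F.IsHomogeneous n) :
    sec j (dehom j F) = Proj.awayToSection (Gr k) (X j) (awMk j n F hF) := by
  change (Proj.basicOpenIsoAway (Gr k) (X j) (X_mem j) zero_lt_one).hom _ = _
  rw [Proj.basicOpenIsoAway_hom]
  exact congrArg _ (awEquiv_symm_dehom j n F hF)

variable (k) in
/-- The open immersion of a standard chart. -/
def chart (j : Fin 3) : Spec (.of (MvPolynomial (Fin 2) k)) ⟶ P2Scheme k :=
  Spec.map (CommRingCat.ofHom (awEquiv j).toRingHom) ≫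
    Proj.awayι (Gr k) (X j) (X_mem j) zero_lt_one

instance (j : Fin 3) : IsIso (Spec.map (CommRingCat.ofHom (awEquiv (k := k) j).toRingHom)) := by
  have : IsIso (CommRingCat.ofHom (awEquiv (k := k) j).toRingHom) :=
    (awEquiv (k := k) j).toCommRingCatIso.isIso_hom
  infer_instance

instance (j : Fin 3) : IsOpenImmersion (chart k j) := by unfold chart; infer_instance

lemma opensRange_chart (j : Fin 3) : (chart k j).opensRange = U k j := by
  exact (Scheme.Hom.opensRange_comp_of_isIso _ _).trans
    (Proj.opensRange_awayι (Gr k) (X j) (X_mem j) zero_lt_one)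

lemma awEquiv_awC (j : Fin 3) (c : k) : awEquiv j (awC j c) = C c := by
  have h : awC j c = (awEquiv j).symm (C c) := by
    change _ = awInv j (C c)
    rw [awInv, coe_eval₂Hom, eval₂_C]
  rw [h, RingEquiv.apply_symm_apply]

lemma chart_str (j : Fin 3) : chart k j ≫ P2Hom k = Spec.map (CommRingCat.ofHom C) := by
  rw [chart, P2Hom, Category.assoc, Proj.awayι_toSpecZero_assoc, ← Spec.map_comp, ← Spec.map_comp]
  exact congrArg (fun f => Spec.map (CommRingCat.ofHom f)) (RingHom.ext (awEquiv_awC j))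

lemma awayι_str (j : Fin 3) :
    Proj.awayι (Gr k) (X j) (X_mem j) zero_lt_one ≫ P2Hom k =
      Spec.map (CommRingCat.ofHom (awC j)) := by
  rw [P2Hom, Proj.awayι_toSpecZero_assoc, ← Spec.map_comp]
  rfl

/-- The coordinates generate `k[X, Y, Z]` as an algebra over its part of degree zero. -/
lemma iSup_U : ⨆ j, U k j = ⊤ := by
  refine Proj.iSup_basicOpen_eq_top' _ _ (fun j => ⟨1, isHomogeneous_X k j⟩) ?_
  refine Algebra.eq_top_iff.2 fun F => ?_
  have hs : IsScalarTower k (Gr k 0) (MvPolynomial (Fin 3) k) :=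
    IsScalarTower.of_algebraMap_eq (R := k) (S := Gr k 0) (A := MvPolynomial (Fin 3) k) fun _ => rfl
  have h : F ∈ Algebra.adjoin k (Set.range (X : Fin 3 → MvPolynomial (Fin 3) k)) := by
    rw [MvPolynomial.adjoin_range_X]; trivial
  induction F using MvPolynomial.induction_on with
  | C c => exact Subalgebra.algebraMap_mem (R := Gr k 0) _ (⟨C c, isHomogeneous_C _ c⟩ : Gr k 0)
  | add p q hp hq =>
    exact add_mem (hp (by rw [MvPolynomial.adjoin_range_X]; trivial))
      (hq (by rw [MvPolynomial.adjoin_range_X]; trivial))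
  | mul_X p i hp =>
    exact mul_mem (hp (by rw [MvPolynomial.adjoin_range_X]; trivial))
      (Algebra.subset_adjoin ⟨i, rfl⟩)

lemma exists_mem_U (x : P2Scheme k) : ∃ j, x ∈ U k j := by
  have : x ∈ (⨆ j, U k j : (P2Scheme k).Opens) := by rw [iSup_U]; trivial
  simpa only [TopologicalSpace.Opens.mem_iSup] using this

instance smooth_chart (j : Fin 3) : SmoothOfRelativeDimension 2 (chart k j ≫ P2Hom k) := by
  rw [chart_str, HasRingHomProperty.Spec_iff (P := @SmoothOfRelativeDimension 2)]
  refine RingHom.locally_of RingHom.isStandardSmoothOfRelativeDimension_respectsIso _ ?_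
  exact (RingHom.isStandardSmoothOfRelativeDimension_algebraMap 2).2 inferInstance

/-- Smoothness is local on the source, and the charts are affine planes. -/
instance : SmoothOfRelativeDimension 2 (P2Hom k) := by
  have : IsZariskiLocalAtSource (@SmoothOfRelativeDimension.{u} 2) :=
    HasRingHomProperty.instIsZariskiLocalAtSource
      (Q := RingHom.Locally (RingHom.IsStandardSmoothOfRelativeDimension 2))
  refine IsZariskiLocalAtSource.of_iSup_eq_top (U k) iSup_U fun j => ?_
  have h := opensRange_chart (k := k) j
  rw [← h, ← IsOpenImmersion.isoOfRangeEq_inv_fac (chart k j) (Scheme.Opens.ι _)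
    (congr_arg TopologicalSpace.Opens.carrier (chart k j).opensRange.opensRange_ι.symm),
    Category.assoc]
  exact IsZariskiLocalAtSource.comp (smooth_chart j) _

/-! ### Values of sections -/

/-- The homogeneous prime ideal of a point. -/
def hid (x : P2Scheme k) : Ideal (MvPolynomial (Fin 3) k) :=
  (x : ProjectiveSpectrum (Gr k)).asHomogeneousIdeal.toIdeal

instance (x : P2Scheme k) : (hid x).IsPrime := ProjectiveSpectrum.isPrime _

/-- The value of a germ in the localization of the homogeneous coordinate ring. -/
def stalkVal (x : P2Scheme k) :
    (P2Scheme k).presheaf.stalk x →+* Localization.AtPrime (hid x) :=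
  (algebraMap (AtPrime (Gr k) (hid x)) _).comp (Proj.stalkIso (Gr k) x).hom.hom

lemma stalkVal_injective (x : P2Scheme k) : Function.Injective (stalkVal x) :=
  (val_injective _).comp (Proj.stalkIso (Gr k) x).commRingCatIsoToRingEquiv.injective

lemma isUnit_stalkVal (x : P2Scheme k) (a : (P2Scheme k).presheaf.stalk x) :
    IsUnit (stalkVal x a) ↔ IsUnit a := by
  change IsUnit (HomogeneousLocalization.val _) ↔ _
  refine (HomogeneousLocalization.isUnit_iff_isUnit_val ..).trans ?_
  exact MulEquiv.isUnit_map (Proj.stalkIso (Gr k) x).commRingCatIsoToRingEquiv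

/-- The germs of the sections over a chart. -/
def toStalk (j : Fin 3) (x : P2Scheme k) (hx : x ∈ U k j) :
    MvPolynomial (Fin 2) k →+* (P2Scheme k).presheaf.stalk x :=
  ((P2Scheme k).presheaf.germ (U k j) x hx).hom.comp (sec j).toRingHom

/-- Germs from different charts become fractions in one and the same localization of `k[X, Y, Z]`,
where they can be compared. -/
lemma stalkVal_toStalk (j : Fin 3) (x : P2Scheme k) (hx : x ∈ U k j) (n : ℕ)
    (F : MvPolynomial (Fin 3) k) (hF : F.IsHomogeneous n) :
    stalkVal x (toStalk j x hx (dehom j F)) =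
      Localization.mk F (⟨X j ^ n, fun h => hx ((inferInstance : (hid x).IsPrime).mem_of_pow_mem _ h)⟩ :
        (hid x).primeCompl) := by
  have h1 : toStalk j x hx (dehom j F) = (P2Scheme k).presheaf.germ (U k j) x hx
      (Proj.awayToSection (Gr k) (X j) (awMk j n F hF)) := by
    rw [← sec_dehom]; rfl
  have h2 := congrArg (fun f => f.hom (awMk j n F hF))
    (ProjectiveSpectrum.Proj.awayToSection_germ (Gr k) (X j) x hx)
  have h3 : toStalk j x hx (dehom j F) = (Proj.stalkIso (Gr k) x).inv
    (HomogeneousLocalization.mapId (Gr k) (Submonoid.powers_le.mpr hx) (awMk j n F hF)) := h1.trans h2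
  rw [h3]
  exact congrArg HomogeneousLocalization.val
    ((Proj.stalkIso (Gr k) x).commRingCatIsoToRingEquiv.apply_symm_apply _)

end P2
end MotivicPV
end

open CategoryTheory AlgebraicGeometry
noncomputable section
namespace MotivicPV
open MvPolynomial HomogeneousLocalization

/-! ### Stalks and the function field through a chart -/

/-- The stalk is a localization of the sections over `U`; this is carried along `θ` to a more
convenient ring, here the polynomial ring of a chart. -/
lemma isLocalization_atPrime_stalk {X : Scheme.{u}} {U : X.Opens} (hU : IsAffineOpen U)
    {R : Type u} [CommRing R] (θ : R ≃+* Γ(X, U)) (x : X) (hx : x ∈ U) :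
    letI := ((X.presheaf.germ U x hx).hom.comp θ.toRingHom).toAlgebra
    IsLocalization.AtPrime (X.presheaf.stalk x) ((IsLocalRing.maximalIdeal (X.presheaf.stalk x)).comap
      ((X.presheaf.germ U x hx).hom.comp θ.toRingHom)) := by
  let := ((X.presheaf.germ U x hx).hom.comp θ.toRingHom).toAlgebra
  let _ : Algebra Γ(X, U) (X.presheaf.stalk x) := (X.presheaf.germ U x hx).hom.toAlgebra
  have h : IsLocalization (hU.primeIdealOf ⟨x, hx⟩).asIdeal.primeCompl (X.presheaf.stalk x) :=
    hU.isLocalization_stalk ⟨x, hx⟩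
  have hp : (hU.primeIdealOf ⟨x, hx⟩).asIdeal =
      (IsLocalRing.maximalIdeal (X.presheaf.stalk x)).comap (X.presheaf.germ U x hx).hom := by
    rw [hU.primeIdealOf_eq_map_closedPoint]; rfl
  have hmem (r : Γ(X, U)) : r ∉ (hU.primeIdealOf ⟨x, hx⟩).asIdeal ↔
      IsUnit ((X.presheaf.germ U x hx).hom r) := by
    rw [hp, Ideal.mem_comap, IsLocalRing.mem_maximalIdeal, mem_nonunits_iff, not_not]
  refine ⟨fun r => ?_, fun z => ?_, fun {a b} hab => ?_⟩
  · have := r.2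
    rwa [Ideal.mem_primeCompl_iff, Ideal.mem_comap, IsLocalRing.mem_maximalIdeal, mem_nonunits_iff, not_not] at this
  · obtain ⟨⟨a, b⟩, hab⟩ := IsLocalization.surj (hU.primeIdealOf ⟨x, hx⟩).asIdeal.primeCompl z
    refine ⟨⟨θ.symm a, θ.symm b, ?_⟩, ?_⟩
    · rw [Ideal.mem_primeCompl_iff, Ideal.mem_comap, IsLocalRing.mem_maximalIdeal, mem_nonunits_iff, not_not]
      simpa using (hmem b).1 b.2
    · simpa [RingHom.algebraMap_toAlgebra] using hab
  · obtain ⟨c, hc⟩ := IsLocalization.exists_of_eq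
      (M := (hU.primeIdealOf ⟨x, hx⟩).asIdeal.primeCompl) (S := X.presheaf.stalk x)
      (x := θ a) (y := θ b) hab
    refine ⟨⟨θ.symm c, ?_⟩, ?_⟩
    · rw [Ideal.mem_primeCompl_iff, Ideal.mem_comap, IsLocalRing.mem_maximalIdeal, mem_nonunits_iff, not_not]
      simpa using (hmem c).1 c.2
    · apply θ.injective
      simpa using hc

namespace P2

variable {k : Type u} [Field k]

/-- The prime ideal of a point in the coordinate ring of a chart. -/
def prime (j : Fin 3) (x : P2Scheme k) (hx : x ∈ U k j) : Ideal (MvPolynomial (Fin 2) k) :=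
  (IsLocalRing.maximalIdeal ((P2Scheme k).presheaf.stalk x)).comap (toStalk j x hx)

instance (j : Fin 3) (x : P2Scheme k) (hx : x ∈ U k j) : (prime j x hx).IsPrime :=
  Ideal.comap_isPrime ..

lemma notMem_prime_iff (j : Fin 3) (x : P2Scheme k) (hx : x ∈ U k j) (r : MvPolynomial (Fin 2) k) :
    r ∉ prime j x hx ↔ IsUnit (toStalk j x hx r) := by
  rw [prime, Ideal.mem_comap, IsLocalRing.mem_maximalIdeal, mem_nonunits_iff, not_not]

/-- The fraction `F / X j ^ n` is a unit in the localization at `hid x` exactly when `F` lies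
outside `hid x`. -/
lemma dehom_mem_prime (j : Fin 3) (x : P2Scheme k) (hx : x ∈ U k j) {n : ℕ}
    {F : MvPolynomial (Fin 3) k} (hF : F.IsHomogeneous n) :
    dehom j F ∈ prime j x hx ↔ F ∈ hid x := by
  rw [← not_iff_not, notMem_prime_iff, ← isUnit_stalkVal, stalkVal_toStalk j x hx n F hF,
    Localization.mk_eq_mk', IsLocalization.AtPrime.isUnit_mk'_iff _ (hid x)]
  rfl

lemma isLocalization_toStalk (j : Fin 3) (x : P2Scheme k) (hx : x ∈ U k j) :
    letI := (toStalk j x hx).toAlgebra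
    IsLocalization.AtPrime ((P2Scheme k).presheaf.stalk x) (prime j x hx) :=
  isLocalization_atPrime_stalk
    (Proj.isAffineOpen_basicOpen (Gr k) (X j) (X_mem j) zero_lt_one) (sec j) x hx

lemma chart_mem (j : Fin 3) (p : Spec (.of (MvPolynomial (Fin 2) k))) : chart k j p ∈ U k j := by
  rw [← opensRange_chart]; exact ⟨p, rfl⟩

lemma mem_hid_chart (j : Fin 3) (p : Spec (.of (MvPolynomial (Fin 2) k))) {n : ℕ}
    {F : MvPolynomial (Fin 3) k} (hF : F.IsHomogeneous n) :
    F ∈ hid (chart k j p) ↔ dehom j F ∈ p.asIdeal := by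
  -- The description of basic opens in a chart requires positive degree. The factor `X j` provides
  -- it and is harmless, as it does not vanish on the chart.
  have hF' : (F * X j).IsHomogeneous (n + 1) := hF.mul (isHomogeneous_X k j)
  have h1 : F ∈ hid (chart k j p) ↔ F * X j ∈ hid (chart k j p) := by
    rw [Ideal.IsPrime.mul_mem_iff_mem_or_mem inferInstance]
    exact ⟨Or.inl, fun h => h.resolve_right (chart_mem j p)⟩
  have h2 := Proj.awayι_preimage_basicOpen (Gr k) (X_mem j) zero_lt_one (g := F * X j) hF' n.succ_pos
  have h3 : F * X j ∈ hid (chart k j p) ↔ ¬ (Spec.map (CommRingCat.ofHom (awEquiv j).toRingHom) p ∈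
      Proj.awayι (Gr k) (X j) (X_mem j) zero_lt_one ⁻¹ᵁ Proj.basicOpen (Gr k) (F * X j)) :=
    not_not.symm
  rw [h1, h3, h2]
  have h4 : awEquiv j (Away.isLocalizationElem (𝒜 := Gr k) (X_mem j) hF') = dehom j F := by
    refine (awEquiv_awMk j (n + 1) ((F * X j) ^ 1) (by simpa using hF')).trans ?_
    simp
  rw [← h4]
  exact not_not

lemma prime_chart (j : Fin 3) (p : Spec (.of (MvPolynomial (Fin 2) k))) :
    prime j (chart k j p) (chart_mem j p) = p.asIdeal := by
  ext f
  obtain ⟨n, F, hF, rfl⟩ := exists_dehom j f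
  rw [dehom_mem_prime j _ _ hF, mem_hid_chart j p hF]

/-- The rational function given by a polynomial in the coordinates of a chart. -/
def toFFHom (j : Fin 3) : MvPolynomial (Fin 2) k →+* (P2 k).FF :=
  ((P2Scheme k).presheaf.germ (U k j) (genericPoint (P2Scheme k))
    (genericPoint_mem_basicOpen k j)).hom.comp (sec j).toRingHom

lemma toFFHom_X (j : Fin 3) (i : Fin 2) : toFFHom (k := k) j (X i) = ratio k (j.succAbove i) j := by
  have h := sec_dehom (k := k) j 1 _ (isHomogeneous_X k (j.succAbove i))
  rw [dehom_X_succAbove] at h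
  exact congrArg ((P2Scheme k).presheaf.germ (U k j) (genericPoint (P2Scheme k))
    (genericPoint_mem_basicOpen k j)) h

lemma U_ι_str (j : Fin 3) : (U k j).ι ≫ P2Hom k = (U k j).toSpecΓ ≫
    Spec.map (CommRingCat.ofHom (awC j) ≫ Proj.awayToSection (Gr k) (X j)) := by
  have h : (U k j).ι = Proj.basicOpenToSpec (Gr k) (X j) ≫
      Proj.awayι (Gr k) (X j) (X_mem j) zero_lt_one := by
    rw [Proj.awayι, ← Proj.basicOpenIsoSpec_hom (Gr k) (X j) (X_mem j) zero_lt_one,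
      Iso.hom_inv_id_assoc]
  rw [h, Category.assoc, awayι_str, Proj.basicOpenToSpec, Category.assoc, Spec.map_comp]

/-- The constants of the function field are defined through global sections; this identifies them
with the constants of a chart. -/
lemma res_appTop (j : Fin 3) :
    (Scheme.ΓSpecIso (CommRingCat.of k)).inv ≫ (P2Hom k).appTop ≫
      (P2Scheme k).presheaf.map (homOfLE le_top : U k j ⟶ ⊤).op =
      CommRingCat.ofHom (awC j) ≫ Proj.awayToSection (Gr k) (X j) := by
  have h := congrArg Scheme.Hom.appTop (U_ι_str (k := k) j)
  rw [Scheme.Hom.comp_appTop, Scheme.Hom.comp_appTop, Scheme.Opens.toSpecΓ_appTop] at h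
  have h' : (Scheme.ΓSpecIso (CommRingCat.of k)).inv ≫ (P2Hom k).appTop ≫ (U k j).ι.appTop ≫
      (U k j).topIso.hom = CommRingCat.ofHom (awC j) ≫ Proj.awayToSection (Gr k) (X j) := by
    rw [reassoc_of% h, Scheme.ΓSpecIso_naturality_assoc, Iso.inv_hom_id_assoc, Iso.inv_hom_id,
      Category.comp_id]
  rw [← h', Scheme.Opens.ι_appTop]
  congr 2

lemma toFFHom_C (j : Fin 3) (c : k) : toFFHom j (C c) = algebraMap k (P2 k).FF c := by
  have h1 : sec j (C c) = (P2Scheme k).presheaf.map (homOfLE le_top : U k j ⟶ ⊤).op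
      ((P2Hom k).appTop ((Scheme.ΓSpecIso (CommRingCat.of k)).inv c)) := by
    have h := congrArg (fun f => f.hom c) (res_appTop (k := k) j)
    refine Eq.trans ?_ h.symm
    rw [← dehom_C j c, sec_dehom j 0 _ (isHomogeneous_C _ c)]
    refine congrArg (Proj.awayToSection (Gr k) (X j)) ?_
    rw [← awEquiv_symm_dehom, dehom_C, RingEquiv.symm_apply_eq]
    exact (awEquiv_awC j c).symm
  have h2 := congrArg ((P2Scheme k).presheaf.germ (U k j) (genericPoint (P2Scheme k))
    (genericPoint_mem_basicOpen k j)) h1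
  exact h2.trans (TopCat.Presheaf.germ_res_apply ..)

end P2
end MotivicPV
end

/-! ### The function field, local rings and curves in the coordinates of a chart -/

open CategoryTheory AlgebraicGeometry
noncomputable section
namespace MotivicPV
open MvPolynomial HomogeneousLocalization

namespace P2

variable {k : Type u} [Field k]

/-- The rational function given by a polynomial in the coordinates of a chart. -/
def toFF (j : Fin 3) : MvPolynomial (Fin 2) k →ₐ[k] (P2 k).FF :=
  { toFFHom j with commutes' := toFFHom_C j }

@[simp] lemma toFF_X (j : Fin 3) (i : Fin 2) :
    toFF (k := k) j (X i) = ratio k (j.succAbove i) j := toFFHom_X j i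

lemma toFF_injective (j : Fin 3) : Function.Injective (toFF (k := k) j) := by
  have h := germ_injective_of_isIntegral (P2Scheme k) (genericPoint (P2Scheme k))
    (genericPoint_mem_basicOpen k j)
  exact h.comp (sec j).injective

lemma toFF_ne_zero {j : Fin 3} {f : MvPolynomial (Fin 2) k} (hf : f ≠ 0) : toFF j f ≠ 0 :=
  (map_ne_zero_iff _ (toFF_injective j)).2 hf

variable (k) in
/-- The inclusion of a local ring into the function field. -/
def stalkToFF (x : P2Scheme k) : (P2Scheme k).presheaf.stalk x →+* (P2 k).FF :=
  algebraMap ((P2Scheme k).presheaf.stalk x) (P2Scheme k).functionField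

lemma stalkToFF_toStalk (j : Fin 3) (x : P2Scheme k) (hx : x ∈ U k j)
    (f : MvPolynomial (Fin 2) k) : stalkToFF k x (toStalk j x hx f) = toFF j f := by
  have : Nonempty (U k j) := ⟨⟨x, hx⟩⟩
  exact (P2Scheme k).algebraMap_germ_eq_germToFunctionField hx (sec j f)

lemma mem_localRing (x : P2Scheme k) (g : (P2 k).FF) :
    g ∈ (P2 k).localRing x ↔ ∃ a, stalkToFF k x a = g := Iff.rfl

lemma exists_toStalk_mul_eq (j : Fin 3) (x : P2Scheme k) (hx : x ∈ U k j)
    (z : (P2Scheme k).presheaf.stalk x) :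
    ∃ a b, b ∉ prime j x hx ∧ z * toStalk j x hx b = toStalk j x hx a := by
  let := (toStalk j x hx).toAlgebra
  have : IsLocalization (prime j x hx).primeCompl ((P2Scheme k).presheaf.stalk x) :=
    isLocalization_toStalk j x hx
  obtain ⟨⟨a, b⟩, h⟩ := IsLocalization.surj (prime j x hx).primeCompl z
  exact ⟨a, b, b.2, h⟩

/-- The stalk is the localization of the polynomial ring at `prime j x hx`. -/
lemma mem_localRing_iff (j : Fin 3) (x : P2Scheme k) (hx : x ∈ U k j) (g : (P2 k).FF) :
    g ∈ (P2 k).localRing x ↔ ∃ a b, b ∉ prime j x hx ∧ g = toFF j a / toFF j b := by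
  rw [mem_localRing]
  constructor
  · rintro ⟨z, rfl⟩
    obtain ⟨a, b, hb, h⟩ := exists_toStalk_mul_eq j x hx z
    refine ⟨a, b, hb, ?_⟩
    have hb0 : b ≠ 0 := fun h => hb (h ▸ zero_mem _)
    rw [eq_div_iff (toFF_ne_zero hb0), ← stalkToFF_toStalk j x hx, ← map_mul, h, stalkToFF_toStalk]
  · rintro ⟨a, b, hb, rfl⟩
    obtain ⟨u, hu⟩ := (notMem_prime_iff j x hx b).1 hb
    refine ⟨toStalk j x hx a * ↑u⁻¹, ?_⟩
    have hb0 : b ≠ 0 := fun h => hb (h ▸ zero_mem _)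
    rw [eq_div_iff (toFF_ne_zero hb0), ← stalkToFF_toStalk j x hx, ← map_mul, ← hu, mul_assoc,
      Units.inv_mul, mul_one, stalkToFF_toStalk]

lemma toFF_mem_localRing (j : Fin 3) (x : P2Scheme k) (hx : x ∈ U k j) (f : MvPolynomial (Fin 2) k) :
    toFF j f ∈ (P2 k).localRing x :=
  (mem_localRing_iff j x hx _).2 ⟨f, 1, (Ideal.ne_top_iff_one _).1 (Ideal.IsPrime.ne_top inferInstance), by simp⟩

lemma exists_toFF_div (j : Fin 3) (g : (P2 k).FF) : ∃ a b, b ≠ 0 ∧ g = toFF j a / toFF j b := by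
  have : Nonempty (U k j) := ⟨⟨_, genericPoint_mem_basicOpen k j⟩⟩
  have hfr := functionField_isFractionRing_of_isAffineOpen (P2Scheme k) (U k j)
    (Proj.isAffineOpen_basicOpen (Gr k) (X j) (X_mem j) zero_lt_one)
  obtain ⟨⟨a, b⟩, h⟩ := IsLocalization.surj (nonZeroDivisors Γ(P2Scheme k, U k j))
    (S := (P2Scheme k).functionField) g
  have hb : (sec j).symm b.1 ≠ 0 := 
    (map_ne_zero_iff _ (sec j).symm.injective).2 (nonZeroDivisors.ne_zero b.2)
  refine ⟨(sec j).symm a, (sec j).symm b.1, hb, (eq_div_iff (toFF_ne_zero hb)).2 ?_⟩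
  have h1 (c : Γ(P2Scheme k, U k j)) :
      toFF j ((sec j).symm c) = algebraMap _ (P2Scheme k).functionField c :=
    congrArg ((P2Scheme k).presheaf.germ (U k j) (genericPoint (P2Scheme k))
      (genericPoint_mem_basicOpen k j)) ((sec j).apply_symm_apply c)
  rw [h1, h1]
  exact h

instance isFractionRing_toFF (j : Fin 3) :
    letI := (toFF (k := k) j).toAlgebra
    IsFractionRing (MvPolynomial (Fin 2) k) (P2 k).FF := by
  let := (toFF (k := k) j).toAlgebra
  refine ⟨fun r => ?_, fun z => ?_, fun {a b} hab => ?_⟩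
  · exact (toFF_ne_zero (nonZeroDivisors.ne_zero r.2)).isUnit
  · obtain ⟨a, b, hb, rfl⟩ := exists_toFF_div j z
    exact ⟨⟨a, b, mem_nonZeroDivisors_of_ne_zero hb⟩, div_mul_cancel₀ _ (toFF_ne_zero hb)⟩
  · exact ⟨1, by rw [toFF_injective j hab]⟩

/-! ### The coordinate functions -/

lemma stalkVal_ratio (i j : Fin 3) : stalkVal (genericPoint (P2Scheme k)) (ratio k i j) =
    Localization.mk (X i) (⟨X j ^ 1, fun h => genericPoint_mem_basicOpen k j
      ((inferInstance : (hid _).IsPrime).mem_of_pow_mem _ h)⟩ :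
        (hid (genericPoint (P2Scheme k))).primeCompl) := by
  rw [← stalkVal_toStalk j _ (genericPoint_mem_basicOpen k j) 1 _ (isHomogeneous_X k i)]
  refine congrArg (stalkVal _) ?_
  exact congrArg ((P2Scheme k).presheaf.germ (U k j) (genericPoint (P2Scheme k))
    (genericPoint_mem_basicOpen k j)) (sec_dehom (k := k) j 1 _ (isHomogeneous_X k i)).symm

/-- The two factors are defined in different charts, so the identity is checked under the injective
map `stalkVal`. -/
lemma ratio_mul (i j l : Fin 3) : ratio k i j * ratio k j l = ratio k i l := by
  refine stalkVal_injective (genericPoint (P2Scheme k)) ?_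
  refine (map_mul (stalkVal (genericPoint (P2Scheme k))) _ _).trans ?_
  rw [stalkVal_ratio, stalkVal_ratio, stalkVal_ratio, Localization.mk_mul]
  exact Localization.mk_eq_mk_iff.2 (Localization.r_of_eq (by simp; ring))

@[simp] lemma ratio_self (i : Fin 3) : ratio k i i = 1 := by
  refine stalkVal_injective (genericPoint (P2Scheme k)) ?_
  refine Eq.trans ?_ (map_one (stalkVal (genericPoint (P2Scheme k)))).symm
  rw [stalkVal_ratio, ← Localization.mk_one]
  exact Localization.mk_eq_mk_iff.2 (Localization.r_of_eq (by simp))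

lemma ratio_ne_zero (i j : Fin 3) : ratio k i j ≠ 0 := fun h => by
  simpa [h] using ratio_mul (k := k) i j i

lemma toFF_dehom (j : Fin 3) (F : MvPolynomial (Fin 3) k) :
    toFF j (dehom j F) = aeval (fun i => ratio k i j) F := by
  refine congrArg (fun f : MvPolynomial (Fin 3) k →ₐ[k] (P2 k).FF => f F)
    (a₁ := (toFF j).comp (dehom j)) (algHom_ext fun i => ?_)
  induction i using j.succAboveCases with
  | x => simp
  | p i => simp

/-- Homogeneity, applied to `X i / X l = (X j / X l) (X i / X j)`: the transition function of
`O(n)`. -/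
lemma toFF_dehom_eq_mul (j l : Fin 3) {n : ℕ} {F : MvPolynomial (Fin 3) k} (hF : F.IsHomogeneous n) :
    toFF l (dehom l F) = ratio k j l ^ n * toFF j (dehom j F) := by
  rw [toFF_dehom, toFF_dehom, aeval_def, aeval_def, ← eval₂_mul_of_isHomogeneous hF]
  congr 1
  ext i
  rw [mul_comm, ratio_mul]

/-! ### Points of codimension one -/

lemma coheight_eq (j : Fin 3) (x : P2Scheme k) (hx : x ∈ U k j) :
    Order.coheight x = (prime j x hx).height := by
  let := (toStalk j x hx).toAlgebra
  have : IsLocalization.AtPrime ((P2Scheme k).presheaf.stalk x) (prime j x hx) :=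
    isLocalization_toStalk j x hx
  have h := IsLocalization.AtPrime.ringKrullDim_eq_height (prime j x hx)
    ((P2Scheme k).presheaf.stalk x)
  rw [ringKrullDim_stalk_eq_coheight] at h
  exact_mod_cast h

/-- The generic point of an irreducible curve. -/
def pt {n : ℕ} {F : MvPolynomial (Fin 3) k} (hF : F.IsHomogeneous n) (hp : Prime F)
    (hX : ∃ j, ¬ F ∣ X j) : P2Scheme k :=
  ({ asHomogeneousIdeal := ⟨Ideal.span {F}, Ideal.homogeneous_span _ _ fun x hx => by
        rw [Set.mem_singleton_iff.1 hx]; exact ⟨n, hF⟩⟩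
     isPrime := (Ideal.span_singleton_prime hp.ne_zero).2 hp
     not_irrelevant_le := fun h => hX.elim fun j hj => hj (Ideal.mem_span_singleton.1
        (h (HomogeneousIdeal.mem_irrelevant_of_mem (Gr k) zero_lt_one (isHomogeneous_X k j)))) } :
    ProjectiveSpectrum (Gr k))

section pt
variable {n : ℕ} {F : MvPolynomial (Fin 3) k} (hF : F.IsHomogeneous n) (hp : Prime F)
    (hX : ∃ j, ¬ F ∣ X j)

lemma mem_hid_pt (G : MvPolynomial (Fin 3) k) : G ∈ hid (pt hF hp hX) ↔ F ∣ G :=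
  Ideal.mem_span_singleton

lemma pt_specializes_iff (x : P2Scheme k) : pt hF hp hX ⤳ x ↔ F ∈ hid x := by
  rw [specializes_iff_mem_closure]
  refine ((ProjectiveSpectrum.le_iff_mem_closure (Gr k) (pt hF hp hX) x).symm.trans
    (ProjectiveSpectrum.as_ideal_le_as_ideal ..).symm).trans ?_
  exact Ideal.span_singleton_le_iff_mem (I := hid x)

lemma closure_pt : closure {pt hF hp hX} = curve F := by
  ext x
  rw [← specializes_iff_mem_closure, pt_specializes_iff]
  exact not_not.symm

lemma pt_mem_U {j : Fin 3} (hj : ¬ F ∣ X j) : pt hF hp hX ∈ U k j := fun h =>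
  hj ((mem_hid_pt hF hp hX _).1 h)

lemma prime_pt {j : Fin 3} (hx : pt hF hp hX ∈ U k j) :
    prime j (pt hF hp hX) hx = Ideal.span {dehom j F} := by
  refine le_antisymm (fun f hf => ?_) ?_
  · obtain ⟨m, G, hG, rfl⟩ := exists_dehom j f
    rw [dehom_mem_prime j _ hx hG, mem_hid_pt] at hf
    exact Ideal.mem_span_singleton.2 (map_dvd _ hf)
  · rw [Ideal.span_singleton_le_iff_mem, dehom_mem_prime j _ hx hF, mem_hid_pt]

lemma dehom_ne_zero {j : Fin 3} (hF0 : F ≠ 0) (hF : F.IsHomogeneous n) : dehom j F ≠ 0 := by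
  intro h
  have h1 := (awInv_dehom j n F hF).symm
  rw [h, map_zero] at h1
  have h2 := congrArg HomogeneousLocalization.val h1
  rw [val_awMk, HomogeneousLocalization.val_zero, Localization.mk_eq_mk',
    IsLocalization.mk'_eq_zero_iff] at h2
  obtain ⟨⟨_, m, rfl⟩, hm⟩ := h2
  exact hF0 ((mul_eq_zero.1 hm).resolve_left (pow_ne_zero _ (X_ne_zero j)))

/-- Krull's principal ideal theorem in a chart which meets the curve. -/
lemma coheight_pt : Order.coheight (pt hF hp hX) = 1 := by
  obtain ⟨j, hj⟩ := hX
  have hx := pt_mem_U hF hp ⟨j, hj⟩ hj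
  rw [coheight_eq j _ hx]
  refine le_antisymm ?_ ?_
  · have h := prime_pt hF hp ⟨j, hj⟩ hx
    refine Ideal.height_le_one_of_isPrincipal_of_mem_minimalPrimes (Ideal.span {dehom j F}) _ ?_
    rw [← h]
    exact ⟨⟨inferInstance, le_rfl⟩, fun I hI _ => hI.2⟩
  · rw [Order.one_le_iff_ne_zero, Ne, Ideal.height_eq_zero_iff_eq_bot, prime_pt,
      Ideal.span_singleton_eq_bot]
    exact dehom_ne_zero hp.ne_zero hF

/-- A proper specialization of the generic point of the curve has coheight at least two. -/
lemma eq_pt {x : P2Scheme k} (hx : Order.coheight x = 1) (h : F ∈ hid x) : x = pt hF hp hX := by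
  have h1 := (pt_specializes_iff hF hp hX x).2 h
  by_contra hne
  have h2 : x < pt hF hp hX := lt_of_le_not_ge (Scheme.le_iff_specializes.2 h1) fun h2 =>
    hne ((Scheme.le_iff_specializes.1 h2).antisymm h1).eq
  have h3 := Order.coheight_add_one_le h2
  rw [coheight_pt, hx] at h3
  exact absurd h3 (by decide)

lemma isPrimeDivisor_curve {n : ℕ} {F : MvPolynomial (Fin 3) k} (hF : F.IsHomogeneous n)
    (hp : Prime F) (hX : ∃ j, ¬ F ∣ X j) : IsPrimeDivisor (V := P2 k) (curve F) :=
  ⟨pt hF hp hX, coheight_pt hF hp hX, closure_pt hF hp hX⟩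

open Classical in
lemma primeDiv_curve (x : P2Scheme k) :
    primeDiv (V := P2 k) (curve F) x = if x = pt hF hp hX then 1 else 0 := by
  unfold primeDiv
  refine if_congr ?_ rfl rfl
  rw [← closure_pt hF hp hX]
  refine ⟨fun h => ?_, fun h => h ▸ rfl⟩
  exact ((specializes_iff_mem_closure.2 (h ▸ subset_closure rfl)).antisymm
    (specializes_iff_mem_closure.2 (h ▸ subset_closure rfl))).eq
end pt

end P2
end MotivicPV
end

open CategoryTheory AlgebraicGeometry
open scoped KaehlerDifferential
noncomputable section
namespace MotivicPV
open MvPolynomial Module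

/-! ### Multi-valued forms in local coordinates -/

section Forms

variable {k K : Type u} [Field k] [Field K] [Algebra k K]

/-- Alternating maps are determined by their values on families of distinct basis vectors, which
here are the permutations of the basis. -/
lemma ιMulti_eq_det_smul {V : Type*} [AddCommGroup V] [Module K V] {n : ℕ} (b : Basis (Fin n) K V)
    (v : Fin n → V) : exteriorPower.ιMulti K n v = b.det v • exteriorPower.ιMulti K n b := by
  have h : exteriorPower.ιMulti K n (M := V) =
      (LinearMap.toSpanSingleton K _ (exteriorPower.ιMulti K n b)).compAlternatingMap b.det := by
    refine b.ext_alternating fun w hw => ?_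
    obtain ⟨σ, rfl⟩ : ∃ σ : Equiv.Perm (Fin n), w = σ :=
      ⟨Equiv.ofBijective w (Finite.injective_iff_bijective.1 hw), rfl⟩
    rw [LinearMap.compAlternatingMap_apply, LinearMap.toSpanSingleton_apply]
    have h1 : (fun i => b (σ i)) = b ∘ σ := rfl
    rw [h1, AlternatingMap.map_perm, AlternatingMap.map_perm, Basis.det_self, Units.smul_def,
      Units.smul_def, smul_assoc, one_smul]
  exact congrArg (fun f => f v) h

lemma det_fin_two_of_eq {V : Type*} [AddCommGroup V] [Module K V] (b : Basis (Fin 2) K V)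
    {v : Fin 2 → V} {p q r s : K} (h0 : v 0 = p • b 0 + q • b 1) (h1 : v 1 = r • b 0 + s • b 1) :
    b.det v = p * s - q * r := by
  rw [Basis.det_apply, Matrix.det_fin_two]
  simp [Basis.toMatrix_apply, h0, h1]
  ring

variable {n d : ℕ} (e : Fin n → K) (b : Basis (Fin n) K Ω[K⁄k])

lemma wedgePow_eq_smul (hb : ∀ i, b i = KaehlerDifferential.D k K (e i)) (a : Fin d → Fin n → K) :
    wedgePow k a =
      (∏ j, b.det fun i => KaehlerDifferential.D k K (a j i)) • wedgePow k fun _ : Fin d => e := by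
  unfold wedgePow
  rw [← MultilinearMap.map_smul_univ]
  congr 1
  ext1 j
  rw [ιMulti_eq_det_smul b]
  simp only [← hb]

lemma exists_eq_smul_wedgePow (hb : ∀ i, b i = KaehlerDifferential.D k K (e i))
    (ω : MultiForm k K n d) : ∃ c : K, ω = c • wedgePow k fun _ : Fin d => e := by
  have h1 (w : ⋀[K]^n Ω[K⁄k]) : ∃ c : K, w = c • exteriorPower.ιMulti K n b := by
    have hw : w ∈ Submodule.span K (Set.range (exteriorPower.ιMulti K n (M := Ω[K⁄k]))) := by
      rw [exteriorPower.ιMulti_span]; trivial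
    induction hw using Submodule.span_induction with
    | mem _ h => obtain ⟨v, rfl⟩ := h; exact ⟨_, ιMulti_eq_det_smul b v⟩
    | zero => exact ⟨0, (zero_smul ..).symm⟩
    | add _ _ _ _ h1 h2 =>
      obtain ⟨c, rfl⟩ := h1; obtain ⟨c', rfl⟩ := h2
      exact ⟨c + c', (add_smul ..).symm⟩
    | smul a _ _ h => obtain ⟨c, rfl⟩ := h; exact ⟨a * c, (mul_smul ..).symm⟩
  induction ω using PiTensorProduct.induction_on with
  | smul_tprod r f =>
    choose c hc using fun j => h1 (f j)
    refine ⟨r * ∏ j, c j, ?_⟩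
    unfold wedgePow
    rw [mul_smul, ← MultilinearMap.map_smul_univ]
    congr 2
    ext1 j
    rw [hc j]
    simp only [← hb]
  | add x y hx hy =>
    obtain ⟨c, rfl⟩ := hx; obtain ⟨c', rfl⟩ := hy
    exact ⟨c + c', (add_smul ..).symm⟩

/-- The product over the tensor factors of the determinants with respect to `b` is a linear
functional with value `1` on this form. -/
lemma wedgePow_ne_zero (hb : ∀ i, b i = KaehlerDifferential.D k K (e i)) :
    (wedgePow k fun _ : Fin d => e) ≠ 0 := by
  intro h
  have h1 := congrArg (PiTensorProduct.lift ((MultilinearMap.mkPiAlgebra K (Fin d) K).compLinearMap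
    fun _ => exteriorPower.alternatingMapLinearEquiv b.det)) h
  rw [wedgePow, PiTensorProduct.lift.tprod, map_zero, MultilinearMap.compLinearMap_apply,
    MultilinearMap.mkPiAlgebra_apply] at h1
  simp only [exteriorPower.alternatingMapLinearEquiv_apply_ιMulti, ← hb] at h1
  rw [show (fun i => b i) = b from rfl] at h1
  simp [Basis.det_self] at h1

end Forms

section Order

variable {k : Type u} [Field k] {V : Variety k} [IsIntegral V.X] {n d : ℕ}

lemma ord_of_isUnit_localRing {ξ : V.X} {c c' : V.FF} (hc : c ∈ V.localRing ξ)
    (hc' : c' ∈ V.localRing ξ) (h : c * c' = 1) : Scheme.ord (X := V.X) c ξ = 0 := by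
  obtain ⟨a, rfl⟩ := hc
  obtain ⟨a', rfl⟩ := hc'
  have ha : IsUnit a := by
    refine IsUnit.of_mul_eq_one a' (IsFractionRing.injective (V.X.presheaf.stalk ξ) V.X.functionField ?_)
    rw [map_mul, map_one]; exact h
  by_cases hξ : Order.coheight ξ = 1
  · have : Ring.KrullDimLE 1 (V.X.presheaf.stalk ξ) := krullDimLE_of_coheight_le hξ.le
    have h0 := left_ne_zero_of_mul_eq_one h
    refine (Scheme.ord_eq_iff hξ h0).2 ?_
    exact Ring.ordFrac_of_isUnit ha
  · exact Scheme.ord_eq_zero_of_coheight_neq_one hξ _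

/-- The definition of `ordForm` chooses a function. Two admissible choices differ by a unit of the
local ring, which has order zero. -/
lemma ordForm_smul {ξ : V.X} {η : MultiForm k V.FF n d} (hη : η ≠ 0)
    (h : V.regularForms n d ξ = Submodule.span _ {η}) {g : V.FF} (hg : g ≠ 0) :
    ordForm (g • η) ξ = Scheme.ord (X := V.X) g ξ := by
  have hex : ∃ g' : V.FF, g' ≠ 0 ∧ V.regularForms n d ξ = Submodule.span _ {g'⁻¹ • g • η} :=
    ⟨g, hg, by rw [inv_smul_smul₀ hg]; exact h⟩
  rw [ordForm, dif_pos hex]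
  obtain ⟨h0, h1⟩ := hex.choose_spec
  set g' := hex.choose
  rw [h, smul_smul] at h1
  have h2 : η ∈ Submodule.span (V.localRing ξ) {(g'⁻¹ * g) • η} := h1 ▸ Submodule.mem_span_singleton_self _
  have h3 : (g'⁻¹ * g) • η ∈ Submodule.span (V.localRing ξ) {η} :=
    h1.symm ▸ Submodule.mem_span_singleton_self _
  obtain ⟨c, hc⟩ := Submodule.mem_span_singleton.1 h2
  obtain ⟨c', hc'⟩ := Submodule.mem_span_singleton.1 h3
  have e1 : c'.1 = g'⁻¹ * g := smul_left_injective V.FF hη hc'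
  have e2 : c.1 * (g'⁻¹ * g) = 1 := by
    refine smul_left_injective V.FF hη ?_
    change (c.1 * (g'⁻¹ * g)) • η = (1 : V.FF) • η
    rw [one_smul, mul_smul]; exact hc
  have e3 : g = c'.1 * g' := by rw [e1]; field_simp
  rw [← e1] at e2
  have e4 := Scheme.ord_mul (X := V.X) (x := ξ) (right_ne_zero_of_mul_eq_one e2) h0
  rw [ord_of_isUnit_localRing c'.2 c.2 ((mul_comm _ _).trans e2), zero_add] at e4
  exact e4.symm.trans (congrArg (fun g => Scheme.ord (X := V.X) g ξ) e3.symm)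

end Order

end MotivicPV
end

/-! ### Differentials, regular forms and orders on the plane -/

open CategoryTheory AlgebraicGeometry
open scoped KaehlerDifferential
noncomputable section
namespace MotivicPV
open MvPolynomial Module

lemma ord_zpow {Y : Scheme.{u}} [IsIntegral Y] [IsLocallyNoetherian Y] (x : Y) {g : Y.functionField}
    (hg : g ≠ 0) (m : ℤ) : Scheme.ord (g ^ m) x = m * Scheme.ord g x := by
  by_cases h : Order.coheight x = 1
  · have h1 := (Scheme.ord_eq_iff h hg (n := Scheme.ord g x)).1 rfl
    rw [Scheme.ord_eq_iff h (zpow_ne_zero m hg), map_zpow₀, h1, mul_comm, Int.ofAdd_mul,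
      WithZero.coe_zpow]
  · rw [Scheme.ord_eq_zero_of_coheight_neq_one h, Scheme.ord_eq_zero_of_coheight_neq_one h, mul_zero]

namespace P2

variable {k : Type u} [Field k]

instance : IsLocallyNoetherian (P2Scheme k) := inferInstanceAs (IsLocallyNoetherian (P2 k).X)

/-- Formation of differentials commutes with localization, so the basis `dX 0, dX 1` over the
polynomial ring remains a basis over its fraction field. -/
lemma exists_toFFBasis (j : Fin 3) : ∃ b : Basis (Fin 2) (P2 k).FF Ω[(P2 k).FF⁄k],
    ∀ i, b i = KaehlerDifferential.D k (P2 k).FF (toFF j (X i)) := by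
  let := (toFF (k := k) j).toAlgebra
  have : IsScalarTower k (MvPolynomial (Fin 2) k) (P2 k).FF :=
    .of_algebraMap_eq fun c => ((toFF j).commutes c).symm
  have : IsFractionRing (MvPolynomial (Fin 2) k) (P2 k).FF := isFractionRing_toFF j
  refine ⟨(KaehlerDifferential.mvPolynomialBasis k (Fin 2)).ofIsLocalizedModule (P2 k).FF
    (nonZeroDivisors (MvPolynomial (Fin 2) k))
    (KaehlerDifferential.map k k (MvPolynomial (Fin 2) k) (P2 k).FF), fun i => ?_⟩
  rw [Basis.ofIsLocalizedModule_apply, KaehlerDifferential.mvPolynomialBasis_apply,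
    KaehlerDifferential.map_D]
  rfl

variable (k) in
/-- The basis of the module of differentials given by the coordinates of a chart. -/
def toFFBasis (j : Fin 3) : Basis (Fin 2) (P2 k).FF Ω[(P2 k).FF⁄k] := (exists_toFFBasis j).choose

lemma toFFBasis_apply (j : Fin 3) (i : Fin 2) :
    toFFBasis k j i = KaehlerDifferential.D k (P2 k).FF (toFF j (X i)) :=
  (exists_toFFBasis j).choose_spec i

variable (k) in
/-- The form `(da ∧ db)^{⊗ d}` for the coordinates `a, b` of a chart. -/
def chartForm (j : Fin 3) (d : ℕ) : MultiForm k (P2 k).FF 2 d :=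
  wedgePow k fun _ i => toFF j (X i)

lemma chartForm_ne_zero (j : Fin 3) (d : ℕ) : chartForm k j d ≠ 0 :=
  wedgePow_ne_zero _ (toFFBasis k j) (toFFBasis_apply j)

lemma exists_eq_smul_chartForm (j : Fin 3) {d : ℕ} (ω : MultiForm k (P2 k).FF 2 d) :
    ∃ c : (P2 k).FF, ω = c • chartForm k j d :=
  exists_eq_smul_wedgePow _ (toFFBasis k j) (toFFBasis_apply j) ω

lemma repr_D_toFF_mem (j : Fin 3) (x : P2Scheme k) (hx : x ∈ U k j) (f : MvPolynomial (Fin 2) k)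
    (i : Fin 2) : (toFFBasis k j).repr (KaehlerDifferential.D k _ (toFF j f)) i ∈
      (P2 k).localRing x := by
  induction f using MvPolynomial.induction_on with
  | C c =>
    have : toFF j (C c) = algebraMap k (P2 k).FF c := (toFF j).commutes c
    rw [this, Derivation.map_algebraMap, map_zero]
    exact zero_mem _
  | add p q hp hq =>
    rw [map_add, map_add, map_add]
    exact add_mem hp hq
  | mul_X p l hp =>
    rw [map_mul, Derivation.leibniz, map_add, map_smul, map_smul, ← toFFBasis_apply,
      Basis.repr_self]
    refine add_mem (mul_mem (toFF_mem_localRing j x hx p) ?_) (mul_mem (toFF_mem_localRing j x hx _) hp)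
    rw [Finsupp.single_apply]
    split_ifs
    exacts [one_mem _, zero_mem _]

lemma inv_toFF_mem (j : Fin 3) (x : P2Scheme k) (hx : x ∈ U k j) {f : MvPolynomial (Fin 2) k}
    (hf : f ∉ prime j x hx) : (toFF j f)⁻¹ ∈ (P2 k).localRing x :=
  (mem_localRing_iff j x hx _).2 ⟨1, f, hf, by simp⟩

lemma repr_D_mem (j : Fin 3) (x : P2Scheme k) (hx : x ∈ U k j) {g : (P2 k).FF}
    (hg : g ∈ (P2 k).localRing x) (i : Fin 2) :
    (toFFBasis k j).repr (KaehlerDifferential.D k _ g) i ∈ (P2 k).localRing x := by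
  obtain ⟨a, b, hb, rfl⟩ := (mem_localRing_iff j x hx g).1 hg
  rw [Derivation.leibniz_div, map_smul, map_sub, map_smul, map_smul]
  exact mul_mem (pow_mem (inv_toFF_mem j x hx hb) 2) (sub_mem
    (mul_mem (toFF_mem_localRing j x hx _) (repr_D_toFF_mem j x hx _ i))
    (mul_mem (toFF_mem_localRing j x hx _) (repr_D_toFF_mem j x hx _ i)))

lemma det_D_mem (j : Fin 3) (x : P2Scheme k) (hx : x ∈ U k j) {a : Fin 2 → (P2 k).FF}
    (ha : ∀ i, a i ∈ (P2 k).localRing x) :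
    ((toFFBasis k j).det fun i => KaehlerDifferential.D k _ (a i)) ∈ (P2 k).localRing x := by
  rw [Basis.det_apply, Matrix.det_fin_two]
  have h (i i' : Fin 2) := repr_D_mem j x hx (ha i) i'
  exact sub_mem (mul_mem (h ..) (h ..)) (mul_mem (h ..) (h ..))

/-- The coefficient of a regular form is a product of Jacobian determinants of regular functions,
and these lie in the local ring by the Leibniz rule. -/
lemma regularForms_eq (j : Fin 3) (x : P2Scheme k) (hx : x ∈ U k j) (d : ℕ) :
    (P2 k).regularForms 2 d x = Submodule.span _ {chartForm k j d} := by
  refine le_antisymm (Submodule.span_le.2 ?_) (Submodule.span_mono ?_)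
  · rintro _ ⟨a, ha, rfl⟩
    have h := prod_mem (S := (P2 k).localRing x) (t := Finset.univ)
      fun l _ => det_D_mem j x hx (ha l)
    rw [wedgePow_eq_smul _ (toFFBasis k j) (toFFBasis_apply j)]
    exact Submodule.mem_span_singleton.2 ⟨⟨_, h⟩, rfl⟩
  · rintro _ rfl
    exact ⟨_, fun _ i => toFF_mem_localRing j x hx _, rfl⟩

lemma ordForm_eq (j : Fin 3) (x : P2Scheme k) (hx : x ∈ U k j) {d : ℕ} {g : (P2 k).FF}
    (hg : g ≠ 0) : ordForm (g • chartForm k j d) x = Scheme.ord (X := (P2 k).X) g x :=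
  ordForm_smul (V := P2 k) (chartForm_ne_zero j d) (regularForms_eq j x hx d) hg

/-! ### Orders of polynomials -/

lemma ord_toFF_of_notMem (j : Fin 3) (x : P2Scheme k) (hx : x ∈ U k j) {f : MvPolynomial (Fin 2) k}
    (hf : f ∉ prime j x hx) : Scheme.ord (X := (P2 k).X) (toFF j f) x = 0 :=
  ord_of_isUnit_localRing (V := P2 k) (toFF_mem_localRing j x hx f) (inv_toFF_mem j x hx hf)
    (mul_inv_cancel₀ (toFF_ne_zero fun h => hf (h ▸ zero_mem _)))

lemma maximalIdeal_eq_map (j : Fin 3) (x : P2Scheme k) (hx : x ∈ U k j) :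
    IsLocalRing.maximalIdeal ((P2Scheme k).presheaf.stalk x) =
      (prime j x hx).map (toStalk j x hx) := by
  let := (toStalk j x hx).toAlgebra
  have : IsLocalization.AtPrime ((P2Scheme k).presheaf.stalk x) (prime j x hx) :=
    isLocalization_toStalk j x hx
  exact (IsLocalization.AtPrime.map_eq_maximalIdeal (prime j x hx) _).symm

lemma toStalk_injective (j : Fin 3) (x : P2Scheme k) (hx : x ∈ U k j) :
    Function.Injective (toStalk j x hx) := fun a b h => toFF_injective j <| by
  rw [← stalkToFF_toStalk j x hx, ← stalkToFF_toStalk j x hx, h]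

/-- The maximal ideal of the local ring is generated by `f`, so the ring is a discrete valuation
ring with uniformizer `f`. -/
lemma ord_toFF_of_prime_eq (j : Fin 3) (x : P2Scheme k) (hx : x ∈ U k j)
    (h1 : Order.coheight x = 1) {f : MvPolynomial (Fin 2) k} (hf : prime j x hx = Ideal.span {f}) :
    Scheme.ord (X := (P2 k).X) (toFF j f) x = 1 := by
  have hm := maximalIdeal_eq_map j x hx
  rw [hf, Ideal.map_span, Set.image_singleton] at hm
  have hf0 : f ≠ 0 := by
    rintro rfl
    rw [coheight_eq j x hx, hf, Ideal.span_singleton_eq_bot.2 rfl, Ideal.height_bot] at h1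
    exact zero_ne_one h1
  have hs0 : toStalk j x hx f ≠ 0 := (map_ne_zero_iff _ (toStalk_injective j x hx)).2 hf0
  have hnf : ¬ IsField ((P2Scheme k).presheaf.stalk x) := by
    rw [IsLocalRing.isField_iff_maximalIdeal_eq, hm, Ideal.span_singleton_eq_bot]
    exact hs0
  have : IsDiscreteValuationRing ((P2Scheme k).presheaf.stalk x) := by
    refine ((IsDiscreteValuationRing.TFAE ((P2Scheme k).presheaf.stalk x) hnf).out 0 4).2 ?_
    rw [hm]; infer_instance
  have hirr := IsDiscreteValuationRing.irreducible_of_span_eq_maximalIdeal _ hs0 hm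
  refine (Scheme.ord_eq_iff (X := P2Scheme k) h1 (toFF_ne_zero hf0)).2 ?_
  rw [← stalkToFF_toStalk j x hx]
  exact Ring.ordFrac_irreducible hirr

end P2

end MotivicPV
end

open CategoryTheory AlgebraicGeometry
open scoped KaehlerDifferential
noncomputable section
namespace MotivicPV
open MvPolynomial Module

namespace P2

variable {k : Type u} [Field k]

/-! ### The divisor of a form given by a quadratic polynomial -/

lemma chartForm_eq_of_det {j l : Fin 3} {c : (P2 k).FF} (d : ℕ)
    (h : ((toFFBasis k j).det fun i => KaehlerDifferential.D k (P2 k).FF (toFF l (X i))) = c) :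
    chartForm k l d = c ^ d • chartForm k j d := by
  rw [chartForm, wedgePow_eq_smul _ (toFFBasis k j) (toFFBasis_apply j), Finset.prod_const,
    Finset.card_univ, Fintype.card_fin, h]
  rfl

lemma inv_ratio (i j : Fin 3) : (ratio k i j)⁻¹ = ratio k j i :=
  inv_eq_of_mul_eq_one_right (by rw [ratio_mul, ratio_self])

/-- With `y = Y/X` and `z = Z/X`, the affine coordinates are `1/z` and `y/z`, and `d(1/z) ∧ d(y/z) =
z⁻³ dy ∧ dz`. -/
lemma det_chart_zero : ((toFFBasis k 0).det fun i => KaehlerDifferential.D k (P2 k).FF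
    (toFF 2 (X i))) = ratio k 0 2 ^ 3 := by
  have h1 : toFF 2 (X 0 : MvPolynomial (Fin 2) k) = (toFF 0 (X 1 : MvPolynomial (Fin 2) k))⁻¹ := by
    rw [toFF_X, toFF_X, inv_ratio]; rfl
  have h2 : toFF 2 (X 1 : MvPolynomial (Fin 2) k) =
      toFF 0 (X 0 : MvPolynomial (Fin 2) k) / toFF 0 (X 1 : MvPolynomial (Fin 2) k) := by
    rw [toFF_X, toFF_X, toFF_X, div_eq_mul_inv, inv_ratio]; exact (ratio_mul 1 0 2).symm
  have h3 : ratio k 0 2 = (toFF 0 (X 1 : MvPolynomial (Fin 2) k))⁻¹ := h1 ▸ (toFF_X 2 0).symm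
  have hz : toFF 0 (X 1 : MvPolynomial (Fin 2) k) ≠ 0 := toFF_ne_zero (X_ne_zero 1)
  rw [det_fin_two_of_eq (toFFBasis k 0) (p := 0) (q := -(toFF 0 (X 1))⁻¹ ^ 2)
    (r := (toFF 0 (X 1))⁻¹ ^ 2 * toFF 0 (X 1)) (s := -((toFF 0 (X 1))⁻¹ ^ 2 * toFF 0 (X 0)))
    (by rw [h1, Derivation.leibniz_inv, toFFBasis_apply, toFFBasis_apply, zero_smul, zero_add])
    (by rw [h2, Derivation.leibniz_div, toFFBasis_apply, toFFBasis_apply, smul_sub, smul_smul,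
          smul_smul, neg_smul, sub_eq_add_neg]), h3]
  field_simp
  ring

lemma det_chart_one : ((toFFBasis k 1).det fun i => KaehlerDifferential.D k (P2 k).FF
    (toFF 2 (X i))) = -ratio k 1 2 ^ 3 := by
  have h1 : toFF 2 (X 1 : MvPolynomial (Fin 2) k) = (toFF 1 (X 1 : MvPolynomial (Fin 2) k))⁻¹ := by
    rw [toFF_X, toFF_X, inv_ratio]; rfl
  have h2 : toFF 2 (X 0 : MvPolynomial (Fin 2) k) =
      toFF 1 (X 0 : MvPolynomial (Fin 2) k) / toFF 1 (X 1 : MvPolynomial (Fin 2) k) := by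
    rw [toFF_X, toFF_X, toFF_X, div_eq_mul_inv, inv_ratio]; exact (ratio_mul 0 1 2).symm
  have h3 : ratio k 1 2 = (toFF 1 (X 1 : MvPolynomial (Fin 2) k))⁻¹ := h1 ▸ (toFF_X 2 1).symm
  have hz : toFF 1 (X 1 : MvPolynomial (Fin 2) k) ≠ 0 := toFF_ne_zero (X_ne_zero 1)
  rw [det_fin_two_of_eq (toFFBasis k 1) (r := 0) (s := -(toFF 1 (X 1))⁻¹ ^ 2)
    (p := (toFF 1 (X 1))⁻¹ ^ 2 * toFF 1 (X 1)) (q := -((toFF 1 (X 1))⁻¹ ^ 2 * toFF 1 (X 0)))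
    (by rw [h2, Derivation.leibniz_div, toFFBasis_apply, toFFBasis_apply, smul_sub, smul_smul,
          smul_smul, neg_smul, sub_eq_add_neg])
    (by rw [h1, Derivation.leibniz_inv, toFFBasis_apply, toFFBasis_apply, zero_smul, zero_add]), h3]
  field_simp
  ring

/-- The transition function of the bicanonical bundle `O(-6)`; the sign in `det_chart_one`
disappears in the square. -/
lemma chartForm_two_eq (j : Fin 3) : chartForm k 2 2 = ratio k j 2 ^ 6 • chartForm k j 2 := by
  fin_cases j
  · refine (chartForm_eq_of_det 2 det_chart_zero).trans ?_
    congr 1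
    change (ratio k 0 2 ^ 3) ^ 2 = ratio k 0 2 ^ 6
    ring
  · refine (chartForm_eq_of_det 2 det_chart_one).trans ?_
    congr 1
    change (-ratio k 1 2 ^ 3) ^ 2 = ratio k 1 2 ^ 6
    ring
  · change _ = ratio k 2 2 ^ 6 • chartForm k 2 2
    rw [ratio_self, one_pow, one_smul]

/-- The form `F⁻³ (dx ∧ dy)^{⊗ 2}`, for the dehomogenization of a quadratic polynomial `F`. -/
def quadForm (F : MvPolynomial (Fin 3) k) : MultiForm k (P2 k).FF 2 2 :=
  (toFF 2 (dehom 2 F)) ^ (-3 : ℤ) • chartForm k 2 2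

variable {F : MvPolynomial (Fin 3) k}

/-- The cube of a quadratic form has degree six, so the transition factors of `F⁻³` and of
`chartForm` cancel. Thus no chart is distinguished and no poles or zeros appear outside `F = 0`. -/
lemma quadForm_eq (hF : F.IsHomogeneous 2) (j : Fin 3) :
    quadForm F = (toFF j (dehom j F)) ^ (-3 : ℤ) • chartForm k j 2 := by
  rw [quadForm, toFF_dehom_eq_mul j 2 hF, chartForm_two_eq j, smul_smul]
  congr 1
  have := ratio_ne_zero (k := k) j 2
  rw [mul_zpow, mul_right_comm, ← zpow_natCast, ← zpow_natCast, ← zpow_mul, ← zpow_add₀ this]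
  simp

lemma quadForm_ne_zero (hF : F.IsHomogeneous 2) (h0 : F ≠ 0) : quadForm F ≠ 0 :=
  smul_ne_zero (zpow_ne_zero _ (toFF_ne_zero (dehom_ne_zero h0 hF))) (chartForm_ne_zero 2 2)

/-- The order of a homogeneous polynomial at a point. -/
def ordPoly (F : MvPolynomial (Fin 3) k) (x : P2Scheme k) : ℤ :=
  Scheme.ord (X := (P2 k).X) (toFF (exists_mem_U x).choose (dehom (exists_mem_U x).choose F)) x

lemma ordForm_quadForm (hF : F.IsHomogeneous 2) (h0 : F ≠ 0) (x : P2Scheme k) :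
    ordForm (quadForm F) x = -3 * ordPoly F x := by
  have hne := toFF_ne_zero (j := (exists_mem_U x).choose)
    (dehom_ne_zero (j := (exists_mem_U x).choose) h0 hF)
  rw [quadForm_eq hF (exists_mem_U x).choose,
    ordForm_eq _ x (exists_mem_U x).choose_spec (zpow_ne_zero _ hne)]
  exact ord_zpow (Y := P2Scheme k) x hne (-3)

lemma ordPoly_mul {m n : ℕ} {F G : MvPolynomial (Fin 3) k} (hF : F.IsHomogeneous m) (hF0 : F ≠ 0)
    (hG : G.IsHomogeneous n) (hG0 : G ≠ 0) (x : P2Scheme k) :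
    ordPoly (F * G) x = ordPoly F x + ordPoly G x := by
  unfold ordPoly
  rw [map_mul, map_mul]
  exact Scheme.ord_mul (X := P2Scheme k) (toFF_ne_zero (dehom_ne_zero hF0 hF))
    (toFF_ne_zero (dehom_ne_zero hG0 hG))

open Classical in
lemma ordPoly_eq {n : ℕ} (hF : F.IsHomogeneous n) (hp : Prime F) (hX : ∃ j, ¬ F ∣ X j)
    (x : P2Scheme k) : ordPoly F x = if x = pt hF hp hX then 1 else 0 := by
  have hj := (exists_mem_U x).choose_spec
  unfold ordPoly
  set j := (exists_mem_U x).choose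
  split_ifs with h
  · subst h
    exact ord_toFF_of_prime_eq j _ hj (coheight_pt hF hp hX) (prime_pt hF hp hX hj)
  · by_cases h1 : Order.coheight x = 1
    · exact ord_toFF_of_notMem j x hj fun h2 =>
        h (eq_pt hF hp hX h1 ((dehom_mem_prime j x hj hF).1 h2))
    · exact Scheme.ord_eq_zero_of_coheight_neq_one (X := P2Scheme k) h1 _

lemma divForm_quadForm_of_prime (hF : F.IsHomogeneous 2) (hp : Prime F) (hX : ∃ j, ¬ F ∣ X j) :
    divForm (V := P2 k) (quadForm F) = (-3 / 2 : ℚ) • primeDiv (V := P2 k) (curve F) := by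
  classical
  refine funext fun (x : P2Scheme k) => ?_
  change (ordForm (quadForm F) x : ℚ) / (2 : ℕ) = (-3 / 2 : ℚ) * primeDiv (V := P2 k) (curve F) x
  rw [ordForm_quadForm hF hp.ne_zero x, ordPoly_eq hF hp hX, primeDiv_curve hF hp hX]
  split_ifs <;> norm_num

lemma divForm_quadForm_mul {F G : MvPolynomial (Fin 3) k} (hF : F.IsHomogeneous 1) (hp : Prime F)
    (hX : ∃ j, ¬ F ∣ X j) (hG : G.IsHomogeneous 1) (hq : Prime G) (hY : ∃ j, ¬ G ∣ X j) :
    divForm (V := P2 k) (quadForm (F * G)) = (-3 / 2 : ℚ) • primeDiv (V := P2 k) (curve F) +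
      (-3 / 2 : ℚ) • primeDiv (V := P2 k) (curve G) := by
  classical
  refine funext fun (x : P2Scheme k) => ?_
  change (ordForm (quadForm (F * G)) x : ℚ) / (2 : ℕ) =
    (-3 / 2 : ℚ) * primeDiv (V := P2 k) (curve F) x + (-3 / 2 : ℚ) * primeDiv (V := P2 k) (curve G) x
  rw [ordForm_quadForm (hF.mul hG) (mul_ne_zero hp.ne_zero hq.ne_zero) x,
    ordPoly_mul hF hp.ne_zero hG hq.ne_zero, ordPoly_eq hF hp hX, ordPoly_eq hG hq hY,
    primeDiv_curve hF hp hX, primeDiv_curve hG hq hY]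
  split_ifs <;> norm_num

/-! ### The lines and the conic -/

lemma not_X_dvd_X {i j : Fin 3} (h : i ≠ j) : ¬ (X i : MvPolynomial (Fin 3) k) ∣ X j := by
  intro h'
  have h1 := map_dvd (aeval (R := k) (fun l : Fin 3 => if l = i then (0 : k) else 1)) h'
  simp [h.symm] at h1

variable (k) in
/-- The equation of the conic. -/
abbrev conic : MvPolynomial (Fin 3) k := X 1 * X 2 - X 0 ^ 2

lemma isHomogeneous_conic : (conic k).IsHomogeneous 2 :=
  ((isHomogeneous_X k 1).mul (isHomogeneous_X k 2)).sub ((isHomogeneous_X k 0).pow 2)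

lemma prime_conic : Prime (conic k) := by
  refine (UniqueFactorizationMonoid.irreducible_iff_prime).1 ?_
  -- The conic is linear in `X 1`, with coefficients `X 2` and `-X 0 ^ 2` that have no common
  -- factor.
  have h := irreducible_mul_X_add (X 2 : MvPolynomial (Fin 3) k) (-X 0 ^ 2) 1 (X_ne_zero 2)
    (by simp) (by
      rw [vars_neg]; exact fun h => by simpa using vars_pow _ _ h) ?_
  · rwa [show conic k = X 2 * X 1 + -X 0 ^ 2 by unfold conic; ring]
  · refine ((X_prime (i := (2 : Fin 3))).irreducible.isRelPrime_iff_not_dvd).2 fun h => ?_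
    exact not_X_dvd_X (by decide) ((X_prime (i := (2 : Fin 3))).dvd_of_dvd_pow ((dvd_neg).1 h))

lemma not_conic_dvd_X (j : Fin 3) : ¬ conic k ∣ X j := by
  intro h
  have h1 := map_dvd (aeval (R := k) (fun _ : Fin 3 => (1 : k))) h
  simp at h1

end P2

end MotivicPV
end

open CategoryTheory AlgebraicGeometry
open scoped KaehlerDifferential
noncomputable section
namespace MotivicPV
open MvPolynomial Module

namespace P2

variable {k : Type u} [Field k]

/-! ### The two bivalued forms -/

lemma toFF_two_dehom_X (i : Fin 3) : toFF 2 (dehom 2 (X i : MvPolynomial (Fin 3) k)) = ratio k i 2 := by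
  rw [toFF_dehom, aeval_X]

lemma toFF_zero_dehom_X (i : Fin 3) : toFF 0 (dehom 0 (X i : MvPolynomial (Fin 3) k)) = ratio k i 0 := by
  rw [toFF_dehom, aeval_X]

lemma biform_two (f : (P2 k).FF) : biform f (x k) (y k) = f • chartForm k 2 2 := by
  unfold biform chartForm
  congr 3
  ext j i
  fin_cases i
  · exact (toFF_X 2 0).symm
  · exact (toFF_X 2 1).symm

lemma biform_zero (f : (P2 k).FF) :
    biform f (ratio k 1 0) (ratio k 2 0) = f • chartForm k 0 2 := by
  unfold biform chartForm
  congr 3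
  ext j i
  fin_cases i
  · exact (toFF_X 0 0).symm
  · exact (toFF_X 0 1).symm

/-- The homogenization of `y` in degree two is `YZ`; the factor `Z` accounts for the pole of `ω`
along the line at infinity. -/
lemma omega_eq : omega k = quadForm (X 1 * X 2) := by
  rw [omega, biform_two, quadForm, map_mul, map_mul, toFF_two_dehom_X, toFF_two_dehom_X, ratio_self,
    mul_one]
  rfl

lemma isHomogeneous_X_mul_X (i j : Fin 3) : (X i * X j : MvPolynomial (Fin 3) k).IsHomogeneous 2 :=
  (isHomogeneous_X k i).mul (isHomogeneous_X k j)

lemma omega_eq_biform_zero : omega k =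
    biform ((ratio k 1 0 * ratio k 2 0) ^ (-3 : ℤ)) (ratio k 1 0) (ratio k 2 0) := by
  rw [omega_eq, biform_zero, quadForm_eq (isHomogeneous_X_mul_X 1 2) 0, map_mul, map_mul,
    toFF_zero_dehom_X, toFF_zero_dehom_X]

lemma quadForm_conic : quadForm (conic k) = biform ((y k - x k ^ 2) ^ (-3 : ℤ)) (x k) (y k) := by
  rw [biform_two, quadForm, map_sub, map_sub, map_mul, map_mul, map_pow, map_pow,
    toFF_two_dehom_X, toFF_two_dehom_X, toFF_two_dehom_X, ratio_self, mul_one]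
  rfl

lemma quadForm_conic_eq_biform_zero : quadForm (conic k) =
    biform ((ratio k 1 0 * ratio k 2 0 - 1) ^ (-3 : ℤ)) (ratio k 1 0) (ratio k 2 0) := by
  rw [quadForm_eq isHomogeneous_conic 0, biform_zero, map_sub, map_sub, map_mul, map_mul, map_pow,
    map_pow, toFF_zero_dehom_X, toFF_zero_dehom_X, toFF_zero_dehom_X, ratio_self, one_pow]

/-- A logarithmic pole would mean order `-2`, but all orders are divisible by three. -/
lemma noLogPoles_quadForm {F : MvPolynomial (Fin 3) k} (hF : F.IsHomogeneous 2) (h0 : F ≠ 0) :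
    NoLogPoles (V := P2 k) (quadForm F) := by
  refine fun (x : P2Scheme k) h => ?_
  change (ordForm (quadForm F) x : ℚ) / (2 : ℕ) = -1 at h
  rw [ordForm_quadForm hF h0 x, div_eq_iff (by norm_num)] at h
  have h' : -3 * ordPoly F x = -1 * 2 := by exact_mod_cast h
  omega

/-! ### The Kodaira dimension -/

lemma ord_toFF_nonneg (j : Fin 3) (x : P2Scheme k) (hx : x ∈ U k j) {f : MvPolynomial (Fin 2) k}
    (hf : f ≠ 0) : 0 ≤ Scheme.ord (X := (P2 k).X) (toFF j f) x := by
  by_cases h : Order.coheight x = 1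
  · refine (Scheme.le_ord_iff (X := P2Scheme k) h (toFF_ne_zero hf)).2 ?_
    have : Ring.KrullDimLE 1 ((P2Scheme k).presheaf.stalk x) := krullDimLE_of_coheight_le h.le
    rw [← stalkToFF_toStalk j x hx]
    exact Ring.ordFrac_ge_one_of_ne_zero ((map_ne_zero_iff _ (toStalk_injective j x hx)).2 hf)
  · exact (Scheme.ord_eq_zero_of_coheight_neq_one (X := P2Scheme k) h _).ge

/-- A rational function without poles on a chart is a polynomial. -/
lemma exists_eq_toFF (j : Fin 3) {c : (P2 k).FF} (hc : c ≠ 0)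
    (h : ∀ x ∈ U k j, 0 ≤ Scheme.ord (X := (P2 k).X) c x) : ∃ f, c = toFF j f := by
  let := (toFF (k := k) j).toAlgebra
  have : IsFractionRing (MvPolynomial (Fin 2) k) (P2 k).FF := isFractionRing_toFF j
  obtain ⟨a, b, hab, rfl⟩ := IsFractionRing.exists_reduced_fraction (A := MvPolynomial (Fin 2) k) c
  have hb0 : b.1 ≠ 0 := nonZeroDivisors.ne_zero b.2
  have hcab : IsLocalization.mk' (P2 k).FF a b = toFF j a * (toFF j b.1) ^ (-1 : ℤ) := by
    rw [zpow_neg_one, ← div_eq_mul_inv, eq_div_iff (toFF_ne_zero hb0)]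
    exact IsLocalization.mk'_spec _ a b
  by_cases hu : IsUnit b.1
  · obtain ⟨u, hu⟩ := hu
    refine ⟨a * ↑u⁻¹, ?_⟩
    rw [hcab, map_mul, zpow_neg_one]
    congr 1
    refine inv_eq_of_mul_eq_one_right ?_
    rw [← hu, ← map_mul, Units.mul_inv, map_one]
  exfalso
  -- In a reduced fraction, an irreducible factor `r` of the denominator does not divide the
  -- numerator, so the divisor `r = 0` of the chart is a pole.
  obtain ⟨r, hr, b', hb'⟩ := WfDvdMonoid.exists_irreducible_factor hu hb0
  have hrp : Prime r := (UniqueFactorizationMonoid.irreducible_iff_prime).1 hr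
  let p : Spec (.of (MvPolynomial (Fin 2) k)) :=
    (⟨Ideal.span {r}, (Ideal.span_singleton_prime hrp.ne_zero).2 hrp⟩ : PrimeSpectrum _)
  have hx := chart_mem j p
  have hp : prime j (chart k j p) hx = Ideal.span {r} := prime_chart j p
  have h1 : Order.coheight (chart k j p) = 1 := by
    rw [coheight_eq j _ hx]
    refine le_antisymm ?_ ?_
    · refine Ideal.height_le_one_of_isPrincipal_of_mem_minimalPrimes (Ideal.span {r}) _ ?_
      rw [← hp]
      exact ⟨⟨inferInstance, le_rfl⟩, fun I hI _ => hI.2⟩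
    · rw [Order.one_le_iff_ne_zero, Ne, Ideal.height_eq_zero_iff_eq_bot, hp,
        Ideal.span_singleton_eq_bot]
      exact hrp.ne_zero
  have hb'0 : b' ≠ 0 := right_ne_zero_of_mul (hb' ▸ hb0)
  have hra : ¬ r ∣ a := fun hra => hr.not_isUnit (hab hra ⟨b', hb'⟩)
  have ha0 : a ≠ 0 := fun h => hra (h ▸ dvd_zero _)
  have e1 : Scheme.ord (X := (P2 k).X) (toFF j a) (chart k j p) = 0 :=
    ord_toFF_of_notMem j _ hx (by rw [hp, Ideal.mem_span_singleton]; exact hra)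
  have e2 := ord_toFF_of_prime_eq j _ hx h1 hp
  have e3 := ord_toFF_nonneg j _ hx hb'0
  have e4 : Scheme.ord (X := (P2 k).X) (toFF j b.1) (chart k j p) =
      Scheme.ord (X := (P2 k).X) (toFF j r) (chart k j p) +
      Scheme.ord (X := (P2 k).X) (toFF j b') (chart k j p) := by
    rw [hb', map_mul]
    exact Scheme.ord_mul (X := P2Scheme k) (toFF_ne_zero hr.ne_zero) (toFF_ne_zero hb'0)
  have e5 := ord_zpow (Y := P2Scheme k) (chart k j p) (toFF_ne_zero (j := j) hb0) (-1)
  have e6 := Scheme.ord_mul (X := P2Scheme k) (x := chart k j p) (toFF_ne_zero (j := j) ha0)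
    (zpow_ne_zero (-1) (toFF_ne_zero (j := j) hb0))
  have e7 := h _ hx
  rw [hcab] at e7
  have e8 := e7.trans_eq e6
  rw [e5] at e8
  change 0 ≤ Scheme.ord (X := (P2 k).X) (toFF j a) (chart k j p) +
    -1 * Scheme.ord (X := (P2 k).X) (toFF j b.1) (chart k j p) at e8
  rw [e1, e4, e2] at e8
  omega

lemma totalDegree_dehom_le (j : Fin 3) {n : ℕ} {F : MvPolynomial (Fin 3) k} (hF : F.IsHomogeneous n) :
    (dehom j F).totalDegree ≤ n := by
  rw [dehom, aeval_def, eval₂_eq]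
  refine totalDegree_finsetSum_le fun d hd => ?_
  have h := hF (mem_support_iff.1 hd)
  rw [Finsupp.weight_apply, Finsupp.sum] at h
  refine (totalDegree_mul _ _).trans ?_
  rw [algebraMap_eq, totalDegree_C, zero_add, ← h]
  refine (totalDegree_finsetProd _ _).trans (Finset.sum_le_sum fun i _ => ?_)
  refine (totalDegree_pow _ _).trans ?_
  simp only [Pi.one_apply, smul_eq_mul, mul_one]
  refine mul_le_of_le_one_right (Nat.zero_le _) ?_
  induction i using j.succAboveCases with
  | x => simp
  | p i => simp

/-- A form without poles has polynomial coefficients in the charts `X ≠ 0` and `Z ≠ 0`. The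
transition factor `(X/Z)^{3m}` makes these incompatible for reasons of degree: `O(-3m)` has no
nonzero sections. -/
lemma kodairaDimNegInfty : KodairaDimNegInfty (P2 k) 2 := by
  intro m hm η hη
  by_contra! hord
  have key (j : Fin 3) : ∃ f : MvPolynomial (Fin 2) k, f ≠ 0 ∧ η = toFF j f • chartForm k j m := by
    obtain ⟨c, rfl⟩ := exists_eq_smul_chartForm j η
    have hc : c ≠ 0 := fun h => hη (by rw [h, zero_smul])
    obtain ⟨f, rfl⟩ := exists_eq_toFF j hc fun x hx => (hord x).trans_eq (ordForm_eq j x hx hc)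
    exact ⟨f, fun h => hc (by rw [h, map_zero]), rfl⟩
  obtain ⟨f₀, h0, e0⟩ := key 0
  obtain ⟨f₂, h2, e2⟩ := key 2
  rw [e2, chartForm_eq_of_det m det_chart_zero, smul_smul] at e0
  have e : toFF 2 f₂ * (ratio k 0 2 ^ 3) ^ m = toFF 0 f₀ :=
    smul_left_injective _ (chartForm_ne_zero (k := k) 0 m) e0
  obtain ⟨n, F, hF, rfl⟩ := exists_dehom 0 f₀
  -- Here `F` has degree `n`, so the left side has degree at most `n`, while the right side has
  -- degree at least `n + 3m`.
  have e3 : dehom 2 F = X 0 ^ (n + 3 * m) * f₂ := by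
    refine toFF_injective 2 ?_
    rw [toFF_dehom_eq_mul 0 2 hF, ← e, map_mul, map_pow, toFF_X]
    change _ = ratio k 0 2 ^ (n + 3 * m) * _
    ring
  have h3 := totalDegree_dehom_le 2 hF
  rw [e3, totalDegree_mul_of_isDomain (pow_ne_zero _ (X_ne_zero 0)) h2, totalDegree_X_pow] at h3
  omega

end P2

end MotivicPV
end

open CategoryTheory AlgebraicGeometry
noncomputable section
namespace MotivicPV
open MvPolynomial

/-! ### Graphs in the affine plane -/

section Graph

variable {k : Type u} [Field k]

/-- The restriction of polynomial functions to the curve `X_b = g(X_a)` for `b ≠ a`. -/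
def graphHom (a : Fin 2) (g : Polynomial k) : MvPolynomial (Fin 2) k →ₐ[k] Polynomial k :=
  aeval fun i => if i = a then Polynomial.X else g

lemma graphHom_aeval_X (a : Fin 2) (g f : Polynomial k) :
    graphHom a g (Polynomial.aeval (X a) f) = f := by
  rw [← Polynomial.aeval_algHom_apply]
  simp [graphHom]

lemma graphHom_surjective (a : Fin 2) (g : Polynomial k) : Function.Surjective (graphHom a g) :=
  fun f => ⟨_, graphHom_aeval_X a g f⟩

/-- Modulo `X b - g(X a)`, each polynomial is congruent to its restriction, read as a polynomial in
`X a`. -/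
lemma ker_graphHom {a b : Fin 2} (hab : b ≠ a) (g : Polynomial k) :
    RingHom.ker (graphHom a g) = Ideal.span {X b - Polynomial.aeval (X a) g} := by
  refine le_antisymm (fun f hf => ?_) ?_
  · set I := Ideal.span {X b - Polynomial.aeval (X a : MvPolynomial (Fin 2) k) g}
    have h : (Ideal.Quotient.mkₐ k I).comp ((Polynomial.aeval (X a)).comp (graphHom a g)) =
        Ideal.Quotient.mkₐ k I := by
      refine algHom_ext fun i => ?_
      by_cases hi : i = a
      · simp [graphHom, hi]
      · have hib : i = b := by omega
        rw [AlgHom.comp_apply, AlgHom.comp_apply, graphHom, aeval_X, if_neg hi, hib]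
        exact (Ideal.Quotient.eq.2 (Ideal.mem_span_singleton_self _)).symm
    have h1 : Ideal.Quotient.mk I (Polynomial.aeval (X a) (graphHom a g f)) = Ideal.Quotient.mk I f :=
      congrArg (fun φ => φ f) h
    have h2 : graphHom a g f = 0 := hf
    rw [← Ideal.Quotient.eq_zero_iff_mem, ← h1, h2, map_zero, map_zero]
  · rw [Ideal.span_singleton_le_iff_mem, RingHom.mem_ker, map_sub, graphHom_aeval_X, graphHom, aeval_X,
      if_neg hab, sub_self]

/-- The second generator is a lift of a generator of the image of `P`. For a point on a graph it
serves as the second local coordinate. -/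
lemma exists_eq_span_pair {R S : Type*} [CommRing R] [CommRing S] [IsPrincipalIdealRing S]
    (φ : R →+* S) (hφ : Function.Surjective φ) {f : R} (hf : RingHom.ker φ = Ideal.span {f})
    {P : Ideal R} (hP : f ∈ P) : ∃ h, P = Ideal.span {f, h} := by
  obtain ⟨s, hs⟩ := (IsPrincipalIdealRing.principal (P.map φ)).principal
  obtain ⟨h, rfl⟩ := hφ s
  refine ⟨h, ?_⟩
  have h1 := Ideal.comap_map_of_surjective' φ hφ P
  rw [hf, sup_eq_left.2 ((Ideal.span_singleton_le_iff_mem _).2 hP), hs, ← Ideal.span,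
    ← Set.image_singleton, ← Ideal.map_span, Ideal.comap_map_of_surjective' φ hφ, hf, sup_comm,
    ← Ideal.span_union] at h1
  exact h1.symm

end Graph

namespace P2

variable {k : Type u} [Field k]

/-! ### Local coordinates -/

lemma stalkSpecializes_toStalk (j : Fin 3) {ξ p : P2Scheme k} (h : ξ ⤳ p) (hp : p ∈ U k j)
    (hξ : ξ ∈ U k j) :
    ((P2Scheme k).presheaf.stalkSpecializes h).hom.comp (toStalk j p hp) = toStalk j ξ hξ := by
  refine RingHom.ext fun f => ?_
  exact (P2Scheme k).presheaf.germ_stalkSpecializes_apply (U := U k j) hp h (sec j f)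

/-- An ideal of a localization is generated by its contraction; thus a local equation of a curve at
`p` can be taken from the chart. -/
lemma comap_stalkSpecializes (j : Fin 3) {ξ p : P2Scheme k} (h : ξ ⤳ p) (hp : p ∈ U k j)
    (hξ : ξ ∈ U k j) :
    (IsLocalRing.maximalIdeal ((P2Scheme k).presheaf.stalk ξ)).comap
      ((P2Scheme k).presheaf.stalkSpecializes h).hom = (prime j ξ hξ).map (toStalk j p hp) := by
  let := (toStalk j p hp).toAlgebra
  have : IsLocalization (prime j p hp).primeCompl ((P2Scheme k).presheaf.stalk p) :=
    isLocalization_toStalk j p hp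
  rw [prime, ← stalkSpecializes_toStalk j h hp hξ, ← Ideal.comap_comap]
  exact (IsLocalization.map_under (prime j p hp).primeCompl _ _).symm

lemma exists_coordinates {D : P2Scheme k → ℚ} (j : Fin 3) {p : P2Scheme k} (hp : p ∈ U k j)
    (h : Fin 2 → MvPolynomial (Fin 2) k) (hh : prime j p hp = Ideal.span (Set.range h))
    (i : {ξ : P2Scheme k // D ξ ≠ 0 ∧ ξ ⤳ p} → Fin 2) (hi : Function.Injective i)
    (hξ : ∀ ξ, prime j ξ.1 (ξ.2.2.mem_open (U k j).isOpen hp) = Ideal.span {h (i ξ)}) :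
    ∃ t : Fin 2 → (P2Scheme k).presheaf.stalk p,
      Ideal.span (Set.range t) = IsLocalRing.maximalIdeal ((P2Scheme k).presheaf.stalk p) ∧
      ∃ i : {ξ : P2Scheme k // D ξ ≠ 0 ∧ ξ ⤳ p} → Fin 2, Function.Injective i ∧
        ∀ ξ, Ideal.comap ((P2Scheme k).presheaf.stalkSpecializes ξ.2.2).hom
          (IsLocalRing.maximalIdeal ((P2Scheme k).presheaf.stalk ξ.1)) = Ideal.span {t (i ξ)} := by
  refine ⟨toStalk j p hp ∘ h, ?_, i, hi, fun ξ => ?_⟩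
  · rw [Set.range_comp, ← Ideal.map_span, ← hh, maximalIdeal_eq_map j p hp]
  · rw [comap_stalkSpecializes j ξ.2.2 hp (ξ.2.2.mem_open (U k j).isOpen hp), hξ, Ideal.map_span,
      Set.image_singleton]
    rfl

/-- For a single component that is a graph in the chart: its coordinate ring `k[t]` is principal, so
its equation and one more function generate the ideal of `p`. -/
lemma exists_coordinates_of_subsingleton {D : P2Scheme k → ℚ} (j : Fin 3) {p : P2Scheme k}
    (hp : p ∈ U k j) {n : ℕ} {F : MvPolynomial (Fin 3) k} (hF : F.IsHomogeneous n) (hpr : Prime F)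
    (hX : ∃ j, ¬ F ∣ X j) (hD : ∀ ξ, D ξ ≠ 0 → ξ ⤳ p → ξ = pt hF hpr hX) (hFp : F ∈ hid p)
    (a : Fin 2) (g : Polynomial k)
    (hg : RingHom.ker (graphHom a g) = Ideal.span {dehom j F}) :
    ∃ t : Fin 2 → (P2Scheme k).presheaf.stalk p,
      Ideal.span (Set.range t) = IsLocalRing.maximalIdeal ((P2Scheme k).presheaf.stalk p) ∧
      ∃ i : {ξ : P2Scheme k // D ξ ≠ 0 ∧ ξ ⤳ p} → Fin 2, Function.Injective i ∧
        ∀ ξ, Ideal.comap ((P2Scheme k).presheaf.stalkSpecializes ξ.2.2).hom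
          (IsLocalRing.maximalIdeal ((P2Scheme k).presheaf.stalk ξ.1)) = Ideal.span {t (i ξ)} := by
  obtain ⟨h, hh⟩ := exists_eq_span_pair (graphHom a g).toRingHom (graphHom_surjective a g) hg
    ((dehom_mem_prime j p hp hF).2 hFp)
  refine exists_coordinates j hp ![dehom j F, h] (by rw [hh, Matrix.range_cons, Matrix.range_cons,
    Matrix.range_empty, Set.union_empty, Set.singleton_union]) (fun _ => 0)
    (fun ξ ξ' _ => Subtype.ext ((hD _ ξ.2.1 ξ.2.2).trans (hD _ ξ'.2.1 ξ'.2.2).symm)) fun ξ => ?_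
  obtain ⟨ξ, h1, h2⟩ := ξ
  obtain rfl := hD ξ h1 h2
  exact prime_pt hF hpr hX _

lemma divForm_quadForm_ne_zero {F : MvPolynomial (Fin 3) k} (hF : F.IsHomogeneous 2) (h0 : F ≠ 0)
    {x : P2Scheme k} (h : divForm (V := P2 k) (quadForm F) x ≠ 0) : ordPoly F x ≠ 0 := by
  contrapose! h
  change (ordForm (quadForm F) x : ℚ) / (2 : ℕ) = 0
  rw [ordForm_quadForm hF h0 x, h]
  simp

variable (k) in
/-- The generic point of a coordinate line. -/
def ptX (i : Fin 3) : P2Scheme k :=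
  pt (isHomogeneous_X k i) (X_prime (i := i)) ⟨i + 1, not_X_dvd_X (by omega)⟩

variable (k) in
/-- The generic point of the conic. -/
def ptConic : P2Scheme k := pt isHomogeneous_conic prime_conic ⟨0, not_conic_dvd_X 0⟩

lemma eq_ptConic {x : P2Scheme k} (h : divForm (V := P2 k) (quadForm (conic k)) x ≠ 0) :
    x = ptConic k := by
  have h1 := divForm_quadForm_ne_zero isHomogeneous_conic prime_conic.ne_zero h
  rw [ordPoly_eq isHomogeneous_conic prime_conic ⟨0, not_conic_dvd_X 0⟩] at h1
  by_contra hx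
  exact h1 (if_neg hx)

lemma eq_ptX {x : P2Scheme k}
    (h : divForm (V := P2 k) (quadForm (X 1 * X 2 : MvPolynomial (Fin 3) k)) x ≠ 0) :
    x = ptX k 1 ∨ x = ptX k 2 := by
  have h1 := divForm_quadForm_ne_zero (isHomogeneous_X_mul_X 1 2)
    (mul_ne_zero (X_ne_zero 1) (X_ne_zero 2)) h
  rw [ordPoly_mul (isHomogeneous_X k 1) (X_ne_zero 1) (isHomogeneous_X k 2) (X_ne_zero 2),
    ordPoly_eq (isHomogeneous_X k 1) (X_prime (i := 1)) ⟨1 + 1, not_X_dvd_X (by omega)⟩,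
    ordPoly_eq (isHomogeneous_X k 2) (X_prime (i := 2)) ⟨2 + 1, not_X_dvd_X (by omega)⟩] at h1
  by_contra! hx
  unfold ptX at hx
  exact h1 (by rw [if_neg hx.1, if_neg hx.2, add_zero])

lemma ptX_specializes_iff (i : Fin 3) p : ptX k i ⤳ p ↔ X i ∈ hid p :=
  pt_specializes_iff ..

lemma prime_ptX (i j : Fin 3) (h : ptX k i ∈ U k j) :
    prime j (ptX k i) h = Ideal.span {dehom j (X i)} :=
  prime_pt ..

lemma ptX_ne : ptX k 1 ≠ ptX k 2 := by
  intro h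
  have h1 : ptX k 1 ⤳ ptX k 2 := by rw [h]
  have h2 : (X 1 : MvPolynomial (Fin 3) k) ∈ hid (ptX k 2) := (ptX_specializes_iff ..).1 h1
  exact not_X_dvd_X (k := k) (i := 2) (j := 1) (by decide) ((mem_hid_pt ..).1 h2)

lemma ker_graphHom_zero {a b : Fin 2} (hab : b ≠ a) :
    RingHom.ker (graphHom a (0 : Polynomial k)) = Ideal.span {X b} := by
  rw [ker_graphHom hab, map_zero, sub_zero]

lemma ker_graphHom_X_sq :
    RingHom.ker (graphHom 0 (Polynomial.X ^ 2 : Polynomial k)) = Ideal.span {X 1 - X 0 ^ 2} := by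
  rw [ker_graphHom (b := 1) (by decide), map_pow, Polynomial.aeval_X]

lemma dehom_conic_two : dehom 2 (conic k) = X 1 - X 0 ^ 2 := by
  have h0 : dehom 2 (X 0 : MvPolynomial (Fin 3) k) = X 0 := dehom_X_succAbove 2 0
  have h1 : dehom 2 (X 1 : MvPolynomial (Fin 3) k) = X 1 := dehom_X_succAbove 2 1
  rw [map_sub, map_mul, map_pow, h0, h1, dehom_X_self, mul_one]

lemma dehom_conic_one : dehom 1 (conic k) = X 1 - X 0 ^ 2 := by
  have h0 : dehom 1 (X 0 : MvPolynomial (Fin 3) k) = X 0 := dehom_X_succAbove 1 0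
  have h1 : dehom 1 (X 2 : MvPolynomial (Fin 3) k) = X 1 := dehom_X_succAbove 1 1
  rw [map_sub, map_mul, map_pow, h0, h1, dehom_X_self, one_mul]

lemma X_zero_mem_hid {p : P2Scheme k} (hF : conic k ∈ hid p) (h2 : X 2 ∈ hid p) : X 0 ∈ hid p := by
  refine (inferInstance : (hid p).IsPrime).mem_of_pow_mem 2 ?_
  have := sub_mem (Ideal.mul_mem_left _ (X 1) h2) hF
  simpa [conic] using this

/-- On the conic, `Z = 0` forces `X = 0`, so the charts `Z ≠ 0` and `Y ≠ 0` cover it. In both it is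
a parabola, hence a graph. -/
lemma isNormalCrossings_conic :
    IsNormalCrossings (V := P2 k) 2 (divForm (V := P2 k) (quadForm (conic k))) := by
  intro p _ ⟨ξ, hξ, hp⟩
  change P2Scheme k at p
  rw [eq_ptConic hξ] at hp
  have hFp : conic k ∈ hid p := (pt_specializes_iff ..).1 hp
  by_cases h2 : p ∈ U k 2
  · exact exists_coordinates_of_subsingleton 2 h2 _ _ _ (fun ξ h _ => eq_ptConic h) hFp 0
      (Polynomial.X ^ 2) (by rw [ker_graphHom_X_sq, dehom_conic_two])
  · have h2' : X 2 ∈ hid p := not_not.1 h2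
    have h0 := X_zero_mem_hid hFp h2'
    have h1 : p ∈ U k 1 := by
      intro h1
      obtain ⟨j, hj⟩ := exists_mem_U p
      fin_cases j
      exacts [hj h0, hj h1, hj h2']
    exact exists_coordinates_of_subsingleton 1 h1 _ _ _ (fun ξ h _ => eq_ptConic h) hFp 0
      (Polynomial.X ^ 2) (by rw [ker_graphHom_X_sq, dehom_conic_one])

lemma dehom_X {j i : Fin 3} {l : Fin 2} (h : j.succAbove l = i) :
    dehom j (X i : MvPolynomial (Fin 3) k) = X l := h ▸ dehom_X_succAbove j l

lemma exists_coordinates_line {i j : Fin 3} {l : Fin 2} (hl : j.succAbove l = i) {p : P2Scheme k}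
    (hj : p ∈ U k j) (hi : X i ∈ hid p) {D : P2Scheme k → ℚ}
    (hD : ∀ ξ, D ξ ≠ 0 → ξ ⤳ p → ξ = ptX k i) :
    ∃ t : Fin 2 → (P2Scheme k).presheaf.stalk p,
      Ideal.span (Set.range t) = IsLocalRing.maximalIdeal ((P2Scheme k).presheaf.stalk p) ∧
      ∃ i : {ξ : P2Scheme k // D ξ ≠ 0 ∧ ξ ⤳ p} → Fin 2, Function.Injective i ∧
        ∀ ξ, Ideal.comap ((P2Scheme k).presheaf.stalkSpecializes ξ.2.2).hom
          (IsLocalRing.maximalIdeal ((P2Scheme k).presheaf.stalk ξ.1)) = Ideal.span {t (i ξ)} :=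
  exists_coordinates_of_subsingleton j hj _ _ _ hD hi (l + 1) 0
    (by rw [ker_graphHom_zero (b := l) (by omega), dehom_X hl])

lemma isMaximal_span_X : (Ideal.span {X 0, X 1} : Ideal (MvPolynomial (Fin 2) k)).IsMaximal := by
  have h : RingHom.ker (Polynomial.constantCoeff.comp (graphHom 0 (0 : Polynomial k)).toRingHom) =
      Ideal.span {X 0, X 1} := by
    have h1 := Ideal.comap_map_of_surjective' (graphHom 0 (0 : Polynomial k)).toRingHom
      (graphHom_surjective 0 0) (Ideal.span {X 0})
    rw [← RingHom.comap_ker, Polynomial.ker_constantCoeff, Ideal.span_insert,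
      ← ker_graphHom_zero (k := k) (show (1 : Fin 2) ≠ 0 by decide)]
    refine Eq.trans ?_ h1
    rw [Ideal.map_span, Set.image_singleton]
    congr 3
    exact (graphHom_aeval_X 0 0 (Polynomial.X : Polynomial k)).symm.trans (by simp)
  rw [← h]
  refine RingHom.ker_isMaximal_of_surjective _ fun c => ⟨C c, ?_⟩
  simp

lemma isNormalCrossings_lines : IsNormalCrossings (V := P2 k) 2
    (divForm (V := P2 k) (quadForm (X 1 * X 2 : MvPolynomial (Fin 3) k))) := by
  intro p _ ⟨ξ, hξ, hp⟩
  change P2Scheme k at p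
  have hX {ξ : P2Scheme k} (hξ : divForm (V := P2 k) (quadForm (X 1 * X 2)) ξ ≠ 0) (hp : ξ ⤳ p) :
      (ξ = ptX k 1 ∧ X 1 ∈ hid p) ∨ (ξ = ptX k 2 ∧ X 2 ∈ hid p) := by
    obtain rfl | rfl := eq_ptX hξ
    · exact .inl ⟨rfl, (ptX_specializes_iff ..).1 hp⟩
    · exact .inr ⟨rfl, (ptX_specializes_iff ..).1 hp⟩
  by_cases h1 : X 1 ∈ hid p <;> by_cases h2 : X 2 ∈ hid p
  -- Both lines pass through `p`, so `p` is the point `(1 : 0 : 0)`, with coordinates `Y/X` and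
  -- `Z/X`. In the other cases at most one line matters.
  · have h0 : p ∈ U k 0 := by
      intro h0
      obtain ⟨j, hj⟩ := exists_mem_U p
      fin_cases j
      exacts [hj h0, hj h1, hj h2]
    have hX1 := dehom_X (k := k) (show Fin.succAbove 0 0 = (1 : Fin 3) by decide)
    have hX2 := dehom_X (k := k) (show Fin.succAbove 0 1 = (2 : Fin 3) by decide)
    classical
    refine exists_coordinates 0 h0 ![X 0, X 1] ?_ (fun ξ => if ξ.1 = ptX k 1 then 0 else 1) ?_ ?_
    · rw [Matrix.range_cons, Matrix.range_cons, Matrix.range_empty, Set.union_empty,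
        Set.singleton_union]
      -- The ideal of the origin is maximal and contained in the prime of `p`, so they agree.
      refine (isMaximal_span_X.eq_of_le (Ideal.IsPrime.ne_top inferInstance) ?_).symm
      rw [Ideal.span_le, Set.insert_subset_iff, Set.singleton_subset_iff, ← hX1, ← hX2]
      exact ⟨(dehom_mem_prime 0 p h0 (isHomogeneous_X k 1)).2 h1,
        (dehom_mem_prime 0 p h0 (isHomogeneous_X k 2)).2 h2⟩
    · rintro ⟨ξ, hξ, hp⟩ ⟨ξ', hξ', hp'⟩ h
      refine Subtype.ext ?_
      obtain ⟨rfl, -⟩ | ⟨rfl, -⟩ := hX hξ hp <;> obtain ⟨rfl, -⟩ | ⟨rfl, -⟩ := hX hξ' hp' <;>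
        simp [ptX_ne.symm] at h ⊢
    · rintro ⟨ξ, hξ, hp⟩
      obtain ⟨rfl, -⟩ | ⟨rfl, -⟩ := hX hξ hp
      · rw [if_pos rfl]
        exact (prime_ptX ..).trans (by rw [hX1]; rfl)
      · rw [if_neg ptX_ne.symm]
        exact (prime_ptX ..).trans (by rw [hX2]; rfl)
  · exact exists_coordinates_line (j := 2) (l := 1) (i := 1) (by decide) h2 h1 fun ξ hξ hp =>
      ((hX hξ hp).resolve_right fun h => h2 h.2).1
  · exact exists_coordinates_line (j := 1) (l := 1) (i := 2) (by decide) h1 h2 fun ξ hξ hp =>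
      ((hX hξ hp).resolve_left fun h => h1 h.2).1
  · exact absurd (hX hξ hp) (by simp [h1, h2])

end P2

end MotivicPV
end

open CategoryTheory AlgebraicGeometry
noncomputable section
namespace MotivicPV
open MvPolynomial

/-! ### Classes in the Grothendieck ring -/

section Classes

variable {k : Type u} [Field k]

lemma K0.mk_eq {a b : FreeCommRing (Variety k)} (h : K0Rel k a b) :
    (Ideal.Quotient.mk _ a : K0 k) = Ideal.Quotient.mk _ b :=
  Ideal.Quotient.eq.2 (Ideal.subset_span ⟨_, _, h, rfl⟩)

/-- Additivity of the class of locally closed subsets. -/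
lemma Variety.cl_diff_add (V : Variety k) {W C : Set V.X} (hW : IsLocallyClosed W)
    (hC : IsClosed C) : V.cl W = V.cl (W \ C) + V.cl (W ∩ C) := by
  obtain ⟨Z, j, hj, hjs, rfl⟩ := V.exists_immersion hW
  have hC' : IsClosed (j ⁻¹' C) := hC.preimage j.continuous
  obtain ⟨Z', i, hi, his, hir⟩ := Z.exists_immersion hC'.isLocallyClosed
  have hci : IsClosedImmersion i := .of_isPreimmersion _ (by rw [hir]; exact hC')
  let O : Z.X.Opens := ⟨(j ⁻¹' C)ᶜ, hC'.isOpen_compl⟩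
  have hO : LocallyOfFiniteType (O.ι ≫ Z.str) := inferInstance
  let U : Variety k := ⟨O, O.ι ≫ Z.str⟩
  have h1 : Set.range j \ C = Set.range (O.ι ≫ j) := by
    rw [Scheme.Hom.comp_base, TopCat.coe_comp, Set.range_comp, Scheme.Opens.range_ι]
    change _ = j '' (j ⁻¹' C)ᶜ
    rw [← Set.preimage_compl, Set.image_preimage_eq_range_inter, Set.sdiff_eq]
  have h2 : Set.range j ∩ C = Set.range (i ≫ j) := by
    rw [Scheme.Hom.comp_base, TopCat.coe_comp, Set.range_comp, hir,
      Set.image_preimage_eq_range_inter]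
  rw [h1, h2, V.cl_eq Z j hjs, V.cl_eq U (O.ι ≫ j) (by simp [U, hjs]),
    V.cl_eq Z' (i ≫ j) (by simp [hjs, his])]
  refine (K0.mk_eq (K0Rel.scissor Z Z' U i O.ι hci inferInstance his rfl ?_)).trans (map_add _ _ _)
  rw [hir, Scheme.Opens.range_ι]
  rfl

/-- The affine variety of a reduced algebra of finite type. -/
def Variety.spec (B : Type u) [CommRing B] [IsReduced B] [Algebra k B] [Algebra.FiniteType k B] :
    Variety k where
  X := Spec (.of B)
  str := specStr B
  locallyOfFiniteType := by
    rw [HasRingHomProperty.Spec_iff (P := @LocallyOfFiniteType)]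
    exact RingHom.finiteType_algebraMap.2 inferInstance

lemma K0.cl_spec_congr {B C : Type u} [CommRing B] [IsReduced B] [Algebra k B]
    [Algebra.FiniteType k B] [CommRing C] [IsReduced C] [Algebra k C] [Algebra.FiniteType k C]
    (e : B ≃ₐ[k] C) : K0.cl (Variety.spec (k := k) B) = K0.cl (Variety.spec C) :=
  (K0.mk_eq (K0Rel.iso (Variety.spec C) (Variety.spec B)
    (Scheme.Spec.mapIso e.toRingEquiv.toCommRingCatIso.op) (FiniteModel.specMap_specStr e.toAlgHom))).symm

lemma K0.cl_spec_self : K0.cl (Variety.spec (k := k) k) = 1 := by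
  have h : specStr (k := k) k = 𝟙 _ := by
    rw [specStr, Algebra.algebraMap_self]; exact Spec.map_id _
  refine (K0.mk_eq (K0Rel.point (Variety.spec k) ?_)).trans (map_one _)
  change IsIso (specStr k)
  rw [h]
  infer_instance

open TensorProduct in
lemma K0.cl_spec_tensorProduct (B C : Type u) [CommRing B] [IsReduced B] [Algebra k B]
    [Algebra.FiniteType k B] [CommRing C] [IsReduced C] [Algebra k C] [Algebra.FiniteType k C]
    [IsReduced (B ⊗[k] C)] : K0.cl (Variety.spec (k := k) (B ⊗[k] C)) =
      K0.cl (Variety.spec (k := k) B) * K0.cl (Variety.spec (k := k) C) :=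
  (K0.mk_eq (K0Rel.prod (Variety.spec B) (Variety.spec C) (Variety.spec (B ⊗[k] C))
    (Spec.map (CommRingCat.ofHom (Algebra.TensorProduct.includeLeft : B →ₐ[k] _).toRingHom))
    (Spec.map (CommRingCat.ofHom (Algebra.TensorProduct.includeRight : C →ₐ[k] _).toRingHom))
    (FiniteModel.specMap_specStr _)
    (isPullback_SpecMap_of_isPushout _ _ _ _
      (CommRingCat.isPushout_tensorProduct k B C)))).symm.trans (map_mul _ _ _)

/-- The plane is the product of two lines: `k[x, y] = k[t] ⊗ k[t]`. -/
lemma K0.cl_spec_mvPolynomial :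
    K0.cl (Variety.spec (k := k) (MvPolynomial (Fin 2) k)) = K0.L k ^ 2 := by
  have e : MvPolynomial (Fin 2) k ≃ₐ[k] TensorProduct k (Polynomial k) (Polynomial k) :=
    ((finSuccEquiv k 1).trans (Polynomial.mapAlgEquiv (uniqueAlgEquiv k (Fin 1)))).trans
      (polyEquivTensor k (Polynomial k))
  have : IsReduced (TensorProduct k (Polynomial k) (Polynomial k)) :=
    isReduced_of_injective e.symm e.symm.injective
  rw [K0.cl_spec_congr e, K0.cl_spec_tensorProduct, pow_two]
  rfl

end Classes

namespace P2

variable {k : Type u} [Field k]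

lemma mem_curve {F : MvPolynomial (Fin 3) k} {x : P2Scheme k} : x ∈ curve F ↔ F ∈ hid x := not_not

lemma isClosed_curve (F : MvPolynomial (Fin 3) k) : IsClosed (curve F) :=
  (Proj.basicOpen (Gr k) F).isOpen.isClosed_compl

/-- A closed subscheme of a chart is immersed in the plane, so a locally closed set with this image
has the class of `Spec B`. -/
lemma cl_chart_image {B : Type u} [CommRing B] [IsReduced B] [Algebra k B] [Algebra.FiniteType k B]
    (j : Fin 3) (φ : MvPolynomial (Fin 2) k →ₐ[k] B) (hφ : Function.Surjective φ) {W : Set (P2Scheme k)}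
    (hW : ∀ x, x ∈ W ↔ ∃ p, RingHom.ker φ ≤ p.asIdeal ∧ chart k j p = x) :
    (P2 k).cl W = K0.cl (Variety.spec B) := by
  have : IsClosedImmersion (Spec.map (CommRingCat.ofHom φ.toRingHom)) :=
    IsClosedImmersion.spec_of_surjective _ hφ
  have h : W = Set.range (Spec.map (CommRingCat.ofHom φ.toRingHom) ≫ chart k j) := by
    rw [Scheme.Hom.comp_base, TopCat.coe_comp, Set.range_comp]
    have h1 : Set.range (Spec.map (CommRingCat.ofHom φ.toRingHom)) =
      PrimeSpectrum.zeroLocus (RingHom.ker φ) := range_comap_of_surjective _ φ.toRingHom hφ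
    rw [h1]
    ext x
    exact hW x
  have : IsImmersion (Spec.map (CommRingCat.ofHom φ.toRingHom) ≫ chart k j) := inferInstance
  rw [h]
  refine Variety.cl_eq (P2 k) (Variety.spec B) _ (hj := this) ?_
  refine (Category.assoc _ _ _).trans ?_
  exact (congrArg _ (chart_str j)).trans (FiniteModel.specMap_specStr φ)

lemma exists_chart {j : Fin 3} {x : P2Scheme k} (hx : x ∈ U k j) : ∃ p, chart k j p = x := by
  rw [← opensRange_chart] at hx
  exact hx

lemma cl_U (j : Fin 3) : (P2 k).cl (U k j : Set (P2Scheme k)) = K0.L k ^ 2 := by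
  rw [← K0.cl_spec_mvPolynomial]
  refine cl_chart_image j (AlgHom.id k _) Function.surjective_id fun x => ⟨fun hx => ?_, ?_⟩
  · obtain ⟨p, rfl⟩ := exists_chart hx
    exact ⟨p, fun f hf => by rw [show f = 0 from hf]; exact zero_mem _, rfl⟩
  · rintro ⟨p, -, rfl⟩
    exact chart_mem j p

/-- The part of the curve in the chart is a graph, hence isomorphic to the affine line. -/
lemma cl_curve_inter {n : ℕ} {F : MvPolynomial (Fin 3) k} (hF : F.IsHomogeneous n) (j : Fin 3)
    (a : Fin 2) (g : Polynomial k) (h : RingHom.ker (graphHom a g) = Ideal.span {dehom j F}) :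
    (P2 k).cl (curve F \ curve (X j)) = K0.L k := by
  have h' (p : Spec (.of (MvPolynomial (Fin 2) k))) :
      RingHom.ker (graphHom a g) ≤ p.asIdeal ↔ F ∈ hid (chart k j p) := by
    rw [h, mem_hid_chart j p hF]
    exact Ideal.span_singleton_le_iff_mem _
  refine cl_chart_image j (graphHom a g) (graphHom_surjective a g) fun x => ⟨fun hx => ?_, ?_⟩
  · obtain ⟨p, rfl⟩ := exists_chart (j := j) fun h => hx.2 (mem_curve.2 h)
    exact ⟨p, (h' p).2 (mem_curve.1 hx.1), rfl⟩
  · rintro ⟨p, hp, rfl⟩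
    exact ⟨mem_curve.2 ((h' p).1 hp), fun h => chart_mem j p (mem_curve.1 h)⟩

lemma cl_curve_X_inter {i j : Fin 3} (hij : i ≠ j) :
    (P2 k).cl (curve (X i) \ curve (X j)) = K0.L k := by
  obtain ⟨l, hl⟩ := Fin.exists_succAbove_eq hij
  exact cl_curve_inter (isHomogeneous_X k i) j (l + 1) 0
    (by rw [ker_graphHom_zero (b := l) (by omega), dehom_X hl])

/-- The value of a polynomial function at the origin. -/
def originHom : MvPolynomial (Fin 2) k →ₐ[k] k := aeval 0

lemma ker_originHom : RingHom.ker (originHom (k := k)) = Ideal.span {X 0, X 1} := by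
  refine (isMaximal_span_X.eq_of_le (RingHom.ker_ne_top _) ?_).symm
  rw [Ideal.span_le, Set.insert_subset_iff, Set.singleton_subset_iff]
  constructor <;> simp [originHom]

lemma cl_point {W : Set (P2Scheme k)} {i l : Fin 3} (j : Fin 3) (hi : j.succAbove 0 = i)
    (hl : j.succAbove 1 = l) (hW : ∀ x, x ∈ W ↔ x ∈ U k j ∧ X i ∈ hid x ∧ X l ∈ hid x) :
    (P2 k).cl W = 1 := by
  rw [← K0.cl_spec_self]
  refine cl_chart_image j originHom (fun c => ⟨C c, by simp [originHom]⟩) fun x => ?_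
  have h (p : Spec (.of (MvPolynomial (Fin 2) k))) :
      Ideal.span {X 0, X 1} ≤ p.asIdeal ↔ X i ∈ hid (chart k j p) ∧ X l ∈ hid (chart k j p) := by
    rw [Ideal.span_le, Set.insert_subset_iff, Set.singleton_subset_iff,
      mem_hid_chart j p (isHomogeneous_X k i), mem_hid_chart j p (isHomogeneous_X k l), dehom_X hi,
      dehom_X hl]
    rfl
  rw [hW, ker_originHom]
  constructor
  · rintro ⟨hx, h1⟩
    obtain ⟨p, rfl⟩ := exists_chart hx
    exact ⟨p, (h p).2 h1, rfl⟩
  · rintro ⟨p, hp, rfl⟩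
    exact ⟨chart_mem j p, (h p).1 hp⟩

lemma mem_U_of_forall {j : Fin 3} {x : P2Scheme k} (h : ∀ i, i ≠ j → X i ∈ hid x) : x ∈ U k j := by
  obtain ⟨i, hi⟩ := exists_mem_U x
  by_cases hij : i = j
  · rwa [← hij]
  · exact absurd (h i hij) hi

lemma cl_curve_X_inter_curve_X : (P2 k).cl (curve (X 1) ∩ curve (X 2)) = 1 := by
  refine cl_point 0 (i := 1) (l := 2) rfl rfl fun x => ?_
  refine ⟨fun h => ?_, fun h => ⟨mem_curve.2 h.2.1, mem_curve.2 h.2.2⟩⟩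
  have h1 := mem_curve.1 h.1
  have h2 := mem_curve.1 h.2
  refine ⟨mem_U_of_forall fun i hi => ?_, h1, h2⟩
  fin_cases i
  exacts [absurd rfl hi, h1, h2]

lemma cl_compl_curve_X (j : Fin 3) : (P2 k).cl (curve (X j))ᶜ = K0.L k ^ 2 :=
  (congrArg (P2 k).cl (compl_compl _)).trans (cl_U j)

lemma cl_compl_curve {F : MvPolynomial (Fin 3) k} :
    (P2 k).cl (curve F)ᶜ = (P2 k).cl Set.univ - (P2 k).cl (curve F) := by
  rw [(P2 k).cl_diff_add isOpen_univ.isLocallyClosed (isClosed_curve F), Set.univ_inter,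
    ← Set.compl_eq_univ_sdiff, add_sub_cancel_right]

lemma cl_curve_X_two : (P2 k).cl (curve (X 2)) = K0.L k + 1 := by
  rw [(P2 k).cl_diff_add (isClosed_curve (X 2)).isLocallyClosed (isClosed_curve (X 1)),
    Set.inter_comm, cl_curve_X_inter_curve_X, cl_curve_X_inter (by decide)]

lemma cl_univ : (P2 k).cl Set.univ = K0.L k ^ 2 + (K0.L k + 1) := by
  rw [← cl_compl_curve_X 2, cl_compl_curve, cl_curve_X_two, sub_add_cancel]

/-- A parabola in the chart `Z ≠ 0` together with the single point `(0 : 1 : 0)` at infinity. -/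
lemma cl_curve_conic : (P2 k).cl (curve (conic k)) = K0.L k + 1 := by
  rw [(P2 k).cl_diff_add (isClosed_curve (conic k)).isLocallyClosed (isClosed_curve (X 2)),
    cl_curve_inter isHomogeneous_conic 2 0 (Polynomial.X ^ 2) (by rw [ker_graphHom_X_sq, dehom_conic_two])]
  congr 1
  refine cl_point 1 (i := 0) (l := 2) rfl rfl fun x => ?_
  refine ⟨fun h => ?_, fun h => ⟨mem_curve.2 ?_, mem_curve.2 h.2.2⟩⟩
  · have h2 := mem_curve.1 h.2
    have h0 := X_zero_mem_hid (mem_curve.1 h.1) h2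
    refine ⟨mem_U_of_forall fun i hi => ?_, h0, h2⟩
    fin_cases i
    exacts [h0, absurd rfl hi, h2]
  · exact sub_mem (Ideal.mul_mem_left _ _ h.2.2) (Ideal.pow_mem_of_mem _ h.2.1 2 two_pos)

lemma cl_compl_curve_conic : (P2 k).cl (curve (conic k))ᶜ = K0.L k ^ 2 := by
  rw [cl_compl_curve, cl_univ, cl_curve_conic, add_sub_cancel_right]

lemma cl_compl_curve_X_inter :
    (P2 k).cl ((curve (X 2))ᶜ ∩ (curve (X 1))ᶜ) = K0.L k ^ 2 - K0.L k := by
  rw [eq_sub_iff_add_eq, ← cl_compl_curve_X 2, (P2 k).cl_diff_add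
    (isClosed_curve (X 2)).isOpen_compl.isLocallyClosed (isClosed_curve (X 1)), Set.sdiff_eq]
  congr 1
  rw [Set.inter_comm, ← Set.sdiff_eq, cl_curve_X_inter (by decide)]

end P2

end MotivicPV
end

open CategoryTheory AlgebraicGeometry
noncomputable section
namespace MotivicPV
open MvPolynomial

/-! ### Evaluation of the principal value integrals -/

section Ring

variable (k : Type u) [Field k] (d : ℕ) [NeZero d]

lemma ringR.ofK0_one : ringR.ofK0 k d 1 = 1 := Subtype.ext (map_one _)

lemma K0Root.Lpow_add (i j : ℤ) :
    K0Root.Lpow k d (i + j) = K0Root.Lpow k d i * K0Root.Lpow k d j := by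
  rw [Lpow, Lpow, Lpow, ← Units.val_mul, ← zpow_add]
  congr 2
  ring

lemma K0Loc.Lpow_add (i j : ℤ) : K0Loc.Lpow k d (i + j) = K0Loc.Lpow k d i * K0Loc.Lpow k d j := by
  rw [Lpow, Lpow, Lpow, K0Root.Lpow_add, map_mul]

lemma K0Loc.Lpow_zero : K0Loc.Lpow k d 0 = 1 := by
  rw [Lpow, K0Root.Lpow, neg_zero, zpow_zero, Units.val_one, map_one]

lemma K0Loc.frac_mul {i : ℤ} (hi : i ≠ 0) :
    K0Loc.frac k i hi * (K0Loc.Lpow k d i - 1) = K0Loc.ofK0 k d (K0.L k) - 1 := by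
  have h := IsLocalization.mk'_spec (K0Loc k d) (algebraMap (K0 k) (K0Root k d) (K0.L k) - 1)
    (⟨K0Root.Lpow k d i - 1, Submonoid.subset_closure ⟨i, hi, rfl⟩⟩ :
      Submonoid.closure {z : K0Root k d | ∃ i : ℤ, i ≠ 0 ∧ z = K0Root.Lpow k d i - 1})
  rw [map_sub, map_one, map_sub, map_one] at h
  exact h

lemma K0Loc.isUnit_Lpow_sub_one {i : ℤ} (hi : i ≠ 0) : IsUnit (K0Loc.Lpow k d i - 1) := by
  have h := IsLocalization.map_units (K0Loc k d)
    (⟨K0Root.Lpow k d i - 1, Submonoid.subset_closure ⟨i, hi, rfl⟩⟩ :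
      Submonoid.closure {z : K0Root k d | ∃ i : ℤ, i ≠ 0 ∧ z = K0Root.Lpow k d i - 1})
  rw [map_sub, map_one] at h
  exact h

lemma K0Loc.ofK0_L_two : K0Loc.ofK0 k 2 (K0.L k) = K0Loc.Lpow k 2 1 ^ 2 := by
  rw [← K0Loc.Lpow_self, pow_two, ← K0Loc.Lpow_add]
  rfl

/-- With `l = L^{1/2}` one has `l² - 1 = (l - 1)(l + 1)` and `l⁻¹ - 1 = -l⁻¹(l - 1)`. -/
lemma K0Loc.frac_neg_one : K0Loc.frac (d := 2) k (-1) (by decide) =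
    -(K0Loc.Lpow k 2 1 * (K0Loc.Lpow k 2 1 + 1)) := by
  have h := K0Loc.isUnit_Lpow_sub_one k 2 (i := -1) (by decide)
  refine h.mul_right_cancel ?_
  rw [K0Loc.frac_mul, ofK0_L_two]
  have h1 : K0Loc.Lpow k 2 1 * K0Loc.Lpow k 2 (-1) = 1 := by
    rw [← K0Loc.Lpow_add, ← K0Loc.Lpow_zero k 2]; rfl
  linear_combination (K0Loc.Lpow k 2 1 + 1) * h1

lemma ringR.frac_neg_one : (ringR.frac k 2 (-1) : K0Loc k 2) =
    -(K0Loc.Lpow k 2 1 * (K0Loc.Lpow k 2 1 + 1)) := by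
  rw [← K0Loc.frac_neg_one, ringR.frac, dif_pos (by decide)]

variable {k} in
lemma ringR.add_add_eq (w x y z c : ringR k 2) (hz : z = 1) :
    w * (x + y * c + (y * c + z * c * c)) = w * (x + 2 * y * c + c ^ 2) := by
  subst hz
  refine Subtype.ext ?_
  change (w : K0Loc k 2) * (x + y * c + (y * c + 1 * c * c)) = w * (x + 2 * y * c + c ^ 2)
  ring

/-- With `l = L^{1/2}` this is `l⁴ - l² - 2l³(l + 1) + l²(l + 1)² = 0`. -/
lemma ringR.lines_eq_zero :
    ringR.ofK0 k 2 (K0.L k ^ 2 - K0.L k) + 2 * ringR.ofK0 k 2 (K0.L k) * ringR.frac k 2 (-1) +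
      ringR.frac k 2 (-1) ^ 2 = 0 := by
  refine Subtype.ext ?_
  change K0Loc.ofK0 k 2 (K0.L k ^ 2 - K0.L k) +
    2 * K0Loc.ofK0 k 2 (K0.L k) * (ringR.frac k 2 (-1) : K0Loc k 2) +
      (ringR.frac k 2 (-1) : K0Loc k 2) ^ 2 = 0
  rw [map_sub, map_pow, frac_neg_one, K0Loc.ofK0_L_two]
  ring

/-- With `l = L^{1/2}`, the bracket is `l⁴ - (l² + 1) l (l + 1) = -l(l² + l + 1)`, and the factor in
front is `l⁻⁴`. -/
lemma ringR.conic_eq : ((ringR.Linv k 2 ^ 2 * (ringR.ofK0 k 2 (K0.L k ^ 2) +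
      ringR.ofK0 k 2 (K0.L k + 1) * ringR.frac k 2 (-1)) : ringR k 2) : K0Loc k 2) =
    -(K0Loc.Lpow k 2 (-3) * (K0Loc.Lpow k 2 2 + K0Loc.Lpow k 2 1 + 1)) := by
  change K0Loc.Lpow k 2 (-(2 : ℕ)) ^ 2 * (K0Loc.ofK0 k 2 (K0.L k ^ 2) +
    K0Loc.ofK0 k 2 (K0.L k + 1) * (ringR.frac k 2 (-1) : K0Loc k 2)) = _
  have h1 : K0Loc.Lpow k 2 (-(2 : ℕ)) = K0Loc.Lpow k 2 (-1) * K0Loc.Lpow k 2 (-1) := by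
    rw [← K0Loc.Lpow_add]; rfl
  have h2 : K0Loc.Lpow k 2 2 = K0Loc.Lpow k 2 1 * K0Loc.Lpow k 2 1 := by
    rw [← K0Loc.Lpow_add]; rfl
  have h3 : K0Loc.Lpow k 2 (-3) = K0Loc.Lpow k 2 (-1) * K0Loc.Lpow k 2 (-1) * K0Loc.Lpow k 2 (-1) := by
    rw [← K0Loc.Lpow_add, ← K0Loc.Lpow_add]; rfl
  have h4 : K0Loc.Lpow k 2 (-1) * K0Loc.Lpow k 2 1 = 1 := by
    rw [← K0Loc.Lpow_add, ← K0Loc.Lpow_zero k 2]; rfl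
  rw [map_pow, map_add, map_one, frac_neg_one, K0Loc.ofK0_L_two, h1, h2, h3]
  linear_combination (-(K0Loc.Lpow k 2 (-1)) ^ 3 * (K0Loc.Lpow k 2 1 ^ 2 + K0Loc.Lpow k 2 1 + 1)) * h4

end Ring

section PV

lemma sum_powerset_singleton_mul_prod {α R : Type*} [CommRing R] (a : α) (f : Finset α → R)
    (c : R) : ∑ I ∈ ({a} : Finset α).powerset, f I * ∏ _ξ ∈ I, c = f ∅ + f {a} * c := by
  classical
  have h := Finset.sum_powerset_insert (Finset.notMem_empty a) fun I => f I * ∏ _ξ ∈ I, c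
  rw [Finset.powerset_empty, Finset.sum_singleton, Finset.sum_singleton,
    show insert a ∅ = ({a} : Finset α) from rfl] at h
  simpa using h

lemma sum_powerset_pair_mul_prod {α R : Type*} [DecidableEq α] [CommRing R] {a b : α}
    (h : a ≠ b) (f : Finset α → R) (c : R) :
    ∑ I ∈ ({a, b} : Finset α).powerset, f I * ∏ _ξ ∈ I, c =
      f ∅ + f {b} * c + (f {a} * c + f {a, b} * c * c) := by
  have hb : a ∉ ({b} : Finset α) := by simpa using h
  rw [Finset.sum_powerset_insert hb, sum_powerset_singleton_mul_prod]
  congr 1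
  have h1 := sum_powerset_singleton_mul_prod b (fun I => f (insert a I)) c
  have h2 : ∑ I ∈ ({b} : Finset α).powerset, f (insert a I) * ∏ _ξ ∈ insert a I, c =
      ∑ I ∈ ({b} : Finset α).powerset, f (insert a I) * (∏ _ξ ∈ I, c) * c := by
    refine Finset.sum_congr rfl fun I hI => ?_
    rw [Finset.prod_insert fun h => hb (Finset.mem_powerset.1 hI h), mul_comm c, mul_assoc]
  rw [h2, ← Finset.sum_mul, h1, add_mul]
  rfl

variable {k : Type u} [Field k] {V : Variety k} [IsIntegral V.X] {n d : ℕ} [NeZero d]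
  {ω : MultiForm k V.FF n d} {ξ η : V.X} {C D : Set V.X} {a : ℤ}

/-- In both examples all components have the same multiplicity, so every factor of the product is
the same. -/
lemma PV_eq_sum (S : Finset V.X) (hS : components ω = S) (h : ∀ ξ ∈ S, ordForm ω ξ + d = a) :
    PV ω = ringR.Linv k d ^ n * ∑ I ∈ S.powerset,
      ringR.ofK0 k d (V.cl (stratum ω I)) * ∏ _ξ ∈ I, ringR.frac k d a := by
  have hf : (components ω).Finite := hS ▸ S.finite_toSet
  have hS' : hf.toFinset = S := Finset.coe_injective (by rw [Set.Finite.coe_toFinset, hS])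
  rw [PV, dif_pos hf, hS']
  refine congrArg _ (Finset.sum_congr rfl fun I hI => ?_)
  rw [Finset.prod_congr rfl fun ξ hξ => show _ = ringR.frac k d a by
    rw [h ξ (Finset.mem_powerset.1 hI hξ)]]

lemma PV_of_components_eq_singleton (hc : components ω = {ξ}) (hC : closure {ξ} = C)
    (h : ordForm ω ξ + d = a) :
    PV ω = ringR.Linv k d ^ n *
      (ringR.ofK0 k d (V.cl Cᶜ) + ringR.ofK0 k d (V.cl C) * ringR.frac k d a) := by
  classical
  have h1 : stratum ω ∅ = Cᶜ := by
    rw [stratum, hc, ← hC]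
    simp [Set.compl_eq_univ_sdiff]
  have h2 : stratum ω {ξ} = C := by
    rw [stratum, hc, ← hC]
    simp
  rw [PV_eq_sum {ξ} (by rw [hc, Finset.coe_singleton])
    (fun ξ hξ => by rw [Finset.mem_singleton.1 hξ, h]), sum_powerset_singleton_mul_prod, h1, h2]

lemma PV_of_components_eq_pair (hne : ξ ≠ η) (hc : components ω = {ξ, η})
    (hC : closure {ξ} = C) (hD : closure {η} = D)
    (h : ordForm ω ξ + d = a) (h' : ordForm ω η + d = a) :
    PV ω = ringR.Linv k d ^ n *
      (ringR.ofK0 k d (V.cl (Dᶜ ∩ Cᶜ)) + ringR.ofK0 k d (V.cl (D \ C)) * ringR.frac k d a +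
      (ringR.ofK0 k d (V.cl (C \ D)) * ringR.frac k d a +
        ringR.ofK0 k d (V.cl (C ∩ D)) * ringR.frac k d a * ringR.frac k d a)) := by
  classical
  have h0 : stratum ω ∅ = Dᶜ ∩ Cᶜ := by
    rw [stratum, hc, ← hC, ← hD]
    ext; simp; tauto
  have h1 : stratum ω {ξ} = C \ D := by
    rw [stratum, hc, ← hC, ← hD]
    ext; simp [hne.symm]
  have h2 : stratum ω {η} = D \ C := by
    rw [stratum, hc, ← hC, ← hD]
    ext; simp [hne]
  have h3 : stratum ω {ξ, η} = C ∩ D := by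
    rw [stratum, hc, ← hC, ← hD]
    ext; simp
  have hS : ∀ x ∈ ({ξ, η} : Finset V.X), ordForm ω x + d = a := by
    intro x hx
    rw [Finset.mem_insert, Finset.mem_singleton] at hx
    rcases hx with hx | hx <;> rwa [hx]
  have hc' : components ω = ↑({ξ, η} : Finset V.X) := by rw [hc, Finset.coe_pair]
  have hP := PV_eq_sum {ξ, η} hc' hS
  rw [sum_powerset_pair_mul_prod hne, h0, h1, h2, h3] at hP
  exact hP

end PV

namespace P2

variable {k : Type u} [Field k]

lemma ordForm_quadForm_conic :
    ordForm (V := P2 k) (quadForm (conic k)) (ptConic k) = -3 := by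
  have h : ordPoly (conic k) (ptConic k) = 1 :=
    (ordPoly_eq isHomogeneous_conic prime_conic ⟨0, not_conic_dvd_X 0⟩ _).trans (if_pos rfl)
  exact (ordForm_quadForm isHomogeneous_conic prime_conic.ne_zero _).trans (by rw [h]; rfl)

open Classical in
lemma ordPoly_X (i j : Fin 3) : ordPoly (X i) (ptX k j) = if ptX k j = ptX k i then 1 else 0 :=
  ordPoly_eq ..

lemma ordForm_quadForm_X_mul_X {i : Fin 3} (hi : i = 1 ∨ i = 2) :
    ordForm (V := P2 k) (quadForm (X 1 * X 2)) (ptX k i) = -3 := by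
  refine (ordForm_quadForm (isHomogeneous_X_mul_X 1 2)
    (mul_ne_zero (X_ne_zero 1) (X_ne_zero 2)) _).trans ?_
  rw [ordPoly_mul (isHomogeneous_X k 1) (X_ne_zero 1) (isHomogeneous_X k 2) (X_ne_zero 2),
    ordPoly_X, ordPoly_X]
  obtain rfl | rfl := hi
  · rw [if_pos rfl, if_neg ptX_ne]; rfl
  · rw [if_pos rfl, if_neg ptX_ne.symm]; rfl

lemma mem_components_of_ordForm {ω : MultiForm k (P2 k).FF 2 2} {x : P2Scheme k}
    (h : ordForm ω x = -3) : x ∈ components ω := by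
  change (ordForm ω x : ℚ) / (2 : ℕ) ≠ 0
  rw [h]
  norm_num

lemma components_conic : components (V := P2 k) (quadForm (conic k)) = {ptConic k} :=
  Set.ext fun _ => ⟨eq_ptConic, fun h => h ▸ mem_components_of_ordForm ordForm_quadForm_conic⟩

lemma components_lines :
    components (V := P2 k) (quadForm (X 1 * X 2)) = {ptX k 1, ptX k 2} := by
  refine Set.ext fun x => ⟨eq_ptX, ?_⟩
  rintro (rfl | rfl)
  exacts [mem_components_of_ordForm (ordForm_quadForm_X_mul_X (.inl rfl)),
    mem_components_of_ordForm (ordForm_quadForm_X_mul_X (.inr rfl))]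

lemma closure_ptX (i : Fin 3) : closure {ptX k i} = curve (X i) := closure_pt ..

lemma closure_ptConic : closure {ptConic k} = curve (conic k) := closure_pt ..

lemma PV_conic : PV (V := P2 k) (quadForm (conic k)) = ringR.Linv k 2 ^ 2 *
    (ringR.ofK0 k 2 (K0.L k ^ 2) + ringR.ofK0 k 2 (K0.L k + 1) * ringR.frac k 2 (-1)) := by
  -- The order is `-3` and `d = 2`, so `d α = -3 + 2 = -1`.
  refine (PV_of_components_eq_singleton (a := -1) components_conic closure_ptConic
    (by rw [ordForm_quadForm_conic]; rfl)).trans ?_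
  rw [cl_compl_curve_conic, cl_curve_conic]

lemma PV_lines : PV (V := P2 k) (quadForm (X 1 * X 2)) = ringR.Linv k 2 ^ 2 *
      (ringR.ofK0 k 2 (K0.L k ^ 2 - K0.L k) + 2 * ringR.ofK0 k 2 (K0.L k) * ringR.frac k 2 (-1) +
        ringR.frac k 2 (-1) ^ 2) := by
  have h := PV_of_components_eq_pair (a := -1) ptX_ne components_lines (closure_ptX (k := k) 1)
    (closure_ptX 2) (by rw [ordForm_quadForm_X_mul_X (.inl rfl)]; rfl)
    (by rw [ordForm_quadForm_X_mul_X (.inr rfl)]; rfl)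
  have h0 := cl_compl_curve_X_inter (k := k)
  have h1 : (P2 k).cl (curve (X 1) \ curve (X 2)) = K0.L k := cl_curve_X_inter (by decide)
  have h2 : (P2 k).cl (curve (X 2) \ curve (X 1)) = K0.L k := cl_curve_X_inter (by decide)
  have h3 := cl_curve_X_inter_curve_X (k := k)
  rw [h0, h1, h2, h3] at h
  exact h.trans (ringR.add_add_eq _ _ _ _ _ (ringR.ofK0_one k 2))

lemma PV_lines_eq_zero : PV (V := P2 k) (quadForm (X 1 * X 2)) = 0 := by
  rw [PV_lines, ringR.lines_eq_zero, mul_zero]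

lemma PV_conic_eq : (PV (V := P2 k) (quadForm (conic k)) : K0Loc k 2) =
    -(K0Loc.Lpow k 2 (-3) * (K0Loc.Lpow k 2 2 + K0Loc.Lpow k 2 1 + 1)) := by
  rw [PV_conic, ringR.conic_eq]

lemma PV_conic_ne_zero : PV (V := P2 k) (quadForm (conic k)) ≠ 0 := by
  intro h
  have h1 := PV_conic_eq (k := k)
  rw [h] at h1
  exact K0Loc.Lpow_mul_ne_zero k (neg_eq_zero.1 h1.symm)

end P2

end MotivicPV
end

open CategoryTheory AlgebraicGeometry
noncomputable section
namespace MotivicPV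
open MvPolynomial

/-! ### The birational map -/

section PartialIso

variable {X Y S T : Scheme.{u}} [IsIntegral X] [IsIntegral Y] [Nonempty S] [Nonempty T]
  (c : S ⟶ X) (c' : T ⟶ Y) [IsOpenImmersion c] [IsOpenImmersion c'] (s : S ≅ T)

lemma dense_opensRange : Dense (c.opensRange : Set X) :=
  c.opensRange.isOpen.dense ⟨_, (Nonempty.some inferInstance : S), rfl⟩

/-- An isomorphism between charts of integral schemes, as a partial isomorphism. -/
def partialIsoOfCharts : Scheme.PartialIso X Y where
  source := c.opensRange
  dense_source := dense_opensRange c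
  target := c'.opensRange
  dense_target := dense_opensRange c'
  iso := c.isoOpensRange.symm ≪≫ s ≪≫ c'.isoOpensRange

lemma partialIsoOfCharts_hom_ι :
    (partialIsoOfCharts c c' s).iso.hom ≫ (partialIsoOfCharts c c' s).target.ι =
      c.isoOpensRange.inv ≫ s.hom ≫ c' := by
  change (c.isoOpensRange.inv ≫ s.hom ≫ c'.isoOpensRange.hom) ≫ c'.opensRange.ι = _
  rw [Category.assoc, Category.assoc, Scheme.Hom.isoOpensRange_hom_ι]

lemma isOver_partialIsoOfCharts {B : Scheme.{u}} {sX : X ⟶ B} {sY : Y ⟶ B}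
    (h : s.hom ≫ c' ≫ sY = c ≫ sX) : (partialIsoOfCharts c c' s).IsOver sX sY := by
  change _ = c.opensRange.ι ≫ sX
  refine (Category.assoc _ _ _).symm.trans ((congrArg (fun f => f ≫ sY)
    (partialIsoOfCharts_hom_ι c c' s)).trans ?_)
  rw [← Scheme.Hom.isoOpensRange_inv_comp]
  exact (Category.assoc _ _ _).trans ((congrArg (fun f => c.isoOpensRange.inv ≫ f)
    ((Category.assoc _ _ _).trans h)).trans (Category.assoc _ _ _).symm)

/-- The generic point of `X` lies in the dense chart, so the rational map can be evaluated there
through the isomorphism of charts. -/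
lemma fromFunctionField_partialIsoOfCharts (l : Spec X.functionField ⟶ S)
    (hl : l ≫ c = X.fromSpecStalk (genericPoint X)) :
    (partialIsoOfCharts c c' s).toRationalMap.fromFunctionField = l ≫ s.hom ≫ c' := by
  have hη : genericPoint X ∈ c.opensRange :=
    (genericPoint_specializes _).mem_open c.opensRange.isOpen
      (dense_opensRange c).nonempty.choose_spec
  have h1 : c.opensRange.fromSpecStalkOfMem (genericPoint X) hη = l ≫ c.isoOpensRange.hom := by
    rw [← cancel_mono c.opensRange.ι, Scheme.Opens.fromSpecStalkOfMem_ι, Category.assoc,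
      Scheme.Hom.isoOpensRange_hom_ι, hl]
  refine (congrArg (fun f => c.opensRange.fromSpecStalkOfMem (genericPoint X) hη ≫ f)
    (partialIsoOfCharts_hom_ι c c' s)).trans ?_
  rw [h1, Category.assoc, Iso.hom_inv_id_assoc]

end PartialIso

namespace P2

variable {k : Type u} [Field k]

lemma fromSpecStalk_genericPoint (j : Fin 3) :
    Spec.map (CommRingCat.ofHom (S := (P2Scheme k).functionField) (toFF j).toRingHom) ≫ chart k j =
      (P2Scheme k).fromSpecStalk (genericPoint (P2Scheme k)) := by
  have h := Scheme.Opens.fromSpecStalkOfMem_toSpecΓ (U k j) (genericPoint (P2Scheme k))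
    (genericPoint_mem_basicOpen k j)
  have h1 : (U k j).fromSpecStalkOfMem (genericPoint (P2Scheme k))
      (genericPoint_mem_basicOpen k j) ≫ Proj.basicOpenToSpec (Gr k) (X j) =
      Spec.map (CommRingCat.ofHom (S := (P2Scheme k).functionField) (toFF j).toRingHom) ≫
        Spec.map (CommRingCat.ofHom (awEquiv j).toRingHom) := by
    rw [Proj.basicOpenToSpec, reassoc_of% h, ← Spec.map_comp, ← Spec.map_comp]
    congr 1
    ext f
    have h2 : sec j (awEquiv j f) = Proj.awayToSection (Gr k) (X j) f := by
      rw [sec, RingEquiv.trans_apply, RingEquiv.symm_apply_apply]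
      change (Proj.basicOpenIsoAway (Gr k) (X j) (X_mem j) zero_lt_one).hom _ = _
      rw [Proj.basicOpenIsoAway_hom]
    exact congrArg ((P2Scheme k).presheaf.germ (U k j) (genericPoint (P2Scheme k))
      (genericPoint_mem_basicOpen k j)) h2.symm
  rw [chart, ← reassoc_of% h1, ← Scheme.Opens.fromSpecStalkOfMem_ι (U k j) _
    (genericPoint_mem_basicOpen k j), Proj.awayι, ← Proj.basicOpenIsoSpec_hom (Gr k) (X j) (X_mem j)
    zero_lt_one, Iso.hom_inv_id_assoc]

/-- The automorphism of the function field induced by an automorphism of the affine plane. -/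
def ffEquiv (e : MvPolynomial (Fin 2) k ≃ₐ[k] MvPolynomial (Fin 2) k) : (P2 k).FF ≃ₐ[k] (P2 k).FF :=
  letI := (toFF (k := k) 2).toAlgebra
  haveI : IsScalarTower k (MvPolynomial (Fin 2) k) (P2 k).FF :=
    .of_algebraMap_eq fun c => ((toFF 2).commutes c).symm
  haveI : IsFractionRing (MvPolynomial (Fin 2) k) (P2 k).FF := isFractionRing_toFF 2
  IsFractionRing.algEquivOfAlgEquiv e

lemma ffEquiv_toFF (e : MvPolynomial (Fin 2) k ≃ₐ[k] MvPolynomial (Fin 2) k)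
    (f : MvPolynomial (Fin 2) k) : ffEquiv e (toFF 2 f) = toFF 2 (e f) :=
  letI := (toFF (k := k) 2).toAlgebra
  haveI : IsScalarTower k (MvPolynomial (Fin 2) k) (P2 k).FF :=
    .of_algebraMap_eq fun c => ((toFF 2).commutes c).symm
  haveI : IsFractionRing (MvPolynomial (Fin 2) k) (P2 k).FF := isFractionRing_toFF 2
  IsFractionRing.algEquivOfAlgEquiv_algebraMap e f

/-- The chart `Z ≠ 0` is dense, so an automorphism of the affine plane is a partial isomorphism of
the projective plane; on functions it acts through `e`. -/
lemma exists_isBirationalMap (e : MvPolynomial (Fin 2) k ≃ₐ[k] MvPolynomial (Fin 2) k) :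
    ∃ π : (P2 k).X ⤏ (P2 k).X, IsBirationalMap (P2 k) (P2 k) π ∧
      IsComorphism (P2 k) (P2 k) π (ffEquiv e).toAlgHom := by
  let s : Spec (.of (MvPolynomial (Fin 2) k)) ≅ Spec (.of (MvPolynomial (Fin 2) k)) :=
    Scheme.Spec.mapIso e.toRingEquiv.toCommRingCatIso.op
  have hs : s.hom = Spec.map (CommRingCat.ofHom e.toAlgHom.toRingHom) := rfl
  have : Nonempty (Spec (.of (MvPolynomial (Fin 2) k))) :=
    inferInstanceAs (Nonempty (PrimeSpectrum (MvPolynomial (Fin 2) k)))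
  let f : Scheme.PartialIso (P2Scheme k) (P2Scheme k) :=
    partialIsoOfCharts (chart k 2) (chart k 2) s
  have hf : f.IsOver (P2Hom k) (P2Hom k) := isOver_partialIsoOfCharts _ _ _ (by
    rw [chart_str, hs]
    exact FiniteModel.specMap_specStr e.toAlgHom)
  refine ⟨f.toRationalMap, ⟨f, hf, rfl⟩, ?_⟩
  · refine (fromFunctionField_partialIsoOfCharts (X := P2Scheme k) (Y := P2Scheme k) _ _ s _
      (fromSpecStalk_genericPoint 2)).trans ?_
    refine Eq.trans ?_ (congrArg (fun f => _ ≫ f) (fromSpecStalk_genericPoint 2))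
    have h : Spec.map (CommRingCat.ofHom (S := (P2Scheme k).functionField) (toFF 2).toRingHom) ≫
        s.hom = Spec.map (CommRingCat.ofHom (R := (P2Scheme k).functionField)
          (S := (P2Scheme k).functionField) (ffEquiv e).toAlgHom.toRingHom) ≫
        Spec.map (CommRingCat.ofHom (S := (P2Scheme k).functionField) (toFF 2).toRingHom) :=
      (Spec.map_comp _ _).symm.trans ((congrArg Spec.map (CommRingCat.hom_ext
        (RingHom.ext fun f => (ffEquiv_toFF e f).symm))).trans (Spec.map_comp _ _))
    exact (Category.assoc _ _ _).symm.trans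
      ((congrArg (fun f => f ≫ chart k 2) h).trans (Category.assoc _ _ _))

variable (k) in
/-- The automorphism `(x, y) ↦ (x, y - x²)` of the affine plane. -/
def shear : MvPolynomial (Fin 2) k ≃ₐ[k] MvPolynomial (Fin 2) k :=
  AlgEquiv.ofAlgHom (aeval ![X 0, X 1 - X 0 ^ 2]) (aeval ![X 0, X 1 + X 0 ^ 2])
    (algHom_ext fun i => by fin_cases i <;> simp) (algHom_ext fun i => by fin_cases i <;> simp)

lemma toFF_two_X_zero : toFF 2 (X 0) = x k := toFF_X 2 0

lemma toFF_two_X_one : toFF 2 (X 1) = y k := toFF_X 2 1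

lemma ffEquiv_shear_x : ffEquiv (shear k) (x k) = x k := by
  rw [← toFF_two_X_zero, ffEquiv_toFF]
  congr 1
  simp [shear]

lemma ffEquiv_shear_y : ffEquiv (shear k) (y k) = y k - x k ^ 2 := by
  rw [← toFF_two_X_zero, ← toFF_two_X_one, ffEquiv_toFF, ← map_pow, ← map_sub]
  congr 1
  simp [shear]

/-- The Jacobian matrix of the shear is unipotent. -/
lemma wedgePow_shear : wedgePow k (fun _ : Fin 2 => ![x k, y k - x k ^ 2]) =
    wedgePow k fun _ : Fin 2 => ![x k, y k] := by
  have h (j : Fin 2) : (toFFBasis k 2).det (fun i => KaehlerDifferential.D k (P2 k).FF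
      (![x k, y k - x k ^ 2] i)) = 1 := by
    refine (det_fin_two_of_eq (p := 1) (q := 0) (r := -(2 * x k)) (s := 1)
      (toFFBasis k 2) ?_ ?_).trans (by ring)
    · rw [toFFBasis_apply, toFF_two_X_zero, one_smul, zero_smul, add_zero]
      rfl
    · rw [toFFBasis_apply, toFFBasis_apply, toFF_two_X_zero, toFF_two_X_one]
      change KaehlerDifferential.D k (P2 k).FF (y k - x k ^ 2) = _
      rw [map_sub, Derivation.leibniz_pow]
      simp [two_smul, neg_smul, mul_smul]
      abel
  rw [wedgePow_eq_smul _ (toFFBasis k 2) (toFFBasis_apply 2), Finset.prod_congr rfl fun j _ => h j,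
    Finset.prod_const_one, one_smul]
  congr 2
  funext _ i
  fin_cases i
  exacts [toFF_two_X_zero (k := k), toFF_two_X_one (k := k)]

lemma pullback_biform (φ : (P2 k).FF →ₐ[k] (P2 k).FF) (f a b : (P2 k).FF) :
    MultiForm.pullback φ (biform f a b) = biform (φ f) (φ a) (φ b) := by
  rw [biform, map_smulₛₗ, MultiForm.pullback_wedgePow, biform]
  congr 3
  funext _ i
  fin_cases i <;> rfl

lemma pullback_shear_omega : MultiForm.pullback (ffEquiv (shear k)).toAlgHom (omega k) =
    quadForm (conic k) := by
  rw [omega, pullback_biform, quadForm_conic, biform, biform]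
  have h1 : (ffEquiv (shear k)).toAlgHom (x k) = x k := ffEquiv_shear_x
  have h2 : (ffEquiv (shear k)).toAlgHom (y k) = y k - x k ^ 2 := ffEquiv_shear_y
  rw [map_zpow₀, h1, h2, wedgePow_shear]

lemma pullback_refl_omega :
    MultiForm.pullback (AlgEquiv.refl : (P2 k).FF ≃ₐ[k] (P2 k).FF).toAlgHom (omega k) = omega k := by
  rw [omega, pullback_biform]
  rfl

/-- Both models are the plane itself, with function fields identified by the identity and by the
shear; the integrals are zero and nonzero. -/
lemma not_pvIsBirationalInvariant : ¬ PVIsBirationalInvariant (P2 k) 2 := by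
  intro h
  have h0 : omega k ≠ 0 := by
    rw [omega_eq]
    exact quadForm_ne_zero (isHomogeneous_X_mul_X 1 2) (mul_ne_zero (X_ne_zero 1) (X_ne_zero 2))
  have : IsProper (P2 k).str := inferInstanceAs (IsProper (P2Hom k))
  have : SmoothOfRelativeDimension 2 (P2 k).str :=
    inferInstanceAs (SmoothOfRelativeDimension 2 (P2Hom k))
  have h1 := h 2 (omega k) h0 (P2 k) (P2 k) AlgEquiv.refl (ffEquiv (shear k))
  rw [pullback_refl_omega, pullback_shear_omega, omega_eq] at h1
  have h2 := h1 isNormalCrossings_lines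
    (noLogPoles_quadForm (isHomogeneous_X_mul_X 1 2) (mul_ne_zero (X_ne_zero 1) (X_ne_zero 2)))
    isNormalCrossings_conic (noLogPoles_quadForm isHomogeneous_conic prime_conic.ne_zero)
  rw [PV_lines_eq_zero] at h2
  exact PV_conic_ne_zero h2.symm

end P2

end MotivicPV
end

/-! ### The main theorem -/

theorem mainTheorem3 {k : Type u} [Field k] [CharZero k] :
    -- the projective plane is a smooth complete surface of Kodaira dimension `-∞`
    IsProper (P2 k).str ∧ SmoothOfRelativeDimension 2 (P2 k).str ∧
    KodairaDimNegInfty (P2 k) 2 ∧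
    -- the form `ω` on the first model
    P2.omega k ≠ 0 ∧
    P2.omega k = P2.biform ((P2.ratio k 1 0 * P2.ratio k 2 0) ^ (-3 : ℤ))
      (P2.ratio k 1 0) (P2.ratio k 2 0) ∧
    IsPrimeDivisor (P2.curve (X 1 : MvPolynomial (Fin 3) k)) ∧
    IsPrimeDivisor (P2.curve (X 2 : MvPolynomial (Fin 3) k)) ∧
    divForm (P2.omega k) =
      (-3 / 2 : ℚ) • primeDiv (P2.curve (X 1)) + (-3 / 2 : ℚ) • primeDiv (P2.curve (X 2)) ∧
    IsNormalCrossings 2 (divForm (P2.omega k)) ∧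
    NoLogPoles (P2.omega k) ∧
    PV (P2.omega k) = ringR.Linv k 2 ^ 2 *
      (ringR.ofK0 k 2 (K0.L k ^ 2 - K0.L k) + 2 * ringR.ofK0 k 2 (K0.L k) * ringR.frac k 2 (-1) +
        ringR.frac k 2 (-1) ^ 2) ∧
    PV (P2.omega k) = 0 ∧
    -- the second model, through the birational map `π` given by `(x, y) ↦ (x, y - x²)`
    (∃ (π : (P2 k).X ⤏ (P2 k).X) (φ : (P2 k).FF ≃ₐ[k] (P2 k).FF),
      IsBirationalMap (P2 k) (P2 k) π ∧ IsComorphism (P2 k) (P2 k) π φ.toAlgHom ∧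
      φ (P2.x k) = P2.x k ∧ φ (P2.y k) = P2.y k - P2.x k ^ 2 ∧
      MultiForm.pullback φ.toAlgHom (P2.omega k) =
        P2.biform ((P2.y k - P2.x k ^ 2) ^ (-3 : ℤ)) (P2.x k) (P2.y k) ∧
      MultiForm.pullback φ.toAlgHom (P2.omega k) =
        P2.biform ((P2.ratio k 1 0 * P2.ratio k 2 0 - 1) ^ (-3 : ℤ))
          (P2.ratio k 1 0) (P2.ratio k 2 0) ∧
      IsPrimeDivisor (P2.curve (X 1 * X 2 - X 0 ^ 2 : MvPolynomial (Fin 3) k)) ∧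
      divForm (MultiForm.pullback φ.toAlgHom (P2.omega k)) =
        (-3 / 2 : ℚ) • primeDiv (P2.curve (X 1 * X 2 - X 0 ^ 2)) ∧
      IsNormalCrossings 2 (divForm (MultiForm.pullback φ.toAlgHom (P2.omega k))) ∧
      NoLogPoles (MultiForm.pullback φ.toAlgHom (P2.omega k)) ∧
      PV (MultiForm.pullback φ.toAlgHom (P2.omega k)) = ringR.Linv k 2 ^ 2 *
        (ringR.ofK0 k 2 (K0.L k ^ 2) + ringR.ofK0 k 2 (K0.L k + 1) * ringR.frac k 2 (-1)) ∧
      (PV (MultiForm.pullback φ.toAlgHom (P2.omega k)) : K0Loc k 2) =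
        -(K0Loc.Lpow k 2 (-3) * (K0Loc.Lpow k 2 2 + K0Loc.Lpow k 2 1 + 1)) ∧
      PV (MultiForm.pullback φ.toAlgHom (P2.omega k)) ≠ 0) ∧
    -- birational invariance fails
    ¬ PVIsBirationalInvariant (P2 k) 2 := by 
  have h1 := P2.isHomogeneous_X_mul_X (k := k) 1 2
  have h2 : (X 1 * X 2 : MvPolynomial (Fin 3) k) ≠ 0 := mul_ne_zero (X_ne_zero 1) (X_ne_zero 2)
  have h3 : ∃ j : Fin 3, ¬ (X 1 : MvPolynomial (Fin 3) k) ∣ X j :=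
    ⟨2, P2.not_X_dvd_X (by decide)⟩
  have h4 : ∃ j : Fin 3, ¬ (X 2 : MvPolynomial (Fin 3) k) ∣ X j :=
    ⟨1, P2.not_X_dvd_X (by decide)⟩
  have h5 : ∃ j : Fin 3, ¬ P2.conic k ∣ X j := ⟨0, P2.not_conic_dvd_X 0⟩
  refine ⟨inferInstanceAs (IsProper (P2Hom k)),
    inferInstanceAs (SmoothOfRelativeDimension 2 (P2Hom k)), P2.kodairaDimNegInfty, ?_,
    P2.omega_eq_biform_zero, P2.isPrimeDivisor_curve (isHomogeneous_X k 1) X_prime h3,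
    P2.isPrimeDivisor_curve (isHomogeneous_X k 2) X_prime h4, ?_, ?_, ?_, ?_, ?_, ?_,
    P2.not_pvIsBirationalInvariant⟩
  · rw [P2.omega_eq]
    exact P2.quadForm_ne_zero h1 h2
  · rw [P2.omega_eq]
    exact P2.divForm_quadForm_mul (isHomogeneous_X k 1) X_prime h3 (isHomogeneous_X k 2) X_prime h4
  · rw [P2.omega_eq]
    exact P2.isNormalCrossings_lines
  · rw [P2.omega_eq]
    exact P2.noLogPoles_quadForm h1 h2
  · rw [P2.omega_eq]
    exact P2.PV_lines
  · rw [P2.omega_eq]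
    exact P2.PV_lines_eq_zero
  · obtain ⟨π, hπ, hφ⟩ := P2.exists_isBirationalMap (P2.shear k)
    refine ⟨π, P2.ffEquiv (P2.shear k), hπ, hφ, P2.ffEquiv_shear_x, P2.ffEquiv_shear_y, ?_⟩
    rw [P2.pullback_shear_omega]
    exact ⟨P2.quadForm_conic, P2.quadForm_conic_eq_biform_zero,
      P2.isPrimeDivisor_curve P2.isHomogeneous_conic P2.prime_conic h5,
      P2.divForm_quadForm_of_prime P2.isHomogeneous_conic P2.prime_conic h5,
      P2.isNormalCrossings_conic,
      P2.noLogPoles_quadForm P2.isHomogeneous_conic P2.prime_conic.ne_zero,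
      P2.PV_conic, P2.PV_conic_eq, P2.PV_conic_ne_zero⟩
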